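/- A metric graph $\Gamma$ is a compact connected metric space in which every point has a neighbourhood isometric to a star-shaped set $\{te^{2k\pi i/n}: 0\le t<r,\ k\in\mathbb{Z}\}$ (with its path metric) for some $r>0$ and some $n\ge 1$. A tropical curve $T$ is the union of a metric graph and finitely many (possibly no) unbounded edges, i.e. copies of $[0,\infty]$ each glued to a point of the graph by its end $0$. Its topology is the glued topology (each unbounded edge being a copy of the compact interval $[0,\infty]$), and its extended metric is the glued one. Let $C$ be a metric graph or a tropical curve. A real structure on $C$ is a continuous isometric involution $\iota:C\to C$; $C(\mathbb{R})$ is the set of its fixed points (the real points). The genus $g$ of a graph is the number of its connected components plus the number of edges minus the number of vertices, for any choice of a finite set of vertices whose complement is a disjoint union of finitely many open intervals (the edges). Put $s(C)=\sum_i (g(C_i)+1)$, where the $C_i$ are the connected components of $C(\mathbb{R})$. One calls $C$ an M-metric graph, respectively an M-tropical curve, if $s(C)=g(C)+1$. A divisor on $C$ is a finite $\mathbb{Z}$-linear combination $D=\sum_p D(p)\,p$ of points of $C$; it is effective if all $D(p)\ge 0$, real if $D(\iota(p))=D(p)$ for all $p$, and totally real if it is real and supported on $C(\mathbb{R})$.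 A rational function on $C$ is a continuous function $f:C\to\mathbb{R}\cup\{\pm\infty\}$, with values $\pm\infty$ allowed only at the points at infinity of unbounded edges, that is piecewise affine with integer slopes and finitely many pieces on each edge; $\Delta(f)(p)$ is the sum of the slopes of $f$ in all directions emanating from $p$. (At the point at infinity of an unbounded edge on which $f(t)=c+\sigma t$ for large finite $t$, this sum is $-\sigma$.) Divisors $D_1,D_2$ are linearly equivalent if $D_2-D_1=\Delta(f)$ for some rational function $f$. Theorem. Let $C$ be an M-metric graph or an M-tropical curve. Then each real effective divisor on $C$ is linearly equivalent to a totally real effective divisor on $C$. -/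

import Mathlib

open Set Filter Topology
open scoped ENNReal

namespace RealTropical

/-! Metric graphs, tropical curves, and the notions which they share. The shared notions are
formulated for a type with a topology and an extended distance; on a metric graph the two come
from its metric, on a tropical curve the topology makes every unbounded edge a copy of the
compact interval `[0, ∞]`. -/

section General

variable {T : Type*} [TopologicalSpace T] [EDist T]

/-- `φ` identifies a neighbourhood of `p` isometrically with the star-shaped set of valence `n` and
radius `r` (with its path metric), where `φ k t` is the point `t * exp (2 * π * i * k / n)` and the
centre corresponds to `p`. -/
structure IsStarChart (p : T) (n : ℕ) (r : ℝ) (φ : Fin n → ℝ → T) : Prop where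
  valence_pos : 1 ≤ n
  radius_pos : 0 < r
  center : ∀ k, φ k 0 = p
  edist_same : ∀ k, ∀ s ∈ Ico 0 r, ∀ t ∈ Ico 0 r,
    edist (φ k s) (φ k t) = ENNReal.ofReal |s - t|
  edist_diff : ∀ k l, k ≠ l → ∀ s ∈ Ico 0 r, ∀ t ∈ Ico 0 r,
    edist (φ k s) (φ l t) = ENNReal.ofReal (s + t)
  mem_nhds : {q | ∃ k, ∃ t ∈ Ico 0 r, φ k t = q} ∈ 𝓝 p

/-- `p` is the point at infinity of an unbounded edge: `φ` identifies `(R, ∞)`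
isometrically with a punctured neighbourhood of `p`, and `p` corresponds to `∞`. -/
structure IsEndChart (p : T) (R : ℝ) (φ : ℝ → T) : Prop where
  edist_eq : ∀ s ∈ Ioi R, ∀ t ∈ Ioi R, edist (φ s) (φ t) = ENNReal.ofReal |s - t|
  edist_end : ∀ s ∈ Ioi R, edist (φ s) p = ⊤
  tendsto : Tendsto φ atTop (𝓝 p)
  mem_nhds : insert p (φ '' Ioi R) ∈ 𝓝 p

/-- Near `p`, the function `f` is affine with an integer slope in each direction emanating from
`p`, and `m` is the sum of these slopes. At a point at infinity the only
direction is the one in which the parameter of the unbounded edge decreases. -/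
def HasOrder (f : T → EReal) (p : T) (m : ℤ) : Prop :=
  (∃ (n : ℕ) (r : ℝ) (φ : Fin n → ℝ → T) (c : ℝ) (σ : Fin n → ℤ), IsStarChart p n r φ ∧
    (∀ k, ∀ t ∈ Ico 0 r, f (φ k t) = ((c + σ k * t : ℝ) : EReal)) ∧ m = ∑ k, σ k) ∨
  (∃ (R : ℝ) (φ : ℝ → T) (c : ℝ) (σ : ℤ), IsEndChart p R φ ∧
    (∀ t ∈ Ioi R, f (φ t) = ((c + σ * t : ℝ) : EReal)) ∧ m = -σ)

/-- Rational functions: continuous and piecewise affine with integer slopes. Values `±∞` are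
possible only at points at infinity. By compactness the local
condition amounts to a finite partition of each edge. -/
def IsRational (f : T → EReal) : Prop :=
  Continuous f ∧ ∀ p, ∃ m, HasOrder f p m

/-- Linear equivalence of divisors: `D₂ - D₁` is the principal divisor `Δ f` of a rational
function `f`. -/
def LinEquiv (D₁ D₂ : T →₀ ℤ) : Prop :=
  ∃ f : T → EReal, IsRational f ∧ ∀ p, HasOrder f p (D₂ p - D₁ p)

/-- The divisor `D` is effective. -/
def IsEffective (D : T →₀ ℤ) : Prop := ∀ p, 0 ≤ D p

/-- The set of connected components of a subset. -/
def components (S : Set T) : Set (Set T) := connectedComponentIn S '' S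

/-- `V` is a vertex set of the graph `S`: removing the finite set `V` leaves finitely many
open edges, each homeomorphic to an open interval. -/
structure IsVertexSet (S V : Set T) : Prop where
  subset : V ⊆ S
  finite : V.Finite
  finite_edges : (components (S \ V)).Finite
  edge : ∀ e ∈ components (S \ V), Nonempty (e ≃ₜ Ioo (0 : ℝ) 1)

open Classical in
/-- The genus `c + e - v` of the graph `S`, where `c`, `e`, `v` are the numbers of connected
components, edges and vertices, for any choice of a vertex set (on which it does not depend). -/
noncomputable def genus (S : Set T) : ℤ :=
  if h : ∃ V, IsVertexSet S V then
    (components S).ncard + (components (S \ h.choose)).ncard - h.choose.ncard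
  else 0

variable (T) in
/-- A real structure: an isometric (and continuous) involution. -/
structure RealStructure where
  conj : T → T
  conj_conj : ∀ p, conj (conj p) = p
  edist_conj : ∀ p q, edist (conj p) (conj q) = edist p q
  continuous_conj : Continuous conj

namespace RealStructure

variable (ι : RealStructure T)

/-- The set of real points. -/
def realLocus : Set T := {p | ι.conj p = p}

/-- The number `s = ∑ (g(Tᵢ) + 1)`, the sum being over the connected components `Tᵢ` of the set of
real points. -/
noncomputable def s : ℤ := ∑ᶠ C ∈ components ι.realLocus, (genus C + 1)

/-- The M-condition `s = g + 1`. -/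
def IsM : Prop := ι.s = genus (univ : Set T) + 1

/-- Real divisors are those equal to their conjugate. -/
def IsRealDivisor (D : T →₀ ℤ) : Prop := ∀ p, D (ι.conj p) = D p

/-- Totally real divisors are real divisors supported on real points. -/
def IsTotallyReal (D : T →₀ ℤ) : Prop :=
  ι.IsRealDivisor D ∧ (D.support : Set T) ⊆ ι.realLocus

end RealStructure

end General

/-- A metric graph: a compact connected metric space in which each point has a neighbourhood
isometric to a star-shaped set of some valence `n ≥ 1`. -/
structure IsMetricGraph (X : Type*) [MetricSpace X] : Prop where
  compact : CompactSpace X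
  connected : ConnectedSpace X
  star : ∀ p : X, ∃ (n : ℕ) (r : ℝ) (φ : Fin n → ℝ → X), IsStarChart p n r φ

/-- The union of `X` and of `n` unbounded edges `[0, ∞]`, the edge number `u` being glued to `X` by
identifying its end `0` with `a u`. A point of the union is encoded by the nearest point of `X`
(its `foot`) and by its coordinates on the unbounded edges, which vanish except on the
edge that contains it. -/
@[ext]
structure TropicalCurve {X : Type*} {n : ℕ} (a : Fin n → X) where
  foot : X
  coord : Fin n → ℝ≥0∞
  mem : ∀ u, coord u ≠ 0 → foot = a u ∧ ∀ v, v ≠ u → coord v = 0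

namespace TropicalCurve

variable {X : Type*} [MetricSpace X] {n : ℕ} (a : Fin n → X)

/-- The glued topology, as a subspace of `X × [0, ∞]ⁿ`. -/
instance : TopologicalSpace (TropicalCurve a) :=
  TopologicalSpace.induced (fun p ↦ (p.foot, p.coord)) inferInstance

/-- The glued extended metric: `|s - t|` for two points on one unbounded edge (`∞` if
exactly one of them is the point at infinity, `0` if both are), the distance of `X` on `X`, and
lengths add up along the paths through the attaching points. -/
noncomputable instance : EDist (TropicalCurve a) where
  edist p q := edist p.foot q.foot +
    ∑ u, ((p.coord u - q.coord u) + (q.coord u - p.coord u))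

end TropicalCurve

end RealTropical

namespace RealTropical

/-! ### Independence of the genus from the vertex set -/

section Genus

/-! The M-condition says that a certain quotient graph is a tree. Take a finite vertex set stable
under the involution, fine enough that each edge either consists of real points or is disjoint from
its conjugate. Let `c` be the number of components of the real locus, and let `v` and `e` count the
nonreal vertices and edges. Each real component contributes `g + 1 = 2 + edges - vertices` to `s`,
while `g(C) + 1 = 2 + edges - vertices` for the whole curve. The real vertices and edges cancel, and
`s = g + 1` becomes `e + 2 = 2 * c + v` (`IsAdapted.ncard_nonrealEdges`).

Now contract every real component to a point and identify conjugate points. The result is connected,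
with `c + v / 2` vertices and `e / 2` edges, that is, one more vertex than edges. So it is a tree,
and deleting a nonreal edge `J` together with its conjugate cuts the curve into two closed pieces
stable under conjugation, one at each end of `J` (`IsAdapted.exists_separation`). The quotient
itself is never built: a dimension count for functions on its vertices replaces it
(`exists_closed_separation`).

Let `J` be a short segment from `p` to `q`. The function which is constant on each piece and grows
with slope 1 along `J` and along its conjugate has divisor `(p + ι p) - (q + ι q)`. Hence a
conjugate pair can be moved locally, past branch points as well as along edges. On an unbounded
nonreal edge the tail separates without any hypothesis. The set of points whose pair is equivalent
to twice a real point is therefore open and closed. It contains the real locus, which is not empty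
since an M-curve without real points would have negative genus; so it is everything
(`IsCurve.exists_real_slopeEquiv`). Replacing the conjugate pairs of a real effective divisor one
after another proves the theorem.

Metric graphs and tropical curves are treated together as instances of `IsCurve`. The functions are
real-valued until the end, so that they can be added without `∞ - ∞`; values at infinity are
supplied in `SlopeEquiv.linEquiv`. -/

theorem nonempty_homeomorph_Ioo {a b : ℝ} (h : a < b) :
    Nonempty (Ioo a b ≃ₜ Ioo (0 : ℝ) 1) := by
  have e := (affineHomeomorph (b - a) a (sub_pos.2 h).ne').image (Ioo (0 : ℝ) 1)
  have : affineHomeomorph (b - a) a (sub_pos.2 h).ne' '' Ioo (0 : ℝ) 1 = Ioo a b := by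
    have h' : 0 < b - a := sub_pos.2 h
    ext x
    simp only [affineHomeomorph_apply, mem_image, mem_Ioo]
    constructor
    · rintro ⟨y, ⟨h0, h1⟩, rfl⟩
      constructor <;> nlinarith
    · rintro ⟨h0, h1⟩
      refine ⟨(x - a) / (b - a), ⟨by apply div_pos <;> linarith, ?_⟩, by field_simp; ring⟩
      rw [div_lt_one h']; linarith
  rw [this] at e
  exact ⟨e.symm⟩

theorem nonempty_Ioo_homeomorph_real : Nonempty (Ioo (0 : ℝ) 1 ≃ₜ ℝ) := by
  obtain ⟨e⟩ := nonempty_homeomorph_Ioo (a := -(Real.pi / 2)) (b := Real.pi / 2)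
    (by linarith [Real.pi_pos])
  exact ⟨e.symm.trans Real.tanOrderIso.toHomeomorph⟩

theorem nonempty_Ioi_homeomorph_real (c : ℝ) : Nonempty (Ioi c ≃ₜ ℝ) := by
  have e := (Homeomorph.addRight c).image (Ioi (0 : ℝ))
  have : Homeomorph.addRight c '' Ioi (0 : ℝ) = Ioi c := by
    ext x; simp
  rw [this] at e
  exact ⟨e.symm.trans Real.expOrderIso.toHomeomorph.symm⟩

theorem nonempty_Iio_homeomorph_real (c : ℝ) : Nonempty (Iio c ≃ₜ ℝ) := by
  have e := (Homeomorph.neg ℝ).image (Ioi (-c))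
  have : Homeomorph.neg ℝ '' Ioi (-c) = Iio c := by
    ext x; simp
  rw [this] at e
  obtain ⟨e'⟩ := nonempty_Ioi_homeomorph_real (-c)
  exact ⟨e.symm.trans e'⟩

variable {T : Type*} [TopologicalSpace T]

theorem eq_connectedComponentIn_of_mem_components {S C : Set T} (hC : C ∈ components S) {x : T}
    (hx : x ∈ C) : C = connectedComponentIn S x := by
  obtain ⟨y, -, rfl⟩ := hC
  exact connectedComponentIn_eq hx

theorem connectedComponentIn_mem_components {S : Set T} {x : T} (hx : x ∈ S) :
    connectedComponentIn S x ∈ components S := ⟨x, hx, rfl⟩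

theorem subset_of_mem_components {S C : Set T} (hC : C ∈ components S) : C ⊆ S := by
  obtain ⟨y, -, rfl⟩ := hC
  exact connectedComponentIn_subset S y

theorem nonempty_of_mem_components {S C : Set T} (hC : C ∈ components S) : C.Nonempty := by
  obtain ⟨y, hy, rfl⟩ := hC
  exact ⟨y, mem_connectedComponentIn hy⟩

theorem isPreconnected_of_mem_components {S C : Set T} (hC : C ∈ components S) :
    IsPreconnected C := by
  obtain ⟨y, hy, rfl⟩ := hC
  exact isPreconnected_connectedComponentIn

theorem eq_of_mem_components {S C C' : Set T} (hC : C ∈ components S) (hC' : C' ∈ components S)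
    {x : T} (hx : x ∈ C) (hx' : x ∈ C') : C = C' :=
  (eq_connectedComponentIn_of_mem_components hC hx).trans
    (eq_connectedComponentIn_of_mem_components hC' hx').symm

/-- Removing a point from an edge splits it into two edges. -/
theorem components_diff_insert {S V : Set T} (hV : IsVertexSet S V) {x : T} (hx : x ∈ S \ V) :
    ∃ e e₁ e₂, e ∈ components (S \ V) ∧ e₁ ≠ e₂ ∧ e₁ ∉ components (S \ V) ∧
      e₂ ∉ components (S \ V) ∧
      components (S \ insert x V) = (components (S \ V) \ {e}) ∪ {e₁, e₂} ∧
      Nonempty (e₁ ≃ₜ Ioo (0 : ℝ) 1) ∧ Nonempty (e₂ ≃ₜ Ioo (0 : ℝ) 1) := by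
  obtain ⟨eR⟩ := nonempty_Ioo_homeomorph_real
  set e := connectedComponentIn (S \ V) x with he
  have hemem : e ∈ components (S \ V) := connectedComponentIn_mem_components hx
  have hxe : x ∈ e := mem_connectedComponentIn hx
  obtain ⟨h⟩ := hV.edge e hemem
  let k : ℝ ≃ₜ e := (h.trans eR).symm
  let j : ℝ → T := fun t ↦ k t
  have hj : IsEmbedding j := IsEmbedding.subtypeVal.comp k.isEmbedding
  have hrange : range j = e := by
    ext y
    constructor
    · rintro ⟨t, rfl⟩; exact (k t).2
    · intro hy; exact ⟨k.symm ⟨y, hy⟩, by simp [j]⟩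
  obtain ⟨c, hc⟩ : ∃ c, j c = x := by rw [← hrange] at hxe; exact hxe
  have heS : e ⊆ S \ V := subset_of_mem_components hemem
  have hsub : ∀ s : Set ℝ, c ∉ s → j '' s ⊆ S \ insert x V := by
    rintro s hs _ ⟨t, ht, rfl⟩
    have h1 : j t ∈ S \ V := heS (hrange ▸ mem_range_self t)
    refine ⟨h1.1, ?_⟩
    rintro (h2 | h2)
    · rw [← hc] at h2
      exact hs (hj.injective h2 ▸ ht)
    · exact h1.2 h2
  have hmono : S \ insert x V ⊆ S \ V := sdiff_subset_sdiff_right (subset_insert _ _)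
  have hcomp_sub : ∀ t, connectedComponentIn (S \ insert x V) (j t) ⊆ e := by
    intro t
    have h1 : j t ∈ e := hrange ▸ mem_range_self t
    rw [eq_connectedComponentIn_of_mem_components hemem h1]
    exact connectedComponentIn_mono _ hmono
  -- In the coordinate `j` of the edge `e`, a component of the remaining set is an order-convex set
  -- of reals which avoids `c`, so it stays on one side of `c`. This yields the two half-edges.
  have hord : ∀ t, (j ⁻¹' connectedComponentIn (S \ insert x V) (j t)).OrdConnected := by
    intro t
    refine IsPreconnected.ordConnected ?_
    rw [← hj.isInducing.isPreconnected_image, image_preimage_eq_inter_range,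
      inter_eq_left.2 (by rw [hrange]; exact hcomp_sub t)]
    exact isPreconnected_connectedComponentIn
  have hcnot : ∀ t, c ∉ j ⁻¹' connectedComponentIn (S \ insert x V) (j t) := by
    intro t h1
    have := connectedComponentIn_subset _ _ h1
    rw [hc] at this
    exact this.2 (mem_insert _ _)
  have hmemself : ∀ t, t ≠ c → t ∈ j ⁻¹' connectedComponentIn (S \ insert x V) (j t) := by
    intro t ht
    exact mem_connectedComponentIn (hsub {t} (by simpa using ht.symm) (mem_image_of_mem _ rfl))
  have h1 : ∀ t < c, connectedComponentIn (S \ insert x V) (j t) = j '' Iio c := by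
    intro t ht
    apply Subset.antisymm
    · intro y hy
      obtain ⟨s, rfl⟩ : y ∈ range j := hrange ▸ hcomp_sub t hy
      refine mem_image_of_mem _ ?_
      by_contra hs
      exact hcnot t ((hord t).out (hmemself t ht.ne) hy ⟨ht.le, not_lt.1 hs⟩)
    · exact (isPreconnected_Iio.image j hj.continuous.continuousOn).subset_connectedComponentIn
        (mem_image_of_mem _ ht) (hsub _ (by simp))
  have h2 : ∀ t > c, connectedComponentIn (S \ insert x V) (j t) = j '' Ioi c := by
    intro t ht
    apply Subset.antisymm
    · intro y hy
      obtain ⟨s, rfl⟩ : y ∈ range j := hrange ▸ hcomp_sub t hy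
      refine mem_image_of_mem _ ?_
      by_contra hs
      exact hcnot t ((hord t).out hy (hmemself t (ne_of_gt ht)) ⟨not_lt.1 hs, le_of_lt ht⟩)
    · exact (isPreconnected_Ioi.image j hj.continuous.continuousOn).subset_connectedComponentIn
        (mem_image_of_mem _ ht) (hsub _ (by simp))
  have hnot : ∀ s : Set ℝ, s.Nonempty → c ∉ s → j '' s ∉ components (S \ V) := by
    rintro s ⟨t, ht⟩ hs hmem
    have h3 : j '' s = e := eq_of_mem_components hmem hemem (mem_image_of_mem j ht)
      (hrange ▸ mem_range_self t)
    rw [← h3, ← hc] at hxe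
    obtain ⟨t', ht', h4⟩ := hxe
    exact hs (hj.injective h4 ▸ ht')
  refine ⟨e, j '' Iio c, j '' Ioi c, hemem, ?_, hnot _ ⟨c - 1, by simp⟩ (by simp),
    hnot _ ⟨c + 1, by simp⟩ (by simp), ?_, ?_, ?_⟩
  · intro h3
    have h4 : j (c - 1) ∈ j '' Ioi c := h3 ▸ mem_image_of_mem j (by simp)
    obtain ⟨t, ht, h5⟩ := h4
    have := hj.injective h5
    simp only [mem_Ioi] at ht
    linarith
  -- The other edges do not contain `x` and survive unchanged.
  · have hother : ∀ z ∈ S \ V, z ∉ e →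
        connectedComponentIn (S \ insert x V) z = connectedComponentIn (S \ V) z := by
      intro z hz hze
      apply Subset.antisymm (connectedComponentIn_mono _ hmono)
      refine isPreconnected_connectedComponentIn.subset_connectedComponentIn
        (mem_connectedComponentIn hz) fun y hy ↦ ?_
      have hy' := connectedComponentIn_subset _ _ hy
      refine ⟨hy'.1, ?_⟩
      rintro (rfl | h3)
      · exact hze (eq_of_mem_components (connectedComponentIn_mem_components hz) hemem hy hxe ▸
          mem_connectedComponentIn hz)
      · exact hy'.2 h3
    apply Subset.antisymm
    · rintro _ ⟨z, hz, rfl⟩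
      by_cases hze : z ∈ e
      · obtain ⟨t, rfl⟩ : z ∈ range j := hrange ▸ hze
        right
        rcases lt_trichotomy t c with h3 | h3 | h3
        · left; exact h1 t h3
        · rw [h3, hc] at hz; exact absurd (mem_insert _ _) hz.2
        · right; exact h2 t h3
      · left
        rw [hother z (hmono hz) hze]
        refine ⟨connectedComponentIn_mem_components (hmono hz), fun h3 ↦ hze ?_⟩
        rw [mem_singleton_iff] at h3
        rw [← h3]; exact mem_connectedComponentIn (hmono hz)
    · rintro e' (⟨⟨z, hz, rfl⟩, h3⟩ | rfl | rfl)
      · have hze : z ∉ e := fun h4 ↦ h3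
          (eq_connectedComponentIn_of_mem_components hemem h4).symm
        rw [← hother z hz hze]
        refine connectedComponentIn_mem_components ⟨hz.1, ?_⟩
        rintro (rfl | h4)
        · exact hze hxe
        · exact hz.2 h4
      · rw [← h1 (c - 1) (by linarith)]
        exact connectedComponentIn_mem_components
          (hsub {c - 1} (fun h ↦ by rw [mem_singleton_iff] at h; linarith) (mem_image_of_mem _ rfl))
      · rw [← h2 (c + 1) (by linarith)]
        exact connectedComponentIn_mem_components (hsub {c + 1} (by simp) (mem_image_of_mem _ rfl))
  · obtain ⟨e'⟩ := nonempty_Iio_homeomorph_real c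
    exact ⟨((hj.homeomorphImage (Iio c)).symm.trans e').trans eR.symm⟩
  · obtain ⟨e'⟩ := nonempty_Ioi_homeomorph_real c
    exact ⟨((hj.homeomorphImage (Ioi c)).symm.trans e').trans eR.symm⟩

/-- One edge is replaced by its two halves while one vertex is added, so edges minus vertices does
not change. -/
theorem IsVertexSet.insert {S V : Set T} (hV : IsVertexSet S V) {x : T} (hx : x ∈ S \ V) :
    IsVertexSet S (insert x V) ∧
      ((components (S \ insert x V)).ncard : ℤ) - (insert x V).ncard =
        (components (S \ V)).ncard - V.ncard := by
  obtain ⟨e, e₁, e₂, he, hne, h1, h2, hcomp, hh1, hh2⟩ := components_diff_insert hV hx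
  have hfin := hV.finite_edges
  refine ⟨⟨insert_subset hx.1 hV.subset, hV.finite.insert x, ?_, ?_⟩, ?_⟩
  · rw [hcomp]
    exact (hfin.sdiff).union (toFinite _)
  · rw [hcomp]
    rintro e' (⟨h3, -⟩ | rfl | rfl)
    · exact hV.edge e' h3
    · exact hh1
    · exact hh2
  · rw [hcomp, ncard_insert_of_notMem hx.2 hV.finite, ncard_union_eq _ hfin.sdiff (toFinite _),
      ncard_pair hne]
    · have := ncard_sdiff_singleton_add_one he hfin
      push_cast
      linarith
    · rw [disjoint_left]
      rintro e' ⟨h3, -⟩ (rfl | rfl)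
      · exact h1 h3
      · exact h2 h3

theorem IsVertexSet.union {S V W : Set T} (hV : IsVertexSet S V) (hW : W.Finite) (hWS : W ⊆ S) :
    IsVertexSet S (V ∪ W) ∧
      ((components (S \ (V ∪ W))).ncard : ℤ) - (V ∪ W).ncard =
        (components (S \ V)).ncard - V.ncard := by
  induction W, hW using Set.Finite.induction_on with
  | empty => simpa using hV
  | @insert x W hx hW ih =>
    obtain ⟨ih1, ih2⟩ := ih ((subset_insert _ _).trans hWS)
    rw [union_insert]
    by_cases hxV : x ∈ V ∪ W
    · rw [insert_eq_of_mem hxV]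
      exact ⟨ih1, ih2⟩
    · obtain ⟨h1, h2⟩ := ih1.insert (x := x) ⟨hWS (mem_insert _ _), hxV⟩
      exact ⟨h1, h2.trans ih2⟩

/-- `genus` is defined through a chosen vertex set; this set and `V` are compared with their union,
which refines both. -/
theorem IsVertexSet.genus_eq {S V : Set T} (hV : IsVertexSet S V) :
    genus S = (components S).ncard + (components (S \ V)).ncard - V.ncard := by
  have h : ∃ V, IsVertexSet S V := ⟨V, hV⟩
  rw [genus, dif_pos h]
  have h1 := (hV.union h.choose_spec.finite h.choose_spec.subset).2
  have h2 := (h.choose_spec.union hV.finite hV.subset).2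
  rw [union_comm] at h2
  linarith

end Genus

/-! ### Curves: the common properties of metric graphs and tropical curves -/

section Curve

variable {T : Type*} [TopologicalSpace T] [EDist T]

/-- The neighbourhoods of `p` are given by the extended distance. -/
def BallNhds (p : T) : Prop :=
  ∀ U : Set T, U ∈ 𝓝 p ↔ ∃ ε : ℝ, 0 < ε ∧ ∀ q, edist p q < ENNReal.ofReal ε → q ∈ U

/-- `φ` parametrizes an end at `p`, and all its tails are open end charts. -/
structure IsRay (p : T) (R : ℝ) (φ : ℝ → T) : Prop where
  chart : ∀ S ≥ R, IsEndChart p S φ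
  isOpen : ∀ S ≥ R, IsOpen (φ '' Ioi S)

variable (T) in
/-- The properties shared by metric graphs and tropical curves: each point is the centre of a star
or a point at infinity. -/
structure IsCurve : Prop where
  compact : CompactSpace T
  t2 : T2Space T
  connected : ConnectedSpace T
  edist_self : ∀ p : T, edist p p = 0
  edist_comm : ∀ p q : T, edist p q = edist q p
  edist_triangle : ∀ p q r : T, edist p r ≤ edist p q + edist q r
  chart : ∀ p : T, (BallNhds p ∧ ∃ n r φ, IsStarChart p n r φ) ∨
    ((∀ x ≠ p, edist x p = ⊤) ∧ ∃ R φ, IsRay p R φ)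

theorem IsStarChart.edist_center {p : T} {n : ℕ} {r : ℝ} {φ : Fin n → ℝ → T}
    (h : IsStarChart p n r φ) (k : Fin n) {t : ℝ} (ht : t ∈ Ico 0 r) :
    edist p (φ k t) = ENNReal.ofReal t := by
  rw [← h.center k, h.edist_same k 0 ⟨le_rfl, h.radius_pos⟩ t ht, zero_sub, abs_neg,
    abs_of_nonneg ht.1]

theorem BallNhds.ball_mem {p : T} (hp : BallNhds p) {ε : ℝ} (hε : 0 < ε) :
    {q | edist p q < ENNReal.ofReal ε} ∈ 𝓝 p :=
  (hp _).2 ⟨ε, hε, fun _ h ↦ h⟩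

/-- A small ball around the centre of a star is a star. -/
theorem IsStarChart.exists_ball {p : T} {n : ℕ} {r : ℝ} {φ : Fin n → ℝ → T}
    (h : IsStarChart p n r φ) (hp : BallNhds p) :
    ∃ ρ, 0 < ρ ∧ ρ ≤ r ∧ ∀ q, ∀ ε ≤ ρ, edist p q < ENNReal.ofReal ε →
      ∃ k, ∃ t ∈ Ico 0 ε, φ k t = q := by
  obtain ⟨ε, hε, h1⟩ := (hp _).1 h.mem_nhds
  refine ⟨min ε r, lt_min hε h.radius_pos, min_le_right _ _, fun q δ hδ hq ↦ ?_⟩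
  obtain ⟨k, t, ht, rfl⟩ := h1 q (hq.trans_le (ENNReal.ofReal_le_ofReal
    (hδ.trans (min_le_left _ _))))
  rw [h.edist_center k ht] at hq
  exact ⟨k, t, ⟨ht.1, (ENNReal.ofReal_lt_ofReal_iff_of_nonneg ht.1).1 hq⟩, rfl⟩

theorem IsStarChart.shrink {p : T} {n : ℕ} {r ρ : ℝ} {φ : Fin n → ℝ → T}
    (h : IsStarChart p n r φ) (hp : BallNhds p) (hρ : 0 < ρ) (hr : ρ ≤ r) :
    IsStarChart p n ρ φ := by
  have hI : Ico 0 ρ ⊆ Ico 0 r := Ico_subset_Ico_right hr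
  refine ⟨h.valence_pos, hρ, h.center, fun k s hs t ht ↦ h.edist_same k s (hI hs) t (hI ht),
    fun k l hkl s hs t ht ↦ h.edist_diff k l hkl s (hI hs) t (hI ht), ?_⟩
  obtain ⟨ρ₀, h0, -, h1⟩ := h.exists_ball hp
  refine (hp _).2 ⟨min ρ₀ ρ, lt_min h0 hρ, fun q hq ↦ ?_⟩
  obtain ⟨k, t, ht, rfl⟩ := h1 q _ (min_le_left _ _) hq
  exact ⟨k, t, ⟨ht.1, ht.2.trans_le (min_le_right _ _)⟩, rfl⟩

/-- Paths between different legs pass through the centre and have length `s + t`, so anything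
shorter stays on one leg. -/
theorem IsStarChart.index_eq {p : T} {n : ℕ} {r : ℝ} {φ : Fin n → ℝ → T}
    (h : IsStarChart p n r φ) {k l : Fin n} {s t : ℝ} (hs : s ∈ Ico 0 r) (ht : t ∈ Ico 0 r)
    (hst : edist (φ k s) (φ l t) < ENNReal.ofReal (s + t)) : k = l := by
  by_contra hkl
  rw [h.edist_diff k l hkl s hs t ht] at hst
  exact lt_irrefl _ hst

/-- The distance to the centre determines the parameter. The condition `0 < s` excludes the centre,
which lies on all legs. -/
theorem IsCurve.eq_index (hT : IsCurve T) {p : T} {n : ℕ} {r : ℝ} {φ : Fin n → ℝ → T}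
    (h : IsStarChart p n r φ) {k l : Fin n} {s t : ℝ} (hs : s ∈ Ico 0 r) (ht : t ∈ Ico 0 r)
    (h0 : 0 < s) (hst : φ k s = φ l t) : k = l ∧ s = t := by
  have h1 : s = t := by
    have := h.edist_center k hs
    rw [hst, h.edist_center l ht] at this
    exact ((ENNReal.ofReal_eq_ofReal_iff ht.1 hs.1).1 this).symm
  refine ⟨h.index_eq hs ht ?_, h1⟩
  rw [hst, hT.edist_self]
  exact ENNReal.ofReal_pos.2 (by linarith [ht.1])

/-- The point at distance `t` on a leg of the first chart lies at distance `t` on some leg of the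
second. This leg does not depend on `t`, because two points on one leg are closer than the sum of
their distances to the centre. -/
theorem IsStarChart.exists_leg_map (hT : IsCurve T) {p : T} {n n' : ℕ} {r r' : ℝ}
    {φ : Fin n → ℝ → T}
    {φ' : Fin n' → ℝ → T} (h : IsStarChart p n r φ) (h' : IsStarChart p n' r' φ')
    (hp : BallNhds p) :
    ∃ ρ, 0 < ρ ∧ ρ ≤ r ∧ ρ ≤ r' ∧ ∃ e : Fin n → Fin n', Function.Injective e ∧
      ∀ k, ∀ t ∈ Ico 0 ρ, φ k t = φ' (e k) t := by
  obtain ⟨ρ', h0', hr', h1'⟩ := h'.exists_ball hp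
  set ρ := min ρ' r with hρ
  have hρ0 : 0 < ρ := lt_min h0' h.radius_pos
  have hρr : ρ ≤ r := min_le_right _ _
  have hρr' : ρ ≤ r' := (min_le_left _ _).trans hr'
  have key : ∀ k, ∀ t ∈ Ico 0 ρ, ∃ l, φ k t = φ' l t := by
    intro k t ht
    have ht1 : t ∈ Ico 0 r := ⟨ht.1, ht.2.trans_le hρr⟩
    obtain ⟨l, t', ht', h2⟩ := h1' (φ k t) ρ (min_le_left _ _) (by
      rw [h.edist_center k ht1]
      exact (ENNReal.ofReal_lt_ofReal_iff hρ0).2 ht.2)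
    have h3 : t' = t := by
      have h4 := h'.edist_center l (t := t') ⟨ht'.1, ht'.2.trans_le hρr'⟩
      rw [h2, h.edist_center k ht1] at h4
      exact ((ENNReal.ofReal_eq_ofReal_iff ht.1 ht'.1).1 h4).symm
    exact ⟨l, by rw [← h2, h3]⟩
  have hh : ρ / 2 ∈ Ico 0 ρ := ⟨by linarith, by linarith⟩
  have hI : ∀ t ∈ Ico 0 ρ, t ∈ Ico 0 r ∧ t ∈ Ico 0 r' := fun t ht ↦
    ⟨⟨ht.1, ht.2.trans_le hρr⟩, ⟨ht.1, ht.2.trans_le hρr'⟩⟩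
  -- The target leg is read off at the parameter `ρ / 2`.
  choose e he using fun k ↦ key k (ρ / 2) hh
  refine ⟨ρ, hρ0, hρr, hρr', e, fun k l hkl ↦ ?_, fun k t ht ↦ ?_⟩
  · exact (hT.eq_index h (hI _ hh).1 (hI _ hh).1 (by linarith)
      (by rw [he, he, hkl])).1
  · rcases ht.1.eq_or_lt with rfl | h0
    · rw [h.center, h'.center]
    · obtain ⟨l, hl⟩ := key k t ht
      have : e k = l := by
        refine h'.index_eq (hI _ hh).2 (hI _ ht).2 ?_
        rw [← hl, ← he, h.edist_same k _ (hI _ hh).1 _ (hI _ ht).1]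
        refine (ENNReal.ofReal_lt_ofReal_iff (by linarith)).2 ?_
        rw [abs_lt]; constructor <;> linarith
      rw [this, hl]

/-- Two star charts with the same centre agree near it, up to a permutation of the legs. -/
theorem IsStarChart.exists_equiv (hT : IsCurve T) {p : T} {n n' : ℕ} {r r' : ℝ}
    {φ : Fin n → ℝ → T}
    {φ' : Fin n' → ℝ → T} (h : IsStarChart p n r φ) (h' : IsStarChart p n' r' φ')
    (hp : BallNhds p) :
    ∃ ρ, 0 < ρ ∧ ρ ≤ r ∧ ρ ≤ r' ∧ ∃ e : Fin n ≃ Fin n',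
      ∀ k, ∀ t ∈ Ico 0 ρ, φ k t = φ' (e k) t := by
  obtain ⟨ρ, h0, h1, h2, e, he, h3⟩ := h.exists_leg_map hT h' hp
  obtain ⟨-, -, -, -, e', he', -⟩ := h'.exists_leg_map hT h hp
  have hb : Function.Bijective e := by
    rw [Fintype.bijective_iff_injective_and_card]
    exact ⟨he, le_antisymm (Fintype.card_le_of_injective e he)
      (Fintype.card_le_of_injective e' he')⟩
  exact ⟨ρ, h0, h1, h2, Equiv.ofBijective e hb, h3⟩

theorem IsRay.mono {p : T} {R S : ℝ} {φ : ℝ → T} (h : IsRay p R φ) (hS : R ≤ S) :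
    IsRay p S φ :=
  ⟨fun S' h' ↦ h.chart S' (hS.trans h'), fun S' h' ↦ h.isOpen S' (hS.trans h')⟩

theorem IsRay.endChart {p : T} {R : ℝ} {φ : ℝ → T} (h : IsRay p R φ) : IsEndChart p R φ :=
  h.chart R le_rfl

theorem IsCurve.ray_ne (hT : IsCurve T) {p : T} {R : ℝ} {φ : ℝ → T} (h : IsRay p R φ) {t : ℝ}
    (ht : R < t) : φ t ≠ p := by
  intro h1
  have := h.endChart.edist_end t ht
  rw [h1, hT.edist_self] at this
  exact ENNReal.zero_ne_top this

theorem IsCurve.ray_injOn (hT : IsCurve T) {p : T} {R : ℝ} {φ : ℝ → T} (h : IsRay p R φ) :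
    InjOn φ (Ioi R) := by
  intro s hs t ht hst
  have := h.endChart.edist_eq s hs t ht
  rw [hst, hT.edist_self, eq_comm, ENNReal.ofReal_eq_zero] at this
  exact sub_eq_zero.1 (abs_nonpos_iff.1 this)

/-- Two rays with the same end agree near it, up to a shift. -/
theorem IsRay.exists_shift (hT : IsCurve T) {p : T} {R R' : ℝ} {φ φ' : ℝ → T} (h : IsRay p R φ)
    (h' : IsRay p R' φ') :
    ∃ S c, R ≤ S ∧ R' ≤ S + c ∧ ∀ t > S, φ t = φ' (t + c) := by
  have hev : ∀ M ≥ R', ∀ᶠ t in atTop, ∃ s > M, φ' s = φ t := by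
    intro M hM
    filter_upwards [h.endChart.tendsto (h'.chart M hM).mem_nhds, eventually_gt_atTop R] with t ht hR
    rcases ht with ht | ht
    · exact absurd ht (hT.ray_ne h hR)
    · exact ht
  obtain ⟨S, hS⟩ := ((hev R' le_rfl).and (eventually_ge_atTop R)).exists_forall_of_atTop
  have hSR : R ≤ S := (hS S le_rfl).2
  choose! τ hτ1 hτ2 using fun t (ht : S < t) ↦ (hS t ht.le).1
  have hiso : ∀ s > S, ∀ t > S, |τ s - τ t| = |s - t| := by
    intro s hs t ht
    have h1 := h'.endChart.edist_eq _ (hτ1 s hs) _ (hτ1 t ht)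
    rw [hτ2 s hs, hτ2 t ht, h.endChart.edist_eq _ (hSR.trans_lt hs) _ (hSR.trans_lt ht)] at h1
    exact ((ENNReal.ofReal_eq_ofReal_iff (abs_nonneg _) (abs_nonneg _)).1 h1).symm
  have hlim : ∀ M, ∀ᶠ t in atTop, M < τ t := by
    intro M
    filter_upwards [hev (max M R') (le_max_right _ _), eventually_gt_atTop S] with t ⟨s, hs, hst⟩ ht
    have : s = τ t := hT.ray_injOn h' ((le_max_right M R').trans_lt hs) (hτ1 t ht)
      (hst.trans (hτ2 t ht).symm)
    exact this ▸ (le_max_left M R').trans_lt hs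
  -- The coordinate change `τ` is isometric and tends to infinity. For large `u` both absolute
  -- values have a positive argument, so `τ u - τ t = u - t`. Comparing two values of `t` at a
  -- common `u` shows that `τ` is a shift.
  have hshift : ∀ t > S, ∀ᶠ u in atTop, τ t - t = τ u - u := by
    intro t ht
    filter_upwards [hlim (τ t), eventually_gt_atTop t] with u hu hut
    have := hiso u (ht.trans hut) t ht
    rw [abs_of_pos (by linarith), abs_of_pos (by linarith)] at this
    linarith
  have hconst : ∀ s > S, ∀ t > S, τ s - s = τ t - t := by
    intro s hs t ht
    obtain ⟨u, hu1, hu2⟩ := ((hshift s hs).and (hshift t ht)).exists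
    rw [hu1, hu2]
  have hS1 : S + 1 > S := by linarith
  refine ⟨S + 1, τ (S + 1) - (S + 1), by linarith, by linarith [hτ1 _ hS1], fun t ht ↦ ?_⟩
  have ht' : t > S := by linarith
  rw [← hconst t ht' _ hS1, ← hτ2 t ht']
  congr 1; ring

theorem IsCurve.not_ray_of_star (hT : IsCurve T) {p : T} {n : ℕ} {r : ℝ} {φ : Fin n → ℝ → T}
    (h : IsStarChart p n r φ) (hp : ∀ x ≠ p, edist x p = ⊤) : False := by
  have h0 := h.radius_pos
  have ht : r / 2 ∈ Ico 0 r := ⟨by linarith, by linarith⟩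
  have h1 := h.edist_center ⟨0, h.valence_pos⟩ ht
  have h2 : φ ⟨0, h.valence_pos⟩ (r / 2) ≠ p := by
    intro h2
    rw [h2, hT.edist_self, eq_comm, ENNReal.ofReal_eq_zero] at h1
    linarith
  rw [hT.edist_comm, hp _ h2] at h1
  exact ENNReal.ofReal_ne_top h1.symm

/-- Points at infinity have infinite distance from all others. This gives metric neighbourhoods at
all points of legs and at all finite points of rays. -/
theorem IsCurve.star_of_ne_top (hT : IsCurve T) {p x : T} (hx : x ≠ p) (h : edist x p ≠ ⊤) :
    BallNhds p ∧ ∃ n r φ, IsStarChart p n r φ :=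
  (hT.chart p).resolve_right fun h' ↦ h (h'.1 x hx)

/-! ### Slopes of real-valued functions -/

/-- The function `g` is affine with integral slopes near `p`, and `m` is the sum of these slopes. At
points at infinity the value of `g` is irrelevant. -/
def HasSlope (g : T → ℝ) (p : T) (m : ℤ) : Prop :=
  (BallNhds p ∧ ∃ (n : ℕ) (r : ℝ) (φ : Fin n → ℝ → T) (c : ℝ) (σ : Fin n → ℤ),
    IsStarChart p n r φ ∧ (∀ k, ∀ t ∈ Ico 0 r, g (φ k t) = c + σ k * t) ∧ m = ∑ k, σ k) ∨
  ((∀ x ≠ p, edist x p = ⊤) ∧ ∃ (R : ℝ) (φ : ℝ → T) (c : ℝ) (σ : ℤ), IsRay p R φ ∧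
    (∀ t ∈ Ioi R, g (φ t) = c + σ * t) ∧ m = -σ)

/-- Two charts at `p` agree near it up to a permutation of legs or a shift, so the slopes of `g'`
can be read in the chart of `g`. At infinity the values are ignored and only the slopes add up. -/
theorem HasSlope.add (hT : IsCurve T) {g g' : T → ℝ} {p : T} {m m' : ℤ} (h : HasSlope g p m)
    (h' : HasSlope g' p m') : HasSlope (fun x ↦ g x + g' x) p (m + m') := by
  rcases h with ⟨hp, n, r, φ, c, σ, hφ, hg, rfl⟩ | ⟨hp, R, φ, c, σ, hφ, hg, rfl⟩
  · rcases h' with ⟨-, n', r', φ', c', σ', hφ', hg', rfl⟩ | ⟨hp', -⟩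
    · obtain ⟨ρ, h0, h1, h2, e, he⟩ := hφ.exists_equiv hT hφ' hp
      refine Or.inl ⟨hp, n, ρ, φ, c + c', fun k ↦ σ k + σ' (e k), hφ.shrink hp h0 h1, ?_, ?_⟩
      · intro k t ht
        beta_reduce
        rw [hg k t ⟨ht.1, ht.2.trans_le h1⟩, he k t ht, hg' (e k) t ⟨ht.1, ht.2.trans_le h2⟩]
        push_cast; ring
      · rw [Finset.sum_add_distrib, Equiv.sum_comp e σ']
    · exact (hT.not_ray_of_star hφ hp').elim
  · rcases h' with ⟨hp', n', r', φ', c', σ', hφ', hg', rfl⟩ | ⟨hp', R', φ', c', σ', hφ', hg', rfl⟩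
    · exact (hT.not_ray_of_star hφ' hp).elim
    · obtain ⟨S, d, h1, h2, h3⟩ := hφ.exists_shift hT hφ'
      refine Or.inr ⟨hp, S, φ, c + c' + σ' * d, σ + σ', hφ.mono h1, fun t ht ↦ ?_, by ring⟩
      have ht' : S < t := ht
      beta_reduce
      rw [hg t (h1.trans_lt ht'), h3 t ht, hg' (t + d) (show R' < t + d by linarith)]
      push_cast; ring

theorem HasSlope.neg {g : T → ℝ} {p : T} {m : ℤ} (h : HasSlope g p m) :
    HasSlope (fun x ↦ -g x) p (-m) := by
  rcases h with ⟨hp, n, r, φ, c, σ, hφ, hg, rfl⟩ | ⟨hp, R, φ, c, σ, hφ, hg, rfl⟩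
  · refine Or.inl ⟨hp, n, r, φ, -c, fun k ↦ -σ k, hφ, fun k t ht ↦ ?_, by simp⟩
    beta_reduce
    rw [hg k t ht]; push_cast; ring
  · refine Or.inr ⟨hp, R, φ, -c, -σ, hφ, fun t ht ↦ ?_, by simp⟩
    beta_reduce
    rw [hg t ht]; push_cast; ring

/-- A function which is constant near `p` has slope `0`. -/
theorem IsCurve.hasSlope_zero (hT : IsCurve T) {g : T → ℝ} {p : T} {c : ℝ}
    (h : ∀ᶠ x in 𝓝 p, g x = c) : HasSlope g p 0 := by
  rcases hT.chart p with ⟨hp, n, r, φ, hφ⟩ | ⟨hp, R, φ, hφ⟩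
  · obtain ⟨ε, hε, h1⟩ := (hp _).1 h
    have h2 : 0 < min ε r := lt_min hε hφ.radius_pos
    refine Or.inl ⟨hp, n, min ε r, φ, c, fun _ ↦ 0, hφ.shrink hp h2 (min_le_right _ _), ?_,
      by simp⟩
    intro k t ht
    have ht' := lt_min_iff.1 ht.2
    have := h1 (φ k t) (by
      rw [hφ.edist_center k ⟨ht.1, ht'.2⟩]
      exact (ENNReal.ofReal_lt_ofReal_iff hε).2 ht'.1)
    simpa using this
  · obtain ⟨S, hS⟩ := (hφ.endChart.tendsto.eventually h).exists_forall_of_atTop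
    refine Or.inr ⟨hp, max R S, φ, c, 0, hφ.mono (le_max_left _ _), fun t ht ↦ ?_, by simp⟩
    simpa using hS t ((le_max_right _ _).trans (le_of_lt ht))

/-! ### The involution -/

variable (ι : RealStructure T)

/-- The involution of a real structure as a homeomorphism. -/
def RealStructure.homeo : T ≃ₜ T where
  toFun := ι.conj
  invFun := ι.conj
  left_inv := ι.conj_conj
  right_inv := ι.conj_conj
  continuous_toFun := ι.continuous_conj
  continuous_invFun := ι.continuous_conj

theorem RealStructure.injective : Function.Injective ι.conj := ι.homeo.injective

theorem RealStructure.image_conj (s : Set T) : ι.conj '' s = ι.conj ⁻¹' s :=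
  ι.homeo.image_eq_preimage_symm s

theorem RealStructure.mem_nhds {p : T} {s : Set T} (h : s ∈ 𝓝 p) :
    ι.conj '' s ∈ 𝓝 (ι.conj p) := ι.homeo.isOpenMap.image_mem_nhds h

theorem RealStructure.isOpen_image {s : Set T} (h : IsOpen s) : IsOpen (ι.conj '' s) :=
  ι.homeo.isOpenMap s h

theorem RealStructure.isClosed_image {s : Set T} (h : IsClosed s) : IsClosed (ι.conj '' s) :=
  ι.homeo.isClosedMap s h

theorem IsStarChart.conj {p : T} {n : ℕ} {r : ℝ} {φ : Fin n → ℝ → T} (h : IsStarChart p n r φ) :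
    IsStarChart (ι.conj p) n r (fun k t ↦ ι.conj (φ k t)) := by
  refine ⟨h.valence_pos, h.radius_pos, fun k ↦ by rw [h.center k], fun k s hs t ht ↦ ?_,
    fun k l hkl s hs t ht ↦ ?_, ?_⟩
  · rw [ι.edist_conj, h.edist_same k s hs t ht]
  · rw [ι.edist_conj, h.edist_diff k l hkl s hs t ht]
  · refine mem_of_superset (ι.mem_nhds h.mem_nhds) ?_
    rintro _ ⟨_, ⟨k, t, ht, rfl⟩, rfl⟩
    exact ⟨k, t, ht, rfl⟩

theorem BallNhds.conj {p : T} (h : BallNhds p) : BallNhds (ι.conj p) := by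
  intro U
  have : U ∈ 𝓝 (ι.conj p) ↔ ι.conj ⁻¹' U ∈ 𝓝 p := by
    constructor
    · exact fun hU ↦ ι.continuous_conj.continuousAt hU
    · intro hU
      have := ι.mem_nhds hU
      rwa [ι.image_conj, ← preimage_comp, show ι.conj ∘ ι.conj = id from funext ι.conj_conj] at this
  rw [this, h]
  refine exists_congr fun ε ↦ and_congr_right fun _ ↦ ⟨fun h1 q hq ↦ ?_, fun h1 q hq ↦ ?_⟩
  · have := h1 (ι.conj q) (by rwa [← ι.edist_conj, ι.conj_conj])
    rwa [mem_preimage, ι.conj_conj] at this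
  · exact h1 _ (by rwa [ι.edist_conj])

theorem IsEndChart.conj {p : T} {R : ℝ} {φ : ℝ → T} (h : IsEndChart p R φ) :
    IsEndChart (ι.conj p) R (fun t ↦ ι.conj (φ t)) := by
  refine ⟨fun s hs t ht ↦ ?_, fun s hs ↦ ?_, ?_, ?_⟩
  · rw [ι.edist_conj, h.edist_eq s hs t ht]
  · rw [ι.edist_conj, h.edist_end s hs]
  · exact (ι.continuous_conj.tendsto p).comp h.tendsto
  · have := ι.mem_nhds h.mem_nhds
    rwa [image_insert_eq, image_image] at this

theorem IsRay.conj {p : T} {R : ℝ} {φ : ℝ → T} (h : IsRay p R φ) :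
    IsRay (ι.conj p) R (fun t ↦ ι.conj (φ t)) := by
  refine ⟨fun S hS ↦ (h.chart S hS).conj ι, fun S hS ↦ ?_⟩
  rw [← image_image]
  exact ι.isOpen_image (h.isOpen S hS)

theorem edist_conj_eq_top {p : T} (h : ∀ x ≠ p, edist x p = ⊤) :
    ∀ x ≠ ι.conj p, edist x (ι.conj p) = ⊤ := by
  intro x hx
  rw [← ι.conj_conj x, ι.edist_conj]
  exact h _ fun h' ↦ hx (by rw [← h', ι.conj_conj])

theorem HasSlope.conj {g : T → ℝ} (hg : ∀ x, g (ι.conj x) = g x) {p : T} {m : ℤ}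
    (h : HasSlope g p m) : HasSlope g (ι.conj p) m := by
  rcases h with ⟨hp, n, r, φ, c, σ, hφ, h1, rfl⟩ | ⟨hp, R, φ, c, σ, hφ, h1, rfl⟩
  · exact Or.inl ⟨hp.conj ι, n, r, _, c, σ, hφ.conj ι, fun k t ht ↦ by rw [hg, h1 k t ht], rfl⟩
  · exact Or.inr ⟨edist_conj_eq_top ι hp, R, _, c, σ, hφ.conj ι,
      fun t ht ↦ by rw [hg, h1 t ht], rfl⟩

end Curve

/-! ### Arcs and adapted vertex sets -/

section Arc

variable {T : Type*} [TopologicalSpace T]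

/-- `ψ` parametrizes an arc with an open interior by the interval `[a, b]`. -/
structure IsArc (ψ : ℝ → T) (a b : ℝ) : Prop where
  lt : a < b
  continuousOn : ContinuousOn ψ (Icc a b)
  injOn : InjOn ψ (Icc a b)
  isOpen : IsOpen (ψ '' Ioo a b)

variable {ψ : ℝ → T} {a b : ℝ}

theorem IsArc.isClosed [T2Space T] (h : IsArc ψ a b) {s : Set ℝ} (hs : IsClosed s)
    (hs' : s ⊆ Icc a b) : IsClosed (ψ '' s) :=
  ((isCompact_Icc.of_isClosed_subset hs hs').image_of_continuousOn
    (h.continuousOn.mono hs')).isClosed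

/-- Openness is the only issue: the smaller open arc is the larger one minus the compact image of
the two end pieces. -/
theorem IsArc.mono [T2Space T] (h : IsArc ψ a b) {a' b' : ℝ} (ha : a ≤ a') (hab : a' < b')
    (hb : b' ≤ b) : IsArc ψ a' b' := by
  have hI : Icc a' b' ⊆ Icc a b := Icc_subset_Icc ha hb
  refine ⟨hab, h.continuousOn.mono hI, h.injOn.mono hI, ?_⟩
  have : ψ '' Ioo a' b' = ψ '' Ioo a b \ ψ '' (Icc a a' ∪ Icc b' b) := by
    ext x
    constructor
    · rintro ⟨t, ht, rfl⟩
      refine ⟨⟨t, ⟨ha.trans_lt ht.1, ht.2.trans_le hb⟩, rfl⟩, ?_⟩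
      rintro ⟨s, hs, hst⟩
      have hs' : s ∈ Icc a b := by
        rcases hs with hs | hs
        · exact ⟨hs.1, hs.2.trans (hab.le.trans hb)⟩
        · exact ⟨ha.trans (hab.le.trans hs.1), hs.2⟩
      have := h.injOn hs' ⟨ha.trans ht.1.le, ht.2.le.trans hb⟩ hst
      subst this
      rcases hs with hs | hs
      · exact absurd hs.2 (not_le.2 ht.1)
      · exact absurd hs.1 (not_le.2 ht.2)
    · rintro ⟨⟨t, ht, rfl⟩, h2⟩
      refine ⟨t, ⟨?_, ?_⟩, rfl⟩ <;> by_contra h3 <;> apply h2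
      · exact ⟨t, Or.inl ⟨ht.1.le, not_lt.1 h3⟩, rfl⟩
      · exact ⟨t, Or.inr ⟨not_lt.1 h3, ht.2.le⟩, rfl⟩
  rw [this]
  refine h.isOpen.sdiff (h.isClosed (isClosed_Icc.union isClosed_Icc) (union_subset ?_ ?_))
  · exact Icc_subset_Icc_right (hab.le.trans hb)
  · exact Icc_subset_Icc_left (ha.trans hab.le)

theorem IsArc.nonempty_homeomorph [T2Space T] (h : IsArc ψ a b) :
    Nonempty (ψ '' Ioo a b ≃ₜ Ioo (0 : ℝ) 1) := by
  have hj : IsEmbedding (fun t : Icc a b ↦ ψ t) :=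
    (Continuous.isClosedEmbedding (continuousOn_iff_continuous_domRestrict.1 h.continuousOn)
      (injOn_iff_injective.1 h.injOn)).isEmbedding
  have e1 := hj.homeomorphImage (Subtype.val ⁻¹' Ioo a b)
  have e2 := (IsEmbedding.subtypeVal (p := fun t ↦ t ∈ Icc a b)).homeomorphImage
    (Subtype.val ⁻¹' Ioo a b)
  have h2 : (Subtype.val '' (Subtype.val ⁻¹' Ioo a b : Set (Icc a b))) = Ioo a b := by
    rw [Subtype.image_preimage_coe, inter_eq_right]
    exact Ioo_subset_Icc_self
  have h1 : (fun t : Icc a b ↦ ψ t) '' (Subtype.val ⁻¹' Ioo a b) = ψ '' Ioo a b := by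
    rw [← h2, image_image, h2]
  rw [h1] at e1
  rw [h2] at e2
  obtain ⟨e3⟩ := nonempty_homeomorph_Ioo h.lt
  exact ⟨(e1.symm.trans e2).trans e3⟩

theorem IsArc.isPreconnected (h : IsArc ψ a b) : IsPreconnected (ψ '' Ioo a b) :=
  isPreconnected_Ioo.image _ (h.continuousOn.mono Ioo_subset_Icc_self)

theorem IsArc.image_Icc (h : IsArc ψ a b) : ψ '' Icc a b = ψ '' Ioo a b ∪ {ψ a, ψ b} := by
  rw [← Ioo_union_both h.lt.le, image_union, image_pair]

/-- The open arc is relatively clopen in `Vᶜ`: it is open, and since its ends lie in `V`, the rest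
of `Vᶜ` lies in the open complement of the closed arc. -/
theorem IsArc.connectedComponentIn_eq [T2Space T] (h : IsArc ψ a b) {V : Set T} (ha : ψ a ∈ V)
    (hb : ψ b ∈ V) (hV : Disjoint (ψ '' Ioo a b) V) {z : T} (hz : z ∈ ψ '' Ioo a b) :
    connectedComponentIn Vᶜ z = ψ '' Ioo a b := by
  have hsub : ψ '' Ioo a b ⊆ Vᶜ := disjoint_left.1 hV
  apply Subset.antisymm
  · refine isPreconnected_connectedComponentIn.subset_left_of_subset_union h.isOpen
      (h.isClosed isClosed_Icc Subset.rfl).isOpen_compl ?_ ?_ ?_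
    · exact disjoint_left.2 fun x hx hx' ↦ hx' (image_mono Ioo_subset_Icc_self hx)
    · intro x hx
      by_cases hx' : x ∈ ψ '' Icc a b
      · rw [h.image_Icc] at hx'
        rcases hx' with hx' | rfl | rfl
        · exact Or.inl hx'
        · exact absurd ha (connectedComponentIn_subset _ _ hx)
        · exact absurd hb (connectedComponentIn_subset _ _ hx)
      · exact Or.inr hx'
    · exact ⟨z, mem_connectedComponentIn (hsub hz), hz⟩
  · exact h.isPreconnected.subset_connectedComponentIn hz hsub

theorem IsArc.finite_preimage (h : IsArc ψ a b) {V : Set T} (hV : V.Finite) :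
    (Icc a b ∩ ψ ⁻¹' V).Finite :=
  Finite.of_injOn (f := ψ) (fun _ ht ↦ ht.2) (h.injOn.mono inter_subset_left) hV

/-- A finite set cuts an arc into finitely many subarcs. -/
theorem IsArc.exists_subarc [T2Space T] (h : IsArc ψ a b) {V : Set T} (hV : V.Finite)
    (ha : ψ a ∈ V) (hb : ψ b ∈ V) {t : ℝ} (ht : t ∈ Ioo a b) (htV : ψ t ∉ V) :
    ∃ a' ∈ Icc a b ∩ ψ ⁻¹' V, ∃ b' ∈ Icc a b ∩ ψ ⁻¹' V, t ∈ Ioo a' b' ∧ IsArc ψ a' b' ∧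
      Disjoint (ψ '' Ioo a' b') V := by
  have hP := h.finite_preimage hV
  -- `a'` is the last parameter before `t` at which the arc meets `V`; `b'` below is the first one
  -- after `t`.
  obtain ⟨a', ⟨ha1, ha2⟩, ha3⟩ := exists_max_image ((Icc a b ∩ ψ ⁻¹' V) ∩ Iic t) id
    (hP.subset inter_subset_left) ⟨a, ⟨⟨le_rfl, h.lt.le⟩, ha⟩, ht.1.le⟩
  obtain ⟨b', ⟨hb1, hb2⟩, hb3⟩ := exists_min_image ((Icc a b ∩ ψ ⁻¹' V) ∩ Ici t) id
    (hP.subset inter_subset_left) ⟨b, ⟨⟨h.lt.le, le_rfl⟩, hb⟩, ht.2.le⟩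
  have ha4 : a' < t := lt_of_le_of_ne ha2 (fun h' ↦ htV (h' ▸ ha1.2))
  have hb4 : t < b' := lt_of_le_of_ne hb2 (fun h' ↦ htV (h' ▸ hb1.2))
  refine ⟨a', ha1, b', hb1, ⟨ha4, hb4⟩, h.mono ha1.1.1 (ha4.trans hb4) hb1.1.2, ?_⟩
  rw [disjoint_left]
  rintro _ ⟨s, hs, rfl⟩ hsV
  have hs' : s ∈ Icc a b ∩ ψ ⁻¹' V :=
    ⟨⟨ha1.1.1.trans hs.1.le, hs.2.le.trans hb1.1.2⟩, hsV⟩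
  rcases le_total s t with h1 | h1
  · exact absurd (ha3 s ⟨hs', h1⟩) (not_le.2 hs.1)
  · exact absurd (hb3 s ⟨hs', h1⟩) (not_le.2 hs.2)

end Arc

section CompactRay

variable {T : Type*}

/-- The reparametrization of a ray by `[0, 1]`. -/
noncomputable def compactRay (p : T) (S : ℝ) (φ : ℝ → T) (s : ℝ) : T :=
  if s ≤ 0 then p else φ (S + (s⁻¹ - 1))

/-- The parameter on the ray is `S + (1 / s - 1)`: `s = 0` is the end `p`, and `s = 1` is `φ S`. -/
theorem image_compactRay {p : T} {S : ℝ} {φ : ℝ → T} :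
    compactRay p S φ '' Ioo 0 1 = φ '' Ioi S := by
  ext x
  constructor
  · rintro ⟨s, hs, rfl⟩
    have := (one_lt_inv₀ hs.1).2 hs.2
    exact ⟨S + (s⁻¹ - 1), by simp only [mem_Ioi]; linarith, by
      rw [compactRay, if_neg (not_le.2 hs.1)]⟩
  · rintro ⟨t, ht, rfl⟩
    have ht' : S < t := ht
    have h1 : 0 < (t - S + 1)⁻¹ := inv_pos.2 (by linarith)
    refine ⟨(t - S + 1)⁻¹, ⟨h1, inv_lt_one_of_one_lt₀ (by linarith)⟩, ?_⟩
    rw [compactRay, if_neg (not_le.2 h1), inv_inv]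
    congr 1; ring

end CompactRay

/-! ### Homogeneous arcs and vertex sets stable under conjugation -/

section Adapted

variable {T : Type*} [TopologicalSpace T] [EDist T] (ι : RealStructure T)

/-- `L` consists of real points, or is disjoint from its conjugate. -/
def Homogeneous (L : Set T) : Prop := L ⊆ ι.realLocus ∨ Disjoint (ι.conj '' L) L

variable {ι} in
theorem Homogeneous.mono {L L' : Set T} (h : Homogeneous ι L) (hL : L' ⊆ L) :
    Homogeneous ι L' :=
  h.imp (fun h ↦ hL.trans h) (fun h ↦ h.mono (image_mono hL) hL)

theorem isArc_conj {ψ : ℝ → T} {a b : ℝ} (h : IsArc ψ a b) :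
    IsArc (fun t ↦ ι.conj (ψ t)) a b := by
  refine ⟨h.lt, ι.continuous_conj.comp_continuousOn h.continuousOn,
    fun s hs t ht hst ↦ h.injOn hs ht (ι.injective hst), ?_⟩
  rw [← image_image]
  exact ι.isOpen_image h.isOpen

/-- A finite set of vertices, stable under conjugation, such that all edges are homogeneous arcs. -/
structure IsAdapted (V : Set T) : Prop where
  finite : V.Finite
  conj_mem : ∀ v ∈ V, ι.conj v ∈ V
  finite_edges : (components Vᶜ).Finite
  edge : ∀ e ∈ components Vᶜ, ∃ ψ a b, IsArc ψ a b ∧ e = ψ '' Ioo a b ∧ ψ a ∈ V ∧ ψ b ∈ V ∧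
    Homogeneous ι e

variable {ι}

/-- Every edge is a subarc of an arc of the cover, cut out by two parameters at which this arc meets
`V`. There are finitely many such pairs of parameters. -/
theorem isAdapted_of_cover [T2Space T] {A : Set ((ℝ → T) × ℝ × ℝ)} (hA : A.Finite)
    (harc : ∀ l ∈ A, IsArc l.1 l.2.1 l.2.2 ∧ Homogeneous ι (l.1 '' Ioo l.2.1 l.2.2))
    (hcover : ∀ z, ∃ l ∈ A, z ∈ l.1 '' Icc l.2.1 l.2.2) {V : Set T} (hV : V.Finite)
    (hconj : ∀ v ∈ V, ι.conj v ∈ V) (hends : ∀ l ∈ A, l.1 l.2.1 ∈ V ∧ l.1 l.2.2 ∈ V) :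
    IsAdapted ι V := by
  have key : ∀ e ∈ components Vᶜ, ∃ l ∈ A, ∃ a ∈ Icc l.2.1 l.2.2 ∩ l.1 ⁻¹' V,
      ∃ b ∈ Icc l.2.1 l.2.2 ∩ l.1 ⁻¹' V, IsArc l.1 a b ∧ e = l.1 '' Ioo a b := by
    rintro _ ⟨z, hz, rfl⟩
    obtain ⟨l, hl, hzl⟩ := hcover z
    obtain ⟨h1, h2⟩ := harc l hl
    rw [h1.image_Icc] at hzl
    rcases hzl with ⟨t, ht, rfl⟩ | rfl | rfl
    · obtain ⟨a, ha, b, hb, ht', h3, h4⟩ := h1.exists_subarc hV (hends l hl).1 (hends l hl).2 ht hz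
      exact ⟨l, hl, a, ha, b, hb, h3, h3.connectedComponentIn_eq ha.2 hb.2 h4
        (mem_image_of_mem _ ht')⟩
    · exact absurd (hends l hl).1 hz
    · exact absurd (hends l hl).2 hz
  refine ⟨hV, hconj, ?_, ?_⟩
  · have hP := fun l (hl : l ∈ A) ↦ (harc l hl).1.finite_preimage hV
    refine (hA.biUnion (t := fun l ↦ (fun q : ℝ × ℝ ↦ l.1 '' Ioo q.1 q.2) ''
      ((Icc l.2.1 l.2.2 ∩ l.1 ⁻¹' V) ×ˢ (Icc l.2.1 l.2.2 ∩ l.1 ⁻¹' V)))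
      fun l hl ↦ ((hP l hl).prod (hP l hl)).image _).subset fun e he ↦ ?_
    obtain ⟨l, hl, a, ha, b, hb, -, rfl⟩ := key e he
    exact mem_biUnion hl ⟨(a, b), ⟨ha, hb⟩, rfl⟩
  · intro e he
    obtain ⟨l, hl, a, ha, b, hb, h1, rfl⟩ := key e he
    exact ⟨l.1, a, b, h1, rfl, ha.2, hb.2,
      (harc l hl).2.mono (image_mono (Ioo_subset_Ioo ha.1.1 hb.1.2))⟩

theorem continuousOn_of_edist {γ : ℝ → T} {I : Set ℝ}
    (h : ∀ s ∈ I, ∀ t ∈ I, edist (γ s) (γ t) = ENNReal.ofReal |s - t|)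
    (hb : ∀ t ∈ I, BallNhds (γ t)) : ContinuousOn γ I := by
  intro t ht U hU
  obtain ⟨ε, hε, h1⟩ := (hb t ht U).1 hU
  rw [Filter.mem_map, mem_nhdsWithin_iff_exists_mem_nhds_inter]
  refine ⟨Metric.ball t ε, Metric.ball_mem_nhds t hε, fun s hs ↦ h1 _ ?_⟩
  rw [h t ht s hs.2]
  refine (ENNReal.ofReal_lt_ofReal_iff hε).2 ?_
  have := hs.1
  rwa [Metric.mem_ball, dist_comm, Real.dist_eq] at this

theorem IsCurve.ballNhds_leg (hT : IsCurve T) {p : T} {n : ℕ} {r : ℝ} {φ : Fin n → ℝ → T}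
    (h : IsStarChart p n r φ) (hp : BallNhds p) (k : Fin n) {t : ℝ} (ht : t ∈ Ico 0 r) :
    BallNhds (φ k t) := by
  rcases ht.1.eq_or_lt with rfl | h0
  · rwa [h.center]
  · have h1 := h.edist_center k ht
    refine (hT.star_of_ne_top (x := p) (fun h2 ↦ ?_) (by rw [h1]; exact ENNReal.ofReal_ne_top)).1
    rw [← h2, hT.edist_self, eq_comm, ENNReal.ofReal_eq_zero] at h1
    linarith

theorem IsCurve.ballNhds_ray (hT : IsCurve T) {p : T} {R : ℝ} {φ : ℝ → T} (h : IsRay p R φ)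
    {t : ℝ} (ht : R < t) : BallNhds (φ t) := by
  have h1 := h.endChart.edist_eq (t + 1) (show R < t + 1 by linarith) t ht
  refine (hT.star_of_ne_top (x := φ (t + 1)) (fun h2 ↦ ?_)
    (by rw [h1]; exact ENNReal.ofReal_ne_top)).1
  have := hT.ray_injOn h (show R < t + 1 by linarith) ht h2
  linarith

theorem IsCurve.isClosed_realLocus (hT : IsCurve T) : IsClosed ι.realLocus := by
  have := hT.t2
  exact isClosed_eq ι.continuous_conj continuous_id

theorem IsCurve.exists_disjoint_nhds (hT : IsCurve T) {p : T} (hp : p ∉ ι.realLocus) :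
    ∃ U ∈ 𝓝 p, Disjoint (ι.conj '' U) U := by
  have := hT.t2
  obtain ⟨U, W, hU, hW, hpU, hpW, h⟩ := t2_separation (Ne.symm hp)
  refine ⟨U ∩ ι.conj ⁻¹' W, inter_mem (hU.mem_nhds hpU)
    (ι.continuous_conj.continuousAt (hW.mem_nhds hpW)), ?_⟩
  rw [disjoint_left]
  rintro _ ⟨x, hx, rfl⟩ hx'
  exact disjoint_left.1 h hx'.1 hx.2

/-- Legs of small stars are homogeneous arcs. -/
theorem IsStarChart.exists_homogeneous (hT : IsCurve T) {p : T} {n : ℕ} {r : ℝ}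
    {φ : Fin n → ℝ → T} (h : IsStarChart p n r φ) (hp : BallNhds p) :
    ∃ ρ, 0 < ρ ∧ ρ ≤ r ∧ ∀ k, (∀ t, 0 < t → t < ρ → IsArc (φ k) 0 t) ∧
      Homogeneous ι (φ k '' Ioo 0 ρ) := by
  obtain ⟨ρ₁, h10, h1r, h1⟩ := h.exists_ball hp
  have harc : ∀ k t, 0 < t → t < ρ₁ → IsArc (φ k) 0 t := by
    intro k t h0 ht
    have hI : Icc 0 t ⊆ Ico 0 r := fun s hs ↦ ⟨hs.1, hs.2.trans_lt (ht.trans_le h1r)⟩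
    refine ⟨h0, (continuousOn_of_edist (h.edist_same k)
      fun t ht ↦ hT.ballNhds_leg h hp k ht).mono hI, ?_, ?_⟩
    · intro s hs s' hs' hss
      have := h.edist_same k s (hI hs) s' (hI hs')
      rw [hss, hT.edist_self, eq_comm, ENNReal.ofReal_eq_zero] at this
      exact sub_eq_zero.1 (abs_nonpos_iff.1 this)
    · rw [isOpen_iff_mem_nhds]
      rintro _ ⟨s, hs, rfl⟩
      have hsr : s ∈ Ico 0 r := hI ⟨hs.1.le, hs.2.le⟩
      -- The bound `t - s` keeps `q` at distance less than `t` from the centre; the bound `s` forces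
      -- it onto leg `k`.
      refine (hT.ballNhds_leg h hp k hsr _).2 ⟨min s (t - s), lt_min hs.1 (sub_pos.2 hs.2), ?_⟩
      intro q hq
      have hq' : edist p q < ENNReal.ofReal t := by
        refine (hT.edist_triangle p (φ k s) q).trans_lt ?_
        rw [h.edist_center k hsr]
        have h2 : ENNReal.ofReal t = ENNReal.ofReal s + ENNReal.ofReal (t - s) := by
          rw [← ENNReal.ofReal_add hs.1.le (sub_pos.2 hs.2).le]; congr 1; ring
        rw [h2]
        exact ENNReal.add_lt_add_left ENNReal.ofReal_ne_top
          (hq.trans_le (ENNReal.ofReal_le_ofReal (min_le_right _ _)))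
      obtain ⟨l, s', hs', rfl⟩ := h1 q t ht.le hq'
      have hsr' : s' ∈ Ico 0 r := ⟨hs'.1, hs'.2.trans (ht.trans_le h1r)⟩
      have hlk : k = l := by
        refine h.index_eq hsr hsr' (hq.trans_le (ENNReal.ofReal_le_ofReal ?_))
        exact (min_le_left _ _).trans (by linarith [hs'.1])
      subst hlk
      rw [h.edist_same k s hsr s' hsr', ENNReal.ofReal_lt_ofReal_iff
        (lt_min hs.1 (sub_pos.2 hs.2)), lt_min_iff, abs_lt] at hq
      exact ⟨s', ⟨by linarith [hq.1.2], hs'.2⟩, rfl⟩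
  by_cases hpF : p ∈ ι.realLocus
  · have h2 := h.conj ι
    rw [show ι.conj p = p from hpF] at h2
    obtain ⟨ρ₂, h20, h2r, -, e, he⟩ := h2.exists_equiv hT h hp
    refine ⟨min ρ₁ ρ₂, lt_min h10 h20, (min_le_left _ _).trans h1r, fun k ↦
      ⟨fun t h0 ht ↦ harc k t h0 (ht.trans_le (min_le_left _ _)), ?_⟩⟩
    have hI : ∀ t ∈ Ioo 0 (min ρ₁ ρ₂), t ∈ Ico 0 ρ₂ := fun t ht ↦
      ⟨ht.1.le, ht.2.trans_le (min_le_right _ _)⟩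
    have hI' : Ico 0 ρ₂ ⊆ Ico 0 r := Ico_subset_Ico_right h2r
    -- At a real centre the involution permutes the legs by `e`, preserving the parameter. A fixed
    -- leg is real near the centre, and any other leg is disjoint from its conjugate.
    by_cases hk : e k = k
    · left
      rintro _ ⟨t, ht, rfl⟩
      have := he k t (hI t ht)
      rwa [hk] at this
    · right
      rw [disjoint_left]
      rintro _ ⟨_, ⟨t, ht, rfl⟩, rfl⟩ ⟨s, hs, hst⟩
      rw [he k t (hI t ht)] at hst
      exact hk (hT.eq_index h (hI' (hI s hs)) (hI' (hI t ht)) hs.1 hst).1.symm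
  · obtain ⟨U, hU, hd⟩ := hT.exists_disjoint_nhds hpF
    obtain ⟨ε, hε, h2⟩ := (hp U).1 hU
    refine ⟨min ρ₁ ε, lt_min h10 hε, (min_le_left _ _).trans h1r, fun k ↦
      ⟨fun t h0 ht ↦ harc k t h0 (ht.trans_le (min_le_left _ _)), Or.inr ?_⟩⟩
    have hsub : φ k '' Ioo 0 (min ρ₁ ε) ⊆ U := by
      rintro _ ⟨t, ht, rfl⟩
      refine h2 _ ?_
      rw [h.edist_center k ⟨ht.1.le, ht.2.trans_le ((min_le_left _ _).trans h1r)⟩]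
      exact (ENNReal.ofReal_lt_ofReal_iff hε).2 (ht.2.trans_le (min_le_right _ _))
    exact hd.mono (image_mono hsub) hsub

/-- Near a real end the involution acts as a shift `t ↦ t + c`; its square is the identity, so `c =
0` and a tail is real. A nonreal end has a neighbourhood disjoint from its conjugate. -/
theorem IsRay.exists_homogeneous (hT : IsCurve T) {p : T} {R : ℝ} {φ : ℝ → T}
    (h : IsRay p R φ) : ∃ S ≥ R, Homogeneous ι (φ '' Ioi S) ∧
      (p ∈ ι.realLocus → φ '' Ioi S ⊆ ι.realLocus) := by
  by_cases hpF : p ∈ ι.realLocus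
  · have h2 := h.conj ι
    rw [show ι.conj p = p from hpF] at h2
    obtain ⟨S, c, hS, hSc, h3⟩ := h2.exists_shift hT h
    have hc : c = 0 := by
      set t := S + |c| + 1
      have h4 : t > S := by have := abs_nonneg c; simp only [t]; linarith
      have h5 : t + c > S := by have := neg_abs_le c; simp only [t]; linarith
      have h6 := h3 _ h5
      rw [← h3 t h4, ι.conj_conj] at h6
      have := hT.ray_injOn h (hS.trans_lt h4) (show R < t + c + c by linarith) h6
      linarith
    have h7 : φ '' Ioi S ⊆ ι.realLocus := by
      rintro _ ⟨t, ht, rfl⟩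
      have := h3 t ht
      rwa [hc, add_zero] at this
    exact ⟨S, hS, Or.inl h7, fun _ ↦ h7⟩
  · obtain ⟨U, hU, hd⟩ := hT.exists_disjoint_nhds hpF
    obtain ⟨S, hS⟩ := (h.endChart.tendsto.eventually hU).exists_forall_of_atTop
    have hsub : φ '' Ioi (max R S) ⊆ U := by
      rintro _ ⟨t, ht, rfl⟩
      exact hS t ((le_max_right _ _).trans (le_of_lt ht))
    exact ⟨max R S, le_max_left _ _, Or.inr (hd.mono (image_mono hsub) hsub),
      fun h ↦ absurd h hpF⟩

theorem IsRay.isArc_compactRay (hT : IsCurve T) {p : T} {R S : ℝ} {φ : ℝ → T}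
    (h : IsRay p R φ) (hS : R < S) : IsArc (compactRay p S φ) 0 1 := by
  have hge : ∀ s ∈ Ioc (0 : ℝ) 1, R < S + (s⁻¹ - 1) := fun s hs ↦ by
    have := (one_le_inv₀ hs.1).2 hs.2
    linarith
  refine ⟨one_pos, ?_, ?_, ?_⟩
  · intro s hs
    rcases hs.1.eq_or_lt with rfl | h0
    · have h1 : Tendsto (fun s : ℝ ↦ S + (s⁻¹ - 1)) (𝓝[>] 0) atTop :=
        tendsto_atTop_add_const_left _ _ (tendsto_atTop_add_const_right _ _
          tendsto_inv_nhdsGT_zero)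
      have h2 := h.endChart.tendsto.comp h1
      have h3 : compactRay p S φ 0 = p := if_pos le_rfl
      have h4 : Tendsto (compactRay p S φ) (𝓝[>] 0) (𝓝 p) := by
        refine h2.congr' ?_
        filter_upwards [self_mem_nhdsWithin] with s hs
        rw [compactRay, if_neg (not_le.2 hs), Function.comp]
      have h5 : ContinuousWithinAt (compactRay p S φ) (insert 0 (Ioi 0)) 0 := by
        rw [continuousWithinAt_insert_self, ContinuousWithinAt, h3]; exact h4
      rw [Ioi_insert] at h5
      exact h5.mono fun s hs ↦ hs.1
    · have h1 : ContinuousAt φ (S + (s⁻¹ - 1)) :=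
        (continuousOn_of_edist h.endChart.edist_eq fun t ht ↦ hT.ballNhds_ray h ht).continuousAt
          (Ioi_mem_nhds (hge s ⟨h0, hs.2⟩))
      have h2 : ContinuousAt (fun s : ℝ ↦ S + (s⁻¹ - 1)) s :=
        continuousAt_const.add ((continuousAt_inv₀ h0.ne').sub continuousAt_const)
      refine ((ContinuousAt.comp (f := fun s : ℝ ↦ S + (s⁻¹ - 1)) h1 h2).congr
        ?_).continuousWithinAt
      filter_upwards [Ioi_mem_nhds h0] with s hs
      rw [compactRay, if_neg (not_le.2 hs), Function.comp]
  · intro s hs t ht hst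
    rcases hs.1.eq_or_lt with rfl | hs0 <;> rcases ht.1.eq_or_lt with rfl | ht0
    · rfl
    · rw [compactRay, if_pos le_rfl, compactRay, if_neg (not_le.2 ht0)] at hst
      exact absurd hst.symm (hT.ray_ne h (hge t ⟨ht0, ht.2⟩))
    · rw [compactRay, if_neg (not_le.2 hs0), compactRay, if_pos le_rfl] at hst
      exact absurd hst (hT.ray_ne h (hge s ⟨hs0, hs.2⟩))
    · rw [compactRay, if_neg (not_le.2 hs0), compactRay, if_neg (not_le.2 ht0)] at hst
      have := hT.ray_injOn h (hge s ⟨hs0, hs.2⟩) (hge t ⟨ht0, ht.2⟩) hst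
      exact inv_injective (by linarith)
  · rw [image_compactRay]
    exact h.isOpen S hS.le

/-- Each point has a neighbourhood covered by finitely many homogeneous arcs. -/
theorem IsCurve.exists_arcs_nhds (hT : IsCurve T) (p : T) :
    ∃ A : Set ((ℝ → T) × ℝ × ℝ), A.Finite ∧
      (∀ l ∈ A, IsArc l.1 l.2.1 l.2.2 ∧ Homogeneous ι (l.1 '' Ioo l.2.1 l.2.2)) ∧
      {z | ∃ l ∈ A, z ∈ l.1 '' Icc l.2.1 l.2.2} ∈ 𝓝 p := by
  rcases hT.chart p with ⟨hp, n, r, φ, h⟩ | ⟨hp, R, φ, h⟩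
  · obtain ⟨ρ, h0, hr, h1⟩ := h.exists_homogeneous (ι := ι) hT hp
    have h2 : 0 < ρ / 2 := by linarith
    refine ⟨range fun k ↦ (φ k, 0, ρ / 2), finite_range _, ?_,
      mem_of_superset (h.shrink hp h2 (by linarith)).mem_nhds ?_⟩
    · rintro _ ⟨k, rfl⟩
      exact ⟨(h1 k).1 _ h2 (by linarith), (h1 k).2.mono (image_mono (Ioo_subset_Ioo_right
        (by linarith)))⟩
    · rintro _ ⟨k, t, ht, rfl⟩
      exact ⟨_, mem_range_self k, t, ⟨ht.1, ht.2.le⟩, rfl⟩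
  · obtain ⟨S, hS, h1, -⟩ := h.exists_homogeneous (ι := ι) hT
    have hS' : R < S + 1 := by have : R ≤ S := hS; linarith
    have harc := h.isArc_compactRay hT hS'
    refine ⟨{(compactRay p (S + 1) φ, 0, 1)}, finite_singleton _, ?_,
      mem_of_superset (h.chart _ hS'.le).mem_nhds ?_⟩
    · rintro _ rfl
      refine ⟨harc, ?_⟩
      rw [image_compactRay]
      exact h1.mono (image_mono (Ioi_subset_Ioi (by linarith)))
    · intro x hx
      refine ⟨_, rfl, ?_⟩
      rw [harc.image_Icc, image_compactRay, compactRay, if_pos le_rfl]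
      rcases hx with rfl | hx
      · right; left; rfl
      · exact Or.inl hx

/-- All sufficiently large finite sets stable under conjugation are adapted. -/
theorem IsCurve.exists_isAdapted (hT : IsCurve T) (ι : RealStructure T) :
    ∃ V₀ : Set T, V₀.Finite ∧ ∀ V : Set T, V.Finite → (∀ v ∈ V, ι.conj v ∈ V) → V₀ ⊆ V →
      IsAdapted ι V := by
  have := hT.t2
  have := hT.compact
  choose A hA h1 h2 using hT.exists_arcs_nhds (ι := ι)
  obtain ⟨t, ht⟩ := CompactSpace.elim_nhds_subcover _ h2
  set B := ⋃ p ∈ t, A p with hB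
  have hBfin : B.Finite := t.finite_toSet.biUnion fun p _ ↦ hA p
  -- `V₀` consists of the ends of finitely many homogeneous arcs which, by compactness, cover the
  -- curve.
  refine ⟨(fun l ↦ l.1 l.2.1) '' B ∪ (fun l ↦ l.1 l.2.2) '' B,
    (hBfin.image _).union (hBfin.image _), fun V hV hconj hsub ↦
    isAdapted_of_cover hBfin ?_ ?_ hV hconj ?_⟩
  · intro l hl
    obtain ⟨p, -, hp⟩ := mem_iUnion₂.1 hl
    exact h1 p l hp
  · intro z
    have hz : z ∈ ⋃ x ∈ t, {z | ∃ l ∈ A x, z ∈ l.1 '' Icc l.2.1 l.2.2} := ht ▸ mem_univ z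
    obtain ⟨p, hp, l, hl, hz⟩ := mem_iUnion₂.1 hz
    exact ⟨l, mem_iUnion₂.2 ⟨p, hp, hl⟩, hz⟩
  · intro l hl
    exact ⟨hsub (Or.inl ⟨l, hl, rfl⟩), hsub (Or.inr ⟨l, hl, rfl⟩)⟩

end Adapted

/-! ### Counting vertices and edges -/

section Combinatorics

/-- The fibres of `f` on `s` are the pairs `{x, σ x}`. This counts conjugate pairs of nonreal
vertices and of nonreal edges. -/
theorem ncard_eq_two_mul_ncard_image {α β : Type*} {s : Set α} (hs : s.Finite) (σ : α → α)
    (hσ : ∀ x ∈ s, σ x ∈ s) (hne : ∀ x ∈ s, σ x ≠ x) (f : α → β)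
    (hf : ∀ x ∈ s, ∀ y ∈ s, f y = f x ↔ y = x ∨ y = σ x) :
    s.ncard = 2 * (f '' s).ncard := by
  classical
  lift s to Finset α using hs
  rw [← Finset.coe_image, ncard_coe_finset, ncard_coe_finset, Finset.card_eq_sum_card_image f s,
    Finset.sum_const_nat (m := 2), mul_comm]
  intro b hb
  obtain ⟨x, hx, rfl⟩ := Finset.mem_image.1 hb
  rw [← Finset.card_pair (hne x hx).symm]
  congr 1
  ext y
  simp only [Finset.mem_filter, Finset.mem_insert, Finset.mem_singleton]
  constructor
  · rintro ⟨hy, h⟩; exact (hf x hx y hy).1 h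
  · intro h
    have hy : y ∈ s := by rcases h with rfl | rfl; exacts [hx, hσ _ hx]
    exact ⟨hy, (hf x hx y hy).2 h⟩

/-- Closed sets `K ∈ Y` joined by fewer than `#Y - 1` closed sets `M i` can be separated. -/
theorem exists_closed_separation {T : Type*} [TopologicalSpace T] {Y : Set (Set T)} (hY : Y.Finite)
    (hclosed : ∀ K ∈ Y, IsClosed K) (hne : ∀ K ∈ Y, K.Nonempty)
    (hdisj : ∀ K ∈ Y, ∀ L ∈ Y, ∀ z ∈ K, z ∈ L → K = L) {I : Type*} [Finite I] (M : I → Set T)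
    (y y' : I → Y) (hM : ∀ i, IsClosed (M i))
    (hMY : ∀ i, ∀ K : Y, ∀ z ∈ M i, z ∈ (K : Set T) → K = y i ∨ K = y' i)
    (hMM : ∀ i j, i ≠ j → M i ∩ M j ⊆ ⋃₀ Y) {K₀ : Set T} (hK₀ : K₀ ∈ Y)
    (hcard : Nat.card I + 1 < Y.ncard) :
    ∃ A₀ A₁ : Set T, IsClosed A₀ ∧ IsClosed A₁ ∧ Disjoint A₀ A₁ ∧ A₁.Nonempty ∧
      A₀ ∪ A₁ = ⋃₀ Y ∪ ⋃ i, M i ∧ K₀ ⊆ A₀ ∧ (∀ K ∈ Y, K ⊆ A₀ ∨ K ⊆ A₁) ∧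
      ∀ i, M i ⊆ A₀ ∨ M i ⊆ A₁ := by
  classical
  have := hY.to_subtype
  have := Fintype.ofFinite Y
  have := Fintype.ofFinite I
  let ev : Y → (Y → ℚ) →ₗ[ℚ] ℚ := fun K ↦ LinearMap.proj K
  -- A function `u` in the kernel vanishes at `K₀` and takes equal values at the two ends of every
  -- `M i`. These are `#I + 1` conditions on a space of dimension `#Y`, so a nonzero `u` exists.
  let f : (Y → ℚ) →ₗ[ℚ] (Option I → ℚ) := LinearMap.pi fun o ↦ o.elim
    (ev ⟨K₀, hK₀⟩) fun i ↦ ev (y i) - ev (y' i)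
  have hker : LinearMap.ker f ≠ ⊥ := by
    apply LinearMap.ker_ne_bot_of_finrank_lt
    rw [Module.finrank_fintype_fun_eq_card, Module.finrank_fintype_fun_eq_card,
      Fintype.card_option, ← Nat.card_eq_fintype_card, ← Nat.card_eq_fintype_card,
      Nat.card_coe_set_eq]
    exact hcard
  obtain ⟨u, hu, hu0⟩ := Submodule.exists_mem_ne_zero_of_ne_bot hker
  have h0 : u ⟨K₀, hK₀⟩ = 0 := congrFun (LinearMap.mem_ker.1 hu) none
  have h1 : ∀ i, u (y i) = u (y' i) := fun i ↦
    sub_eq_zero.1 (congrFun (LinearMap.mem_ker.1 hu) (some i))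
  -- `A True` collects the sets where `u` vanishes and `A False` the others; each `M i` goes with
  -- its ends.
  let A : Prop → Set T := fun P ↦ (⋃ K : {K : Y // (u K = 0) = P}, ((K : Y) : Set T)) ∪
    ⋃ i : {i // (u (y i) = 0) = P}, M i
  have hA : ∀ P, IsClosed (A P) := fun P ↦
    (isClosed_iUnion_of_finite fun K ↦ hclosed _ K.1.2).union
      (isClosed_iUnion_of_finite fun i ↦ hM _)
  have hAK : ∀ K : Y, (K : Set T) ⊆ A (u K = 0) := fun K x hx ↦
    Or.inl (mem_iUnion.2 ⟨⟨K, rfl⟩, hx⟩)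
  have hAM : ∀ i, M i ⊆ A (u (y i) = 0) := fun i x hx ↦
    Or.inr (mem_iUnion.2 ⟨⟨i, rfl⟩, hx⟩)
  have hmemY : ∀ P, ∀ z ∈ A P, ∀ K : Y, z ∈ (K : Set T) → (u K = 0) = P := by
    intro P z hz K hzK
    rcases hz with hz | hz
    · obtain ⟨⟨L, hL⟩, hz⟩ := mem_iUnion.1 hz
      rw [← hL, Subtype.ext (hdisj K K.2 L L.2 z hzK hz)]
    · obtain ⟨⟨i, hi⟩, hz⟩ := mem_iUnion.1 hz
      rcases hMY i K z hz hzK with rfl | rfl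
      · exact hi
      · rw [← h1]; exact hi
  have htrue : ∀ P : Prop, P → A P = A True := fun P hP ↦ by rw [eq_true hP]
  have hfalse : ∀ P : Prop, ¬P → A P = A False := fun P hP ↦ by rw [eq_false hP]
  have hor : ∀ (P : Prop) (B : Set T), B ⊆ A P → B ⊆ A True ∨ B ⊆ A False := by
    intro P B hB
    by_cases hP : P
    · exact Or.inl (htrue P hP ▸ hB)
    · exact Or.inr (hfalse P hP ▸ hB)
  refine ⟨A True, A False, hA _, hA _, ?_, ?_, ?_, ?_, fun K hK ↦ hor _ _ (hAK ⟨K, hK⟩),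
    fun i ↦ hor _ _ (hAM i)⟩
  · rw [disjoint_left]
    intro z hz hz'
    by_cases hzY : ∃ K : Y, z ∈ (K : Set T)
    · obtain ⟨K, hK⟩ := hzY
      exact absurd ((hmemY _ z hz K hK).symm.trans (hmemY _ z hz' K hK)) (by simp)
    · rcases hz with hz | hz
      · obtain ⟨⟨L, hL⟩, hz⟩ := mem_iUnion.1 hz
        exact hzY ⟨L, hz⟩
      rcases hz' with hz' | hz'
      · obtain ⟨⟨L, hL⟩, hz'⟩ := mem_iUnion.1 hz'
        exact hzY ⟨L, hz'⟩
      obtain ⟨⟨i, hi⟩, hz⟩ := mem_iUnion.1 hz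
      obtain ⟨⟨j, hj⟩, hz'⟩ := mem_iUnion.1 hz'
      have hij : i ≠ j := by
        rintro rfl
        exact absurd (hi.symm.trans hj) (by simp)
      obtain ⟨K, hK, hzK⟩ := hMM i j hij ⟨hz, hz'⟩
      exact hzY ⟨⟨K, hK⟩, hzK⟩
  · obtain ⟨K, hK⟩ := Function.ne_iff.1 hu0
    exact (hne K K.2).mono (hfalse (u K = 0) hK ▸ hAK K)
  · apply Subset.antisymm
    · rintro z ((hz | hz) | (hz | hz)) <;> obtain ⟨⟨i, _⟩, hi⟩ := mem_iUnion.1 hz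
      exacts [Or.inl ⟨i, i.2, hi⟩, Or.inr (mem_iUnion.2 ⟨i, hi⟩), Or.inl ⟨i, i.2, hi⟩,
        Or.inr (mem_iUnion.2 ⟨i, hi⟩)]
    · rintro z (⟨K, hK, hz⟩ | hz)
      · exact (hor _ _ (hAK ⟨K, hK⟩)).imp (fun h ↦ h hz) fun h ↦ h hz
      · obtain ⟨i, hz⟩ := mem_iUnion.1 hz
        exact (hor _ _ (hAM i)).imp (fun h ↦ h hz) fun h ↦ h hz
  · exact htrue _ h0 ▸ hAK ⟨K₀, hK₀⟩

end Combinatorics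

section Components

variable {T : Type*} [TopologicalSpace T]

theorem IsArc.ends_mem_of_isClosed {ψ : ℝ → T} {a b : ℝ} (h : IsArc ψ a b) {F : Set T}
    (hF : IsClosed F) (hsub : ψ '' Ioo a b ⊆ F) : ψ '' Icc a b ⊆ F := by
  have h1 : ψ '' closure (Ioo a b) ⊆ closure (ψ '' Ioo a b) :=
    ContinuousOn.image_closure (by rw [closure_Ioo h.lt.ne]; exact h.continuousOn)
  rw [closure_Ioo h.lt.ne] at h1
  exact h1.trans (hF.closure_subset_iff.2 hsub)

theorem isClosed_of_mem_components {F C : Set T} (hF : IsClosed F) (hC : C ∈ components F) :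
    IsClosed C := by
  obtain ⟨z, hz⟩ := nonempty_of_mem_components hC
  refine isClosed_of_closure_subset ?_
  conv_rhs => rw [eq_connectedComponentIn_of_mem_components hC hz]
  exact (isPreconnected_of_mem_components hC).closure.subset_connectedComponentIn
    (subset_closure hz) (hF.closure_subset_iff.2 (subset_of_mem_components hC))

theorem subset_of_inter_nonempty {F C e : Set T} (hC : C ∈ components F) (he : IsPreconnected e)
    (heF : e ⊆ F) (h : (e ∩ C).Nonempty) : e ⊆ C := by
  obtain ⟨z, hze, hzC⟩ := h
  rw [eq_connectedComponentIn_of_mem_components hC hzC]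
  exact he.subset_connectedComponentIn hze heF

theorem components_of_isPreconnected {C : Set T} (hC : IsPreconnected C) (hne : C.Nonempty) :
    components C = {C} := by
  have key : ∀ z ∈ C, connectedComponentIn C z = C := fun z hz ↦
    Subset.antisymm (connectedComponentIn_subset _ _)
      (hC.subset_connectedComponentIn hz Subset.rfl)
  obtain ⟨z, hz⟩ := hne
  apply Subset.antisymm
  · rintro _ ⟨x, hx, rfl⟩; exact key x hx
  · rintro _ rfl; exact ⟨z, hz, key z hz⟩

end Components

/-! ### The M-condition and separation by a conjugate pair of edges -/

section Counting

variable {T : Type*} [TopologicalSpace T] [EDist T] {ι : RealStructure T} {V : Set T}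

theorem disjoint_realLocus {e : Set T} (h : Disjoint (ι.conj '' e) e) :
    Disjoint e ι.realLocus := by
  rw [disjoint_left] at h ⊢
  intro z hz hzF
  exact h (by rw [← show ι.conj z = z from hzF]; exact mem_image_of_mem _ hz) hz

theorem IsAdapted.edge_subset (hV : IsAdapted ι V) {e : Set T} (he : e ∈ components Vᶜ) {z : T}
    (hz : z ∈ e) (hzF : z ∈ ι.realLocus) : e ⊆ ι.realLocus := by
  obtain ⟨ψ, a, b, -, -, -, -, h⟩ := hV.edge e he
  exact h.resolve_right fun h ↦ disjoint_left.1 (disjoint_realLocus h) hz hzF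

/-- An edge which contains a real point is real, and so are its ends, because the real locus is
closed. Hence there are finitely many real components. -/
theorem IsAdapted.component_meets (hT : IsCurve T) (hV : IsAdapted ι V) {C : Set T}
    (hC : C ∈ components ι.realLocus) : (C ∩ V).Nonempty := by
  obtain ⟨z, hz⟩ := nonempty_of_mem_components hC
  by_cases hzV : z ∈ V
  · exact ⟨z, hz, hzV⟩
  · have he := connectedComponentIn_mem_components (S := Vᶜ) hzV
    have hze := mem_connectedComponentIn (F := Vᶜ) hzV
    have hsub := hV.edge_subset he hze (subset_of_mem_components hC hz)
    obtain ⟨ψ, a, b, h1, h2, h3, -, -⟩ := hV.edge _ he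
    rw [h2] at hsub hze
    refine ⟨ψ a, subset_of_inter_nonempty hC (isPreconnected_Icc.image ψ h1.continuousOn)
      (h1.ends_mem_of_isClosed hT.isClosed_realLocus hsub)
      ⟨z, image_mono Ioo_subset_Icc_self hze, hz⟩ ⟨a, ⟨le_rfl, h1.lt.le⟩, rfl⟩, h3⟩

theorem IsAdapted.finite_components (hT : IsCurve T) (hV : IsAdapted ι V) :
    (components ι.realLocus).Finite := by
  refine (hV.finite.image (connectedComponentIn ι.realLocus)).subset fun C hC ↦ ?_
  obtain ⟨z, hz, hzV⟩ := hV.component_meets hT hC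
  exact ⟨z, hzV, (eq_connectedComponentIn_of_mem_components hC hz).symm⟩

/-- An edge that meets `C` is real and connected, hence contained in `C`. So `C ∩ V` serves as a
vertex set of `C`. -/
theorem IsAdapted.components_diff (hV : IsAdapted ι V) {C : Set T}
    (hC : C ∈ components ι.realLocus) :
    components (C \ (C ∩ V)) = {e ∈ components Vᶜ | e ⊆ C} := by
  have key : ∀ z ∈ C \ (C ∩ V), connectedComponentIn Vᶜ z ⊆ C ∧
      connectedComponentIn (C \ (C ∩ V)) z = connectedComponentIn Vᶜ z := by
    intro z hz
    have hzV : z ∈ Vᶜ := fun h ↦ hz.2 ⟨hz.1, h⟩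
    have he := connectedComponentIn_mem_components hzV
    have hze := mem_connectedComponentIn hzV
    have hsub : connectedComponentIn Vᶜ z ⊆ C :=
      subset_of_inter_nonempty hC isPreconnected_connectedComponentIn
        (hV.edge_subset he hze (subset_of_mem_components hC hz.1)) ⟨z, hze, hz.1⟩
    refine ⟨hsub, Subset.antisymm (connectedComponentIn_mono _ fun x hx h ↦ hx.2 ⟨hx.1, h⟩) ?_⟩
    exact isPreconnected_connectedComponentIn.subset_connectedComponentIn hze
      fun x hx ↦ ⟨hsub hx, fun h ↦ connectedComponentIn_subset _ _ hx h.2⟩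
  apply Subset.antisymm
  · rintro _ ⟨z, hz, rfl⟩
    rw [(key z hz).2]
    exact ⟨connectedComponentIn_mem_components fun h ↦ hz.2 ⟨hz.1, h⟩, (key z hz).1⟩
  · rintro _ ⟨⟨z, hz, rfl⟩, h⟩
    have hz' : z ∈ C \ (C ∩ V) := ⟨h (mem_connectedComponentIn hz), fun h' ↦ hz h'.2⟩
    exact ⟨z, hz', (key z hz').2⟩

theorem IsAdapted.genus_univ (hT : IsCurve T) (hV : IsAdapted ι V) :
    genus (univ : Set T) = 1 + (components Vᶜ).ncard - V.ncard := by
  have := hT.t2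
  have := hT.connected
  have h : IsVertexSet univ V := by
    refine ⟨subset_univ _, hV.finite, ?_, ?_⟩
    · rw [← compl_eq_univ_sdiff]; exact hV.finite_edges
    · rw [← compl_eq_univ_sdiff]
      intro e he
      obtain ⟨ψ, a, b, h1, rfl, -⟩ := hV.edge e he
      exact h1.nonempty_homeomorph
  rw [h.genus_eq, ← compl_eq_univ_sdiff,
    components_of_isPreconnected isPreconnected_univ univ_nonempty, ncard_singleton]
  simp

theorem IsAdapted.genus_component (hT : IsCurve T) (hV : IsAdapted ι V) {C : Set T}
    (hC : C ∈ components ι.realLocus) :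
    genus C = 1 + {e ∈ components Vᶜ | e ⊆ C}.ncard - (C ∩ V).ncard := by
  have := hT.t2
  have h : IsVertexSet C (C ∩ V) := by
    refine ⟨inter_subset_left, hV.finite.subset inter_subset_right, ?_, ?_⟩
    · rw [hV.components_diff hC]
      exact hV.finite_edges.subset (sep_subset _ _)
    · rw [hV.components_diff hC]
      rintro e ⟨he, -⟩
      obtain ⟨ψ, a, b, h1, rfl, -⟩ := hV.edge e he
      exact h1.nonempty_homeomorph
  rw [h.genus_eq, hV.components_diff hC, components_of_isPreconnected
    (isPreconnected_of_mem_components hC) (nonempty_of_mem_components hC), ncard_singleton]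
  simp

/-- A real component contributes 2 plus its edges minus its vertices; real edges and real vertices
are partitioned among the components. -/
theorem IsAdapted.s_eq (hT : IsCurve T) (hV : IsAdapted ι V) :
    ι.s = 2 * (components ι.realLocus).ncard + {e ∈ components Vᶜ | e ⊆ ι.realLocus}.ncard
      - (ι.realLocus ∩ V).ncard := by
  have hfin := hV.finite_components hT
  have hE : (⋃ C ∈ components ι.realLocus, {e ∈ components Vᶜ | e ⊆ C}) =
      {e ∈ components Vᶜ | e ⊆ ι.realLocus} := by
    apply Subset.antisymm
    · refine iUnion₂_subset fun C hC e he ↦ ⟨he.1, he.2.trans (subset_of_mem_components hC)⟩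
    · rintro e ⟨he, heF⟩
      obtain ⟨z, hz⟩ := nonempty_of_mem_components he
      have hC := connectedComponentIn_mem_components (heF hz)
      exact mem_iUnion₂.2 ⟨_, hC, he, subset_of_inter_nonempty hC
        (isPreconnected_of_mem_components he) heF ⟨z, hz, mem_connectedComponentIn (heF hz)⟩⟩
  have hE' := hfin.ncard_biUnion (s := fun C ↦ {e ∈ components Vᶜ | e ⊆ C})
    (fun C _ ↦ hV.finite_edges.subset (sep_subset _ _)) (by
      intro C hC C' hC' hne
      refine disjoint_left.2 fun e he he' ↦ hne ?_
      obtain ⟨z, hz⟩ := nonempty_of_mem_components he.1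
      exact eq_of_mem_components hC hC' (he.2 hz) (he'.2 hz))
  have hW : (⋃ C ∈ components ι.realLocus, C ∩ V) = ι.realLocus ∩ V := by
    apply Subset.antisymm
    · exact iUnion₂_subset fun C hC ↦ inter_subset_inter_left _ (subset_of_mem_components hC)
    · rintro z ⟨hzF, hzV⟩
      exact mem_iUnion₂.2 ⟨_, connectedComponentIn_mem_components hzF,
        mem_connectedComponentIn hzF, hzV⟩
  have hW' := hfin.ncard_biUnion (s := fun C ↦ C ∩ V)
    (fun C _ ↦ hV.finite.subset inter_subset_right) (by
      intro C hC C' hC' hne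
      refine disjoint_left.2 fun z hz hz' ↦ hne ?_
      exact eq_of_mem_components hC hC' hz.1 hz'.1)
  rw [hE, finsum_mem_eq_finite_toFinset_sum _ hfin] at hE'
  rw [hW, finsum_mem_eq_finite_toFinset_sum _ hfin] at hW'
  rw [RealStructure.s, finsum_mem_congr (g := fun C ↦
    (2 + {e ∈ components Vᶜ | e ⊆ C}.ncard - (C ∩ V).ncard : ℤ)) rfl
    (fun C hC ↦ by rw [hV.genus_component hT hC]; ring),
    finsum_mem_eq_finite_toFinset_sum _ hfin, Finset.sum_sub_distrib, Finset.sum_add_distrib,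
    hE', hW', Finset.sum_const, ncard_eq_toFinset_card _ hfin]
  push_cast
  simp [mul_comm]

/-- The edges which are disjoint from their conjugates. -/
def nonrealEdges (ι : RealStructure T) (V : Set T) : Set (Set T) :=
  {e ∈ components Vᶜ | Disjoint (ι.conj '' e) e}

theorem IsAdapted.edge_cases (hV : IsAdapted ι V) {e : Set T} (he : e ∈ components Vᶜ) :
    e ⊆ ι.realLocus ∨ e ∈ nonrealEdges ι V := by
  obtain ⟨ψ, a, b, -, -, -, -, h⟩ := hV.edge e he
  exact h.imp_right fun h ↦ ⟨he, h⟩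

/-- The M-condition in terms of vertices and edges. -/
theorem IsAdapted.ncard_nonrealEdges (hT : IsCurve T) (hV : IsAdapted ι V) (hM : ι.IsM) :
    (nonrealEdges ι V).ncard + 2 = 2 * (components ι.realLocus).ncard +
      (V \ ι.realLocus).ncard := by
  have h1 : {e ∈ components Vᶜ | e ⊆ ι.realLocus}.ncard + (nonrealEdges ι V).ncard =
      (components Vᶜ).ncard := by
    have hf : (nonrealEdges ι V).Finite := hV.finite_edges.subset (sep_subset _ _)
    rw [← ncard_union_eq _ (hV.finite_edges.subset (sep_subset _ _)) hf]
    · congr 1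
      apply Subset.antisymm
      · exact union_subset (sep_subset _ _) (sep_subset _ _)
      · exact fun e he ↦ (hV.edge_cases he).imp (fun h ↦ ⟨he, h⟩) id
    · refine disjoint_left.2 fun e he he' ↦ ?_
      obtain ⟨z, hz⟩ := nonempty_of_mem_components he.1
      exact disjoint_left.1 (disjoint_realLocus he'.2) hz (he.2 hz)
  have h2 := ncard_inter_add_ncard_sdiff_eq_ncard V ι.realLocus hV.finite
  -- Subtracting the Euler counts of the real locus and of the curve leaves only nonreal edges and
  -- vertices.
  have h3 : ι.s = genus (univ : Set T) + 1 := hM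
  rw [hV.s_eq hT, hV.genus_univ hT, inter_comm] at h3
  omega

theorem isClosed_edge_union (hT : IsCurve T) {ψ : ℝ → T} {a b : ℝ} (h : IsArc ψ a b) :
    IsClosed (ψ '' Ioo a b ∪ {ψ a, ψ b}) := by
  have := hT.t2
  rw [← h.image_Icc]
  exact h.isClosed isClosed_Icc Subset.rfl

/-- The genus of a curve is not negative. -/
theorem IsAdapted.ncard_le (hT : IsCurve T) (hV : IsAdapted ι V) :
    V.ncard ≤ (components Vᶜ).ncard + 1 := by
  have := hT.t2
  have := hT.connected
  choose ψ a b h1 h2 h3 h4 _ using fun e : components Vᶜ ↦ hV.edge e e.2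
  by_contra! hlt
  have hVne : V.Nonempty := by
    rw [nonempty_iff_ne_empty]
    rintro rfl
    simp at hlt
  obtain ⟨v, hv⟩ := hVne
  have hfin := hV.finite_edges.to_subtype
  -- With too few edges, the vertices, joined by all closed edges, could be separated, and the
  -- connected curve would be a disjoint union of two nonempty closed sets.
  let Y : Set (Set T) := (fun v ↦ {v}) '' V
  have hmemY : ∀ v ∈ V, ({v} : Set T) ∈ Y := fun v hv ↦ ⟨v, hv, rfl⟩
  obtain ⟨A₀, A₁, hA₀, hA₁, hd, hne, hun, hK, -⟩ := exists_closed_separation (Y := Y)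
    (hV.finite.image _) (by rintro _ ⟨v, -, rfl⟩; exact isClosed_singleton)
    (by rintro _ ⟨v, -, rfl⟩; exact singleton_nonempty v)
    (by rintro _ ⟨v, -, rfl⟩ _ ⟨w, -, rfl⟩ z rfl hz
        rw [mem_singleton_iff.1 hz])
    (I := components Vᶜ) (fun e ↦ (e : Set T) ∪ {ψ e (a e), ψ e (b e)})
    (fun e ↦ ⟨{ψ e (a e)}, hmemY _ (h3 e)⟩) (fun e ↦ ⟨{ψ e (b e)}, hmemY _ (h4 e)⟩)
    (fun e ↦ by
      have := isClosed_edge_union hT (h1 e)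
      rwa [← h2 e] at this)
    (by rintro e ⟨_, v, hv, rfl⟩ z hz hzv
        obtain rfl : z = v := hzv
        rcases hz with hz | rfl | rfl
        · exact absurd hv (subset_of_mem_components e.2 hz)
        · exact Or.inl rfl
        · exact Or.inr rfl)
    (by rintro e e' hne z ⟨hz, hz'⟩
        by_cases hzV : z ∈ V
        · exact ⟨{z}, hmemY z hzV, rfl⟩
        have hze : ∀ e : components Vᶜ, z ∈ (e : Set T) ∪ {ψ e (a e), ψ e (b e)} →
            z ∈ (e : Set T) := by
          rintro e (hz | rfl | rfl)
          · exact hz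
          · exact absurd (h3 e) hzV
          · exact absurd (h4 e) hzV
        exact absurd (Subtype.ext (eq_of_mem_components e.2 e'.2 (hze e hz) (hze e' hz'))) hne)
    (hmemY v hv) (by
      rw [Nat.card_coe_set_eq, ncard_image_of_injective _ singleton_injective]
      exact hlt)
  have hun' : A₀ ∪ A₁ = univ := by
    rw [hun, eq_univ_iff_forall]
    intro z
    by_cases hz : z ∈ V
    · exact Or.inl ⟨{z}, hmemY z hz, rfl⟩
    · exact Or.inr (mem_iUnion.2 ⟨⟨_, connectedComponentIn_mem_components hz⟩,
        Or.inl (mem_connectedComponentIn hz)⟩)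
  obtain ⟨z, -, hz0, hz1⟩ := isPreconnected_closed_iff.1 isPreconnected_univ A₀ A₁ hA₀ hA₁
    hun'.ge ⟨v, mem_univ v, hK rfl⟩ (by rwa [univ_inter])
  exact disjoint_left.1 hd hz0 hz1

/-- An M-curve has real points. -/
theorem IsCurve.exists_real (hT : IsCurve T) (hM : ι.IsM) : ι.realLocus.Nonempty := by
  obtain ⟨V₀, hV₀, h⟩ := hT.exists_isAdapted ι
  have hV : IsAdapted ι (V₀ ∪ ι.conj '' V₀) := by
    refine h _ (hV₀.union (hV₀.image _)) ?_ subset_union_left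
    rintro _ (hv | ⟨v, hv, rfl⟩)
    · exact Or.inr ⟨_, hv, rfl⟩
    · rw [ι.conj_conj]; exact Or.inl hv
  have h1 := hV.ncard_nonrealEdges hT hM
  have h2 := hV.ncard_le hT
  rw [nonempty_iff_ne_empty]
  -- Without real points all edges and vertices are nonreal, and the M-condition gives edges + 2 =
  -- vertices, which contradicts connectedness.
  intro h3
  have h4 : nonrealEdges ι (V₀ ∪ ι.conj '' V₀) = components (V₀ ∪ ι.conj '' V₀)ᶜ := by
    refine Subset.antisymm (sep_subset _ _) fun e he ↦ (hV.edge_cases he).resolve_left fun h5 ↦ ?_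
    obtain ⟨z, hz⟩ := nonempty_of_mem_components he
    rw [h3] at h5
    exact h5 hz
  rw [h4, h3] at h1
  simp only [components, image_empty, ncard_empty, sdiff_empty] at h1 h2
  omega

/-- Removing a nonreal edge and its conjugate from an M-curve separates the ends of the edge. -/
theorem IsAdapted.exists_separation (hT : IsCurve T) (hV : IsAdapted ι V) (hM : ι.IsM)
    {ψ : ℝ → T} {a b : ℝ} (hψ : IsArc ψ a b) (ha : ψ a ∈ V) (hb : ψ b ∈ V)
    (hdisj : Disjoint (ψ '' Ioo a b) V)
    (hJ : Disjoint (ι.conj '' (ψ '' Ioo a b)) (ψ '' Ioo a b)) :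
    ∃ A₀ A₁ : Set T, IsClosed A₀ ∧ IsClosed A₁ ∧ Disjoint A₀ A₁ ∧
      A₀ ∪ A₁ = (ψ '' Ioo a b ∪ ι.conj '' (ψ '' Ioo a b))ᶜ ∧
      (∀ z ∈ A₀, ι.conj z ∈ A₀) ∧ (∀ z ∈ A₁, ι.conj z ∈ A₁) ∧ ψ a ∈ A₀ ∧ ψ b ∈ A₁ := by
  classical
  have := hT.t2
  have := hT.connected
  set F := ι.realLocus with hF
  have hFc : IsClosed F := hT.isClosed_realLocus
  set J := ψ '' Ioo a b with hJdef
  -- The sets `cl e` play the role of the edges of the quotient graph.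
  let cl : Set T → Set T := fun e ↦ e ∪ ι.conj '' e
  have hclinv : ∀ e, ∀ z ∈ cl e, ι.conj z ∈ cl e := by
    rintro e z (hz | ⟨z, hz, rfl⟩)
    · exact Or.inr ⟨z, hz, rfl⟩
    · rw [ι.conj_conj]; exact Or.inl hz
  have hconjE : ∀ e ∈ nonrealEdges ι V, ι.conj '' e ∈ nonrealEdges ι V := by
    rintro e ⟨he, hd⟩
    obtain ⟨γ, a', b', h1, rfl, h3, h4, -⟩ := hV.edge e he
    have h5 : ι.conj '' (γ '' Ioo a' b') = (fun t ↦ ι.conj (γ t)) '' Ioo a' b' := image_image _ _ _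
    have h6 : (a' + b') / 2 ∈ Ioo a' b' := ⟨by linarith [h1.lt], by linarith [h1.lt]⟩
    have hdV : Disjoint (ι.conj '' (γ '' Ioo a' b')) V := by
      rw [disjoint_left]
      rintro _ ⟨z, hz, rfl⟩ hzV
      have := hV.conj_mem _ hzV
      rw [ι.conj_conj] at this
      exact subset_of_mem_components he hz this
    refine ⟨?_, ?_⟩
    · have h7 := (isArc_conj ι h1).connectedComponentIn_eq (V := V) (hV.conj_mem _ h3)
        (hV.conj_mem _ h4) (h5 ▸ hdV) (mem_image_of_mem _ h6)
      rw [h5, ← h7]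
      refine connectedComponentIn_mem_components fun h8 ↦ ?_
      exact disjoint_left.1 hdV (h5 ▸ mem_image_of_mem _ h6) h8
    · rw [image_image]
      simpa [ι.conj_conj] using hd.symm
  have hclE : ∀ e ∈ nonrealEdges ι V, ∀ e' ∈ nonrealEdges ι V, ∀ z ∈ cl e, z ∈ cl e' →
      e' = e ∨ e' = ι.conj '' e := by
    intro e he e' he' z hz hz'
    have hz1 : z ∈ e' ∨ ι.conj z ∈ e' := by
      rcases hz' with hz' | ⟨w, hw, rfl⟩
      · exact Or.inl hz'
      · right; rwa [ι.conj_conj]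
    have key : ∀ w ∈ cl e, w ∈ e' → e' = e ∨ e' = ι.conj '' e := by
      rintro w (hw | hw) hw'
      · exact Or.inl (eq_of_mem_components he'.1 he.1 hw' hw)
      · exact Or.inr (eq_of_mem_components he'.1 (hconjE e he).1 hw' hw)
    rcases hz1 with h | h
    · exact key z hz h
    · exact key _ (hclinv e z hz) h
  have hclconj : ∀ e, cl (ι.conj '' e) = cl e := by
    intro e
    simp only [cl, image_image, ι.conj_conj, image_id']
    exact union_comm _ _
  have hJE : J ∈ nonrealEdges ι V := by
    have h6 : (a + b) / 2 ∈ Ioo a b := ⟨by linarith [hψ.lt], by linarith [hψ.lt]⟩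
    refine ⟨?_, hJ⟩
    rw [hJdef, ← hψ.connectedComponentIn_eq ha hb hdisj (mem_image_of_mem ψ h6)]
    exact connectedComponentIn_mem_components
      fun h ↦ disjoint_left.1 hdisj (mem_image_of_mem ψ h6) h
  set EN := nonrealEdges ι V with hEN
  have hENfin : EN.Finite := hV.finite_edges.subset (sep_subset _ _)
  have hcardE : EN.ncard = 2 * (cl '' EN).ncard := by
    refine ncard_eq_two_mul_ncard_image hENfin (fun e ↦ ι.conj '' e) hconjE ?_ cl ?_
    · intro e he h
      obtain ⟨z, hz⟩ := nonempty_of_mem_components he.1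
      exact disjoint_left.1 he.2 (h.symm ▸ hz : z ∈ ι.conj '' e) hz
    · intro e he e' he'
      constructor
      · intro h
        obtain ⟨z, hz⟩ := nonempty_of_mem_components he'.1
        exact hclE e he e' he' z (h ▸ Or.inl hz) (Or.inl hz)
      · rintro (rfl | rfl)
        · rfl
        · exact hclconj e
  -- `κ` sends a vertex to its vertex in the quotient: its whole real component, or its conjugate
  -- pair.
  let κ : T → Set T := fun v ↦ if v ∈ F then connectedComponentIn F v else {v, ι.conj v}
  have hκF : ∀ v ∈ F, κ v = connectedComponentIn F v := fun v hv ↦ if_pos hv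
  have hκN : ∀ v ∉ F, κ v = {v, ι.conj v} := fun v hv ↦ if_neg hv
  have hconjF : ∀ v, ι.conj v ∈ F ↔ v ∈ F := fun v ↦ by
    simp only [hF, RealStructure.realLocus, mem_ofPred_eq, ι.conj_conj]
    exact eq_comm
  have hκconj : ∀ v, κ (ι.conj v) = κ v := by
    intro v
    by_cases hv : v ∈ F
    · rw [show ι.conj v = v from hv]
    · rw [hκN v hv, hκN _ (fun h ↦ hv ((hconjF v).1 h)), ι.conj_conj, pair_comm]
  have hκself : ∀ v, v ∈ κ v := by
    intro v
    by_cases hv : v ∈ F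
    · rw [hκF v hv]; exact mem_connectedComponentIn hv
    · rw [hκN v hv]; exact Or.inl rfl
  let Y : Set (Set T) := components F ∪ κ '' (V \ F)
  have hcompfin := hV.finite_components hT
  have hκY : ∀ v ∈ V, κ v ∈ Y := by
    intro v hv
    by_cases hvF : v ∈ F
    · rw [hκF v hvF]; exact Or.inl (connectedComponentIn_mem_components hvF)
    · exact Or.inr ⟨v, ⟨hv, hvF⟩, rfl⟩
  have hYsub : ∀ K ∈ Y, ∀ z ∈ K, K = κ z ∧ z ∈ F ∪ V := by
    rintro K (hK | ⟨v, ⟨hv, hvF⟩, rfl⟩) z hz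
    · have hzF := subset_of_mem_components hK hz
      rw [hκF z hzF]
      exact ⟨eq_connectedComponentIn_of_mem_components hK hz, Or.inl hzF⟩
    · rw [hκN v hvF] at hz
      rcases hz with rfl | rfl
      · exact ⟨rfl, Or.inr hv⟩
      · exact ⟨(hκconj v).symm, Or.inr (hV.conj_mem v hv)⟩
  have hcardV : (V \ F).ncard = 2 * (κ '' (V \ F)).ncard := by
    refine ncard_eq_two_mul_ncard_image hV.finite.sdiff ι.conj
      (fun v hv ↦ ⟨hV.conj_mem v hv.1, fun h ↦ hv.2 ((hconjF v).1 h)⟩) (fun v hv ↦ hv.2) κ ?_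
    intro v hv w hw
    constructor
    · intro h
      have := h ▸ hκself w
      rwa [hκN v hv.2] at this
    · rintro (rfl | rfl)
      · rfl
      · exact hκconj v
  have hcardY : Y.ncard = (components F).ncard + (κ '' (V \ F)).ncard := by
    refine ncard_union_eq ?_ hcompfin (hV.finite.sdiff.image _)
    refine disjoint_left.2 ?_
    rintro _ hK ⟨v, hv, rfl⟩
    exact hv.2 (subset_of_mem_components hK (hκself v))
  choose! γ α β h1 h2 h3 h4 _h5 using hV.edge
  let I := {c // c ∈ (cl '' EN) \ {cl J}}
  have : Finite I := (hENfin.image cl).sdiff.to_subtype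
  choose ε hε hεc using fun c : I ↦ c.2.1
  -- The quotient has one vertex more than it has edges, and `I` omits the edge `cl J`. This spare
  -- edge provides the strict inequality.
  have hcardI : Nat.card I + 1 < Y.ncard := by
    have h6 : Nat.card I + 1 = (cl '' EN).ncard := by
      rw [← ncard_sdiff_singleton_add_one (mem_image_of_mem cl hJE) (hENfin.image cl)]
      rw [← Nat.card_coe_set_eq]
    have h7 := hV.ncard_nonrealEdges hT hM
    rw [h6, hcardY]
    rw [← hEN, ← hF] at h7
    omega
  -- A closed edge together with its conjugate, built from a chosen representative of the pair.
  let M : I → Set T := fun c ↦ cl (ε c ∪ {γ (ε c) (α (ε c)), γ (ε c) (β (ε c))})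
  have hMmem : ∀ c : I, ∀ z ∈ M c, z ∈ (c : Set T) ∨ (z ∈ V ∧
      (κ z = κ (γ (ε c) (α (ε c))) ∨ κ z = κ (γ (ε c) (β (ε c))))) := by
    have key : ∀ c : I, ∀ z ∈ ε c ∪ {γ (ε c) (α (ε c)), γ (ε c) (β (ε c))}, z ∈ ε c ∨ (z ∈ V ∧
      (κ z = κ (γ (ε c) (α (ε c))) ∨ κ z = κ (γ (ε c) (β (ε c))))) := by
      rintro c z (hz | rfl | rfl)
      · exact Or.inl hz
      · exact Or.inr ⟨h3 _ (hε c).1, Or.inl rfl⟩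
      · exact Or.inr ⟨h4 _ (hε c).1, Or.inr rfl⟩
    rintro c z (hz | ⟨z, hz, rfl⟩)
    · refine (key c z hz).imp_left fun h ↦ ?_
      rw [← hεc c]; exact Or.inl h
    · refine (key c z hz).imp (fun h ↦ ?_) fun h ↦ ?_
      · rw [← hεc c]; exact Or.inr ⟨z, h, rfl⟩
      · rw [hκconj]; exact ⟨hV.conj_mem z h.1, h.2⟩
  have hcV : ∀ e ∈ EN, ∀ z ∈ cl e, z ∉ F ∪ V := by
    have key : ∀ e ∈ EN, ∀ z ∈ e, z ∉ F ∪ V := by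
      rintro e he z hz (h | h)
      · exact disjoint_left.1 (disjoint_realLocus he.2) hz h
      · exact subset_of_mem_components he.1 hz h
    rintro e he z (hz | hz)
    · exact key e he z hz
    · exact key _ (hconjE e he) z hz
  obtain ⟨A₀, A₁, hA₀, hA₁, hd, hne, hun, hK, hYA, hMA⟩ := exists_closed_separation (Y := Y)
    (hcompfin.union (hV.finite.sdiff.image _))
    (by rintro K (hK | ⟨v, ⟨-, hv⟩, rfl⟩)
        · exact isClosed_of_mem_components hFc hK
        · rw [hκN v hv]; exact (toFinite _).isClosed)
    (by rintro K (hK | ⟨v, -, rfl⟩)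
        · exact nonempty_of_mem_components hK
        · exact ⟨v, hκself v⟩)
    (fun K hK L hL z hzK hzL ↦ (hYsub K hK z hzK).1.trans (hYsub L hL z hzL).1.symm)
    M (fun c ↦ ⟨_, hκY _ (h3 _ (hε c).1)⟩) (fun c ↦ ⟨_, hκY _ (h4 _ (hε c).1)⟩)
    (fun c ↦ by
      have h6 := isClosed_edge_union hT (h1 _ (hε c).1)
      rw [← h2 _ (hε c).1] at h6
      exact h6.union (ι.isClosed_image h6))
    (by rintro c ⟨K, hKY⟩ z hz hzK
        obtain ⟨h6, h7⟩ := hYsub K hKY z hzK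
        rcases hMmem c z hz with h8 | ⟨-, h8⟩
        · rw [← hεc c] at h8
          exact absurd h7 (hcV _ (hε c) z h8)
        · subst h6
          exact h8.imp (fun h ↦ Subtype.ext h) fun h ↦ Subtype.ext h)
    (by rintro c d hcd z ⟨hz, hz'⟩
        rcases hMmem c z hz with h6 | ⟨h6, -⟩
        · rcases hMmem d z hz' with h7 | ⟨h7, -⟩
          · refine absurd (Subtype.ext ?_) hcd
            rw [← hεc c] at h6 ⊢
            rw [← hεc d] at h7 ⊢
            rcases hclE _ (hε c) _ (hε d) z h6 h7 with h8 | h8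
            · rw [h8]
            · rw [h8, hclconj]
          · exact ⟨κ z, hκY z h7, hκself z⟩
        · exact ⟨κ z, hκY z h6, hκself z⟩)
    (hκY _ ha) hcardI
  have hYinv : ∀ K ∈ Y, ∀ z ∈ K, ι.conj z ∈ K := by
    intro K hK z hz
    rw [(hYsub K hK z hz).1, ← hκconj]
    exact hκself _
  have hun' : A₀ ∪ A₁ = (cl J)ᶜ := by
    rw [hun]
    apply Subset.antisymm
    · rintro z (⟨K, hK, hz⟩ | hz) hzJ
      · exact hcV J hJE z hzJ (hYsub K hK z hz).2
      · obtain ⟨c, hz⟩ := mem_iUnion.1 hz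
        rcases hMmem c z hz with h6 | ⟨h6, -⟩
        · rw [← hεc c] at h6
          refine c.2.2 ?_
          rw [mem_singleton_iff, ← hεc c]
          rcases hclE _ (hε c) _ hJE z h6 hzJ with h8 | h8
          · rw [h8]
          · rw [h8, hclconj]
        · exact hcV J hJE z hzJ (Or.inr h6)
    · intro z hzJ
      by_cases hzF : z ∈ F
      · exact Or.inl ⟨_, Or.inl (connectedComponentIn_mem_components hzF),
          mem_connectedComponentIn hzF⟩
      by_cases hzV : z ∈ V
      · exact Or.inl ⟨κ z, hκY z hzV, hκself z⟩
      have he := connectedComponentIn_mem_components (S := Vᶜ) hzV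
      have hze := mem_connectedComponentIn (F := Vᶜ) hzV
      have heN := (hV.edge_cases he).resolve_left fun h ↦ hzF (h hze)
      have hc : cl (connectedComponentIn Vᶜ z) ∈ (cl '' EN) \ {cl J} :=
        ⟨⟨_, heN, rfl⟩, fun h ↦ hzJ (mem_singleton_iff.1 h ▸ Or.inl hze)⟩
      refine Or.inr (mem_iUnion.2 ⟨⟨_, hc⟩, ?_⟩)
      have h9 : z ∈ cl (ε ⟨_, hc⟩) := by rw [hεc ⟨_, hc⟩]; exact Or.inl hze
      exact h9.imp (fun h ↦ Or.inl h) (fun h ↦ image_mono subset_union_left h)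
  -- Every point of `A₀ ∪ A₁` lies in a block stable under conjugation which is contained in one of
  -- the two sides; so both sides are stable.
  have hinv : ∀ z, ∃ B : Set T, (z ∈ A₀ ∪ A₁ → z ∈ B ∧ ι.conj z ∈ B) ∧ (B ⊆ A₀ ∨ B ⊆ A₁) := by
    intro z
    by_cases hz : z ∈ A₀ ∪ A₁
    · rw [hun] at hz
      rcases hz with ⟨K, hK, hz⟩ | hz
      · exact ⟨K, fun _ ↦ ⟨hz, hYinv K hK z hz⟩, hYA K hK⟩
      · obtain ⟨c, hz⟩ := mem_iUnion.1 hz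
        exact ⟨M c, fun _ ↦ ⟨hz, hclinv _ z hz⟩, hMA c⟩
    · exact ⟨∅, fun h ↦ absurd h hz, Or.inl (empty_subset _)⟩
  have hb' : ψ b ∈ A₀ ∪ A₁ := by
    rw [hun]; exact Or.inl ⟨κ (ψ b), hκY _ hb, hκself _⟩
  have ha' : ψ a ∈ A₀ := hK (hκself _)
  have hinv₀ : ∀ z ∈ A₀, ι.conj z ∈ A₀ := by
    intro z hz
    obtain ⟨B, hB, hB'⟩ := hinv z
    obtain ⟨h6, h7⟩ := hB (Or.inl hz)
    exact hB'.resolve_right (fun h ↦ disjoint_left.1 hd hz (h h6)) h7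
  have hinv₁ : ∀ z ∈ A₁, ι.conj z ∈ A₁ := by
    intro z hz
    obtain ⟨B, hB, hB'⟩ := hinv z
    obtain ⟨h6, h7⟩ := hB (Or.inr hz)
    exact hB'.resolve_left (fun h ↦ disjoint_left.1 hd (h h6) hz) h7
  -- If both ends of `J` were in `A₀`, then `A₀` with the closures of `J` and its conjugate, and
  -- `A₁`, would be disjoint nonempty closed sets covering the connected curve.
  refine ⟨A₀, A₁, hA₀, hA₁, hd, hun', hinv₀, hinv₁, ha', hb'.resolve_left fun hb₀ ↦ ?_⟩
  have hJcl : IsClosed (J ∪ {ψ a, ψ b}) := isClosed_edge_union hT hψ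
  have hends : ({ψ a, ψ b} : Set T) ⊆ A₀ := by
    rintro _ (rfl | rfl)
    exacts [ha', hb₀]
  have hB : IsClosed (A₀ ∪ ((J ∪ {ψ a, ψ b}) ∪ ι.conj '' (J ∪ {ψ a, ψ b}))) :=
    hA₀.union (hJcl.union (ι.isClosed_image hJcl))
  obtain ⟨z, -, hz0, hz1⟩ := isPreconnected_closed_iff.1 isPreconnected_univ _ A₁ hB hA₁
    (fun z _ ↦ by
      by_cases hz : z ∈ cl J
      · left; right
        exact hz.imp (fun h ↦ Or.inl h) (fun h ↦ image_mono subset_union_left h)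
      · rw [← mem_compl_iff, ← hun'] at hz
        exact hz.imp_left Or.inl) ⟨ψ a, mem_univ _, Or.inl ha'⟩ (by rwa [univ_inter])
  have hnot : ∀ z ∈ J ∪ {ψ a, ψ b}, z ∉ A₁ := by
    rintro z (hz | hz) hz1
    · exact (hun' ▸ Or.inr hz1 : z ∈ (cl J)ᶜ) (Or.inl hz)
    · exact disjoint_left.1 hd (hends hz) hz1
  rcases hz0 with hz0 | hz0 | ⟨z, hz0, rfl⟩
  · exact disjoint_left.1 hd hz0 hz1
  · exact hnot z hz0 hz1
  · have := hinv₁ _ hz1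
    rw [ι.conj_conj] at this
    exact hnot z hz0 this

end Counting

/-! ### Moving conjugate pairs of points -/

section Slopes

variable {T : Type*} [TopologicalSpace T] [EDist T]

theorem isStarChart_two_sided {γ : ℝ → T} {t ε : ℝ} (hε : 0 < ε)
    (h : ∀ s ∈ Ioo (t - ε) (t + ε), ∀ s' ∈ Ioo (t - ε) (t + ε),
      edist (γ s) (γ s') = ENNReal.ofReal |s - s'|) (ho : IsOpen (γ '' Ioo (t - ε) (t + ε))) :
    IsStarChart (γ t) 2 ε ![fun s ↦ γ (t + s), fun s ↦ γ (t - s)] := by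
  have h1 : ∀ s ∈ Ico 0 ε, t + s ∈ Ioo (t - ε) (t + ε) := fun s hs ↦
    ⟨by linarith [hs.1], by linarith [hs.2]⟩
  have h2 : ∀ s ∈ Ico 0 ε, t - s ∈ Ioo (t - ε) (t + ε) := fun s hs ↦
    ⟨by linarith [hs.2], by linarith [hs.1]⟩
  refine ⟨by norm_num, hε, ?_, ?_, ?_, ?_⟩
  · intro k; fin_cases k <;> simp
  · intro k s hs s' hs'
    fin_cases k
    · refine (h _ (h1 s hs) _ (h1 s' hs')).trans ?_
      congr 2; ring
    · refine (h _ (h2 s hs) _ (h2 s' hs')).trans ?_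
      rw [abs_sub_comm]; congr 2; ring
  · intro k l hkl s hs s' hs'
    fin_cases k <;> fin_cases l
    · exact absurd rfl hkl
    · refine (h _ (h1 s hs) _ (h2 s' hs')).trans ?_
      rw [abs_of_nonneg (by linarith [hs.1, hs'.1])]; congr 1; ring
    · refine (h _ (h2 s hs) _ (h1 s' hs')).trans ?_
      rw [abs_sub_comm, abs_of_nonneg (by linarith [hs.1, hs'.1])]; congr 1; ring
    · exact absurd rfl hkl
  · refine mem_of_superset (ho.mem_nhds ⟨t, ⟨by linarith, by linarith⟩, rfl⟩) ?_
    rintro _ ⟨s, hs, rfl⟩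
    rcases le_total t s with hst | hst
    · exact ⟨0, s - t, ⟨by linarith, by linarith [hs.2]⟩, by simp⟩
    · exact ⟨1, t - s, ⟨by linarith, by linarith [hs.1]⟩, by simp⟩

theorem hasSlope_two_sided {g : T → ℝ} {γ : ℝ → T} {t ε c : ℝ} {σ₀ σ₁ : ℤ} (hε : 0 < ε)
    (h : ∀ s ∈ Ioo (t - ε) (t + ε), ∀ s' ∈ Ioo (t - ε) (t + ε),
      edist (γ s) (γ s') = ENNReal.ofReal |s - s'|) (ho : IsOpen (γ '' Ioo (t - ε) (t + ε)))
    (hb : BallNhds (γ t)) (h0 : ∀ s ∈ Ico 0 ε, g (γ (t + s)) = c + σ₀ * s)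
    (h1 : ∀ s ∈ Ico 0 ε, g (γ (t - s)) = c + σ₁ * s) : HasSlope g (γ t) (σ₀ + σ₁) := by
  refine Or.inl ⟨hb, 2, ε, _, c, ![σ₀, σ₁], isStarChart_two_sided hε h ho, ?_, by simp⟩
  intro k s hs
  fin_cases k
  · exact h0 s hs
  · exact h1 s hs

/-- Linear equivalence in terms of real-valued functions. -/
def SlopeEquiv (D D' : T →₀ ℤ) : Prop := ∃ g : T → ℝ, ∀ p, HasSlope g p (D' p - D p)

theorem SlopeEquiv.refl (hT : IsCurve T) (D : T →₀ ℤ) : SlopeEquiv D D :=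
  ⟨fun _ ↦ 0, fun p ↦ by
    rw [sub_self]; exact hT.hasSlope_zero (Eventually.of_forall fun _ ↦ rfl)⟩

theorem SlopeEquiv.symm {D D' : T →₀ ℤ} (h : SlopeEquiv D D') : SlopeEquiv D' D := by
  obtain ⟨g, hg⟩ := h
  refine ⟨fun x ↦ -g x, fun p ↦ ?_⟩
  rw [← neg_sub]
  exact (hg p).neg

theorem SlopeEquiv.trans (hT : IsCurve T) {D₁ D₂ D₃ : T →₀ ℤ} (h : SlopeEquiv D₁ D₂)
    (h' : SlopeEquiv D₂ D₃) : SlopeEquiv D₁ D₃ := by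
  obtain ⟨g, hg⟩ := h
  obtain ⟨g', hg'⟩ := h'
  refine ⟨fun x ↦ g x + g' x, fun p ↦ ?_⟩
  rw [show D₃ p - D₁ p = (D₂ p - D₁ p) + (D₃ p - D₂ p) by ring]
  exact (hg p).add hT (hg' p)

theorem SlopeEquiv.add (hT : IsCurve T) {D₁ D₂ D₁' D₂' : T →₀ ℤ} (h : SlopeEquiv D₁ D₂)
    (h' : SlopeEquiv D₁' D₂') : SlopeEquiv (D₁ + D₁') (D₂ + D₂') := by
  obtain ⟨g, hg⟩ := h
  obtain ⟨g', hg'⟩ := h'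
  refine ⟨fun x ↦ g x + g' x, fun p ↦ ?_⟩
  rw [Finsupp.add_apply, Finsupp.add_apply, add_sub_add_comm]
  exact (hg p).add hT (hg' p)

theorem SlopeEquiv.nsmul (hT : IsCurve T) {D D' : T →₀ ℤ} (h : SlopeEquiv D D') (n : ℕ) :
    SlopeEquiv (n • D) (n • D') := by
  induction n with
  | zero => rw [zero_smul, zero_smul]; exact SlopeEquiv.refl hT 0
  | succ n ih => rw [succ_nsmul, succ_nsmul]; exact ih.add hT h

variable (ι : RealStructure T)

/-- The divisor `p + ι p`. -/
noncomputable def conjPair (p : T) : T →₀ ℤ := Finsupp.single p 1 + Finsupp.single (ι.conj p) 1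

theorem conjPair_apply_of_ne {p x : T} (h : x ≠ p) (h' : x ≠ ι.conj p) : conjPair ι p x = 0 := by
  rw [conjPair, Finsupp.add_apply, Finsupp.single_eq_of_ne h, Finsupp.single_eq_of_ne h', add_zero]

theorem conjPair_self_of_nonreal {p : T} (h : p ∉ ι.realLocus) : conjPair ι p p = 1 := by
  rw [conjPair, Finsupp.add_apply, Finsupp.single_eq_same, Finsupp.single_eq_of_ne (Ne.symm h),
    add_zero]

theorem conjPair_self_of_real {p : T} (h : p ∈ ι.realLocus) : conjPair ι p p = 2 := by
  rw [conjPair, Finsupp.add_apply, show ι.conj p = p from h, Finsupp.single_eq_same]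
  norm_num

theorem conjPair_conj_apply (p x : T) : conjPair ι p (ι.conj x) = conjPair ι p x := by
  have key : ∀ p, Finsupp.single p (1 : ℤ) (ι.conj x) = Finsupp.single (ι.conj p) 1 x := by
    intro p
    classical
    rw [Finsupp.single_apply, Finsupp.single_apply]
    refine if_congr ⟨fun h ↦ ?_, fun h ↦ ?_⟩ rfl rfl
    · rw [h, ι.conj_conj]
    · rw [← h, ι.conj_conj]
  rw [conjPair, Finsupp.add_apply, Finsupp.add_apply, key, key, ι.conj_conj, add_comm]

open Classical in
/-- The function which is the distance from `b` on `J`, its conjugate on the conjugate of `J`, and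
is equal to `L` on `A` and to `0` elsewhere. -/
noncomputable def edgeFun (J A : Set T) (b : T) (L : ℝ) (x : T) : ℝ :=
  if x ∈ J then (edist b x).toReal else if ι.conj x ∈ J then (edist b (ι.conj x)).toReal else
    if x ∈ A then L else 0

variable {ι} {J A : Set T} {b : T} {L : ℝ}

theorem edgeFun_of_mem {x : T} (hx : x ∈ J) : edgeFun ι J A b L x = (edist b x).toReal :=
  if_pos hx

theorem edgeFun_of_mem_right {x : T} (hx : x ∉ J) (hx' : ι.conj x ∉ J) (hA : x ∈ A) :
    edgeFun ι J A b L x = L := by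
  rw [edgeFun, if_neg hx, if_neg hx', if_pos hA]

theorem edgeFun_of_notMem {x : T} (hx : x ∉ J) (hx' : ι.conj x ∉ J) (hA : x ∉ A) :
    edgeFun ι J A b L x = 0 := by
  rw [edgeFun, if_neg hx, if_neg hx', if_neg hA]

/-- By this symmetry, slopes need to be checked only along `J` and at its ends, and not along the
conjugate. -/
theorem edgeFun_conj (hJ : Disjoint (ι.conj '' J) J) (hA : ∀ z ∈ A, ι.conj z ∈ A) (x : T) :
    edgeFun ι J A b L (ι.conj x) = edgeFun ι J A b L x := by
  by_cases hx : x ∈ J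
  · have hx' : ι.conj x ∉ J := fun h ↦ disjoint_left.1 hJ (mem_image_of_mem _ hx) h
    rw [edgeFun, if_neg hx', ι.conj_conj, if_pos hx, edgeFun_of_mem hx]
  · have hA' : ι.conj x ∈ A ↔ x ∈ A :=
      ⟨fun h ↦ by rw [← ι.conj_conj x]; exact hA _ h, hA x⟩
    rw [edgeFun, edgeFun, ι.conj_conj, if_neg hx, if_neg hx]
    by_cases hx' : ι.conj x ∈ J
    · rw [if_pos hx', if_pos hx']
    · rw [if_neg hx', if_neg hx']
      by_cases h : x ∈ A
      · rw [if_pos h, if_pos (hA'.2 h)]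
      · rw [if_neg h, if_neg (hA'.not.2 h)]

end Slopes

/-! ### Moves along an unbounded edge -/

section Moves

variable {T : Type*} [TopologicalSpace T] [EDist T] {ι : RealStructure T}

/-- A conjugate pair at the end of a ray can be moved along it. -/
theorem IsRay.slopeEquiv (hT : IsCurve T) {p : T} {R t : ℝ} {φ : ℝ → T} (h : IsRay p R φ)
    (hp : ∀ x ≠ p, edist x p = ⊤) (hpF : p ∉ ι.realLocus) (ht : R < t)
    (hd : Disjoint (ι.conj '' (φ '' Ioi R)) (φ '' Ioi R)) :
    SlopeEquiv (conjPair ι p) (conjPair ι (φ t)) := by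
  set J := φ '' Ioi t with hJ
  have hsub : J ⊆ φ '' Ioi R := image_mono (Ioi_subset_Ioi ht.le)
  have hdJ : Disjoint (ι.conj '' J) J := hd.mono (image_mono hsub) hsub
  -- No piece lies beyond the end `p`, so no separation is needed: `g` vanishes off the tail and its
  -- conjugate.
  set g := edgeFun ι J ∅ (φ t) 0
  have hgconj : ∀ x, g (ι.conj x) = g x := edgeFun_conj hdJ (by simp)
  have hptR : φ t ∈ φ '' Ioi R := ⟨t, ht, rfl⟩
  have hptF : φ t ∉ ι.realLocus := disjoint_left.1 (disjoint_realLocus hd) hptR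
  have hpt : φ t ≠ p := hT.ray_ne h ht
  have hmemJ : ∀ s, R < s → (φ s ∈ J ↔ t < s) := by
    intro s hs
    constructor
    · rintro ⟨s', hs', hss⟩
      rwa [← hT.ray_injOn h (ht.trans hs') hs hss]
    · exact fun h ↦ ⟨s, h, rfl⟩
  have hconjR : ∀ s, R < s → ι.conj (φ s) ∉ φ '' Ioi R := fun s hs hs' ↦
    disjoint_left.1 hd (mem_image_of_mem _ (mem_image_of_mem φ hs)) hs'
  have hpR : p ∉ φ '' Ioi R := by
    rintro ⟨s, hs, hsp⟩; exact hT.ray_ne h hs hsp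
  -- `ι p` is at infinite distance from all other points, whereas points of the ray have finite
  -- distances from each other.
  have hpR' : ι.conj p ∉ φ '' Ioi R := by
    rintro ⟨s, hs, hsp⟩
    have h1 := edist_conj_eq_top ι hp (φ (s + 1)) (fun h1 ↦ by
      have := hT.ray_injOn h (show R < s + 1 by linarith [show R < s from hs]) hs
        (h1.trans hsp.symm)
      linarith)
    rw [← hsp, h.endChart.edist_eq (s + 1) (show R < s + 1 by linarith [show R < s from hs]) s
      hs] at h1
    exact ENNReal.ofReal_ne_top h1
  have hpt' : φ t ≠ ι.conj p := fun h' ↦ hpR' (h' ▸ hptR)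
  have hg : ∀ s, t ≤ s → g (φ s) = s - t := by
    intro s hs
    have hsR : R < s := ht.trans_le hs
    rcases hs.eq_or_lt with rfl | hs'
    · rw [sub_self]
      exact edgeFun_of_notMem (fun h' ↦ lt_irrefl t ((hmemJ t ht).1 h'))
        (fun h' ↦ hconjR t ht (hsub h')) (by simp)
    · refine (edgeFun_of_mem (mem_image_of_mem φ (show s ∈ Ioi t from hs'))).trans ?_
      rw [h.endChart.edist_eq t ht s hsR, abs_sub_comm, abs_of_pos (sub_pos.2 hs'),
        ENNReal.toReal_ofReal (sub_pos.2 hs').le]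
  have hg' : ∀ s, R < s → s ≤ t → g (φ s) = 0 := fun s hs hst ↦
    edgeFun_of_notMem (fun h' ↦ absurd ((hmemJ s hs).1 h') (not_lt.2 hst))
      (fun h' ↦ hconjR s hs (hsub h')) (by simp)
  have hopen : ∀ s ε, 0 < ε → R < s - ε → IsOpen (φ '' Ioo (s - ε) (s + ε)) := by
    intro s ε hε hs
    have := hT.t2
    have hlt : s - ε < s + ε := by linarith
    have h1 := continuousOn_of_edist h.endChart.edist_eq fun t ht ↦ hT.ballNhds_ray h ht
    -- An open tail minus a smaller closed tail; the latter is closed because it includes the end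
    -- `p`.
    have h2 : φ '' Ioo (s - ε) (s + ε) = φ '' Ioi (s - ε) \ (insert p (φ '' Ici (s + ε))) := by
      ext x
      constructor
      · rintro ⟨u, hu, rfl⟩
        refine ⟨⟨u, hu.1, rfl⟩, ?_⟩
        rintro (h3 | ⟨v, hv, h3⟩)
        · exact hT.ray_ne h (hs.trans hu.1) h3
        · have h4 := hT.ray_injOn h ((hs.trans hlt).trans_le hv) (hs.trans hu.1) h3
          rw [h4] at hv
          exact absurd hu.2 (not_lt.2 hv)
      · rintro ⟨⟨u, hu, rfl⟩, h3⟩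
        exact ⟨u, ⟨hu, not_le.1 fun h4 ↦ h3 (Or.inr ⟨u, h4, rfl⟩)⟩, rfl⟩
    rw [h2]
    refine (h.isOpen _ hs.le).sdiff ?_
    have h3 := isClosed_edge_union hT (h.isArc_compactRay hT (hs.trans hlt))
    rw [image_compactRay, compactRay, if_pos le_rfl, compactRay, if_neg (by norm_num)] at h3
    convert h3 using 1
    rw [← Ioi_insert, image_insert_eq]
    ext x
    simp only [mem_insert_iff, mem_union, mem_singleton_iff, inv_one, sub_self, add_zero]
    tauto
  have hball : ∀ s, R < s → BallNhds (φ s) := fun s hs ↦ hT.ballNhds_ray h hs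
  have hint : ∀ x ∈ J, HasSlope g x (conjPair ι (φ t) x - conjPair ι p x) := by
    rintro _ ⟨s, hs, rfl⟩
    have hsR : R < s := ht.trans hs
    have hs0 : 0 < s - t := sub_pos.2 hs
    rw [conjPair_apply_of_ne, conjPair_apply_of_ne, sub_zero, show (0 : ℤ) = 1 + -1 by norm_num]
    · refine hasSlope_two_sided (c := s - t) hs0 (fun u hu v hv ↦ h.endChart.edist_eq u ?_ v ?_)
        (hopen s _ hs0 (by linarith)) (hball s hsR) ?_ ?_
      · exact show R < u by linarith [hu.1]
      · exact show R < v by linarith [hv.1]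
      · intro u hu
        rw [hg _ (by linarith [hu.1])]; push_cast; ring
      · intro u hu
        rw [hg _ (by linarith [hu.2])]; push_cast; ring
    · exact hT.ray_ne h hsR
    · exact fun h' ↦ hpR' (h' ▸ ⟨s, hsR, rfl⟩)
    · intro h'
      exact (ne_of_gt hs) (hT.ray_injOn h hsR ht h')
    · intro h'
      exact hconjR t ht (h' ▸ ⟨s, hsR, rfl⟩)
  have hend : HasSlope g p (conjPair ι (φ t) p - conjPair ι p p) := by
    rw [conjPair_self_of_nonreal ι hpF, conjPair_apply_of_ne ι hpt.symm
      (fun h' ↦ hpt' (by rw [h', ι.conj_conj]))]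
    -- The slope is 1 towards infinity, hence -1 in the only direction emanating from `p`.
    refine Or.inr ⟨hp, t, φ, -t, 1, h.mono ht.le, fun s hs ↦ ?_, by norm_num⟩
    rw [hg s (le_of_lt hs)]; push_cast; ring
  have hbase : HasSlope g (φ t) (conjPair ι (φ t) (φ t) - conjPair ι p (φ t)) := by
    rw [conjPair_self_of_nonreal ι hptF, conjPair_apply_of_ne ι hpt hpt',
      show (1 : ℤ) - 0 = 1 + 0 by norm_num]
    have h0 : 0 < (t - R) / 2 := by linarith
    refine hasSlope_two_sided (c := 0) h0 (fun u hu v hv ↦ h.endChart.edist_eq u ?_ v ?_)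
      (hopen t _ h0 (by linarith)) (hball t ht) ?_ ?_
    · exact show R < u by linarith [hu.1]
    · exact show R < v by linarith [hv.1]
    · intro u hu
      rw [hg _ (by linarith [hu.1])]; push_cast; ring
    · intro u hu
      rw [hg' _ (by linarith [hu.2]) (by linarith [hu.1])]; push_cast; ring
  have hconj : ∀ x, HasSlope g x (conjPair ι (φ t) x - conjPair ι p x) →
      HasSlope g (ι.conj x) (conjPair ι (φ t) (ι.conj x) - conjPair ι p (ι.conj x)) := by
    intro x hx
    rw [conjPair_conj_apply, conjPair_conj_apply]
    exact hx.conj ι hgconj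
  have hgood : ∀ x ∈ J ∪ {p, φ t}, HasSlope g x (conjPair ι (φ t) x - conjPair ι p x) := by
    rintro x (hx | rfl | rfl)
    exacts [hint x hx, hend, hbase]
  refine ⟨g, fun x ↦ ?_⟩
  by_cases hx : x ∈ J ∪ {p, φ t}
  · exact hgood x hx
  by_cases hx' : ι.conj x ∈ J ∪ {p, φ t}
  · have := hconj _ (hgood _ hx')
    rwa [ι.conj_conj] at this
  have hcl : IsClosed (J ∪ {p, φ t}) := by
    have h3 := isClosed_edge_union hT (h.isArc_compactRay hT ht)
    rw [image_compactRay, compactRay, if_pos le_rfl, compactRay, if_neg (by norm_num)] at h3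
    simpa using h3
  rw [conjPair_apply_of_ne, conjPair_apply_of_ne, sub_zero]
  · refine hT.hasSlope_zero (c := 0) ?_
    filter_upwards [hcl.isOpen_compl.mem_nhds hx,
      (hcl.preimage ι.continuous_conj).isOpen_compl.mem_nhds hx'] with y hy hy'
    exact edgeFun_of_notMem (fun h ↦ hy (Or.inl h)) (fun h ↦ hy' (Or.inl h)) (by simp)
  · rintro rfl; exact hx (by simp)
  · rintro rfl; exact hx' (by simp [ι.conj_conj])
  · rintro rfl; exact hx (by simp)
  · rintro rfl; exact hx' (by simp [ι.conj_conj])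

end Moves

/-! ### Moves at the centre of a star, and the global conclusion -/

section StarMoves

variable {T : Type*} [TopologicalSpace T] [EDist T] {ι : RealStructure T}

/-- A conjugate pair at the centre of a star can be moved along its legs, provided that the moved
segment and its conjugate separate the curve. -/
theorem IsStarChart.slopeEquiv_of_separation (hT : IsCurve T) {p : T} {n : ℕ} {r t ρ : ℝ}
    {φ : Fin n → ℝ → T}
    (h : IsStarChart p n r φ) (hp : BallNhds p) {k : Fin n} (ht : 0 < t) (htρ : t < ρ)
    (hρ : ρ ≤ r) (harc : ∀ u, 0 < u → u < ρ → IsArc (φ k) 0 u)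
    (hd : Disjoint (ι.conj '' (φ k '' Ioo 0 ρ)) (φ k '' Ioo 0 ρ)) {A₀ A₁ : Set T}
    (hA₀ : IsClosed A₀) (hA₁ : IsClosed A₁) (hdA : Disjoint A₀ A₁)
    (hun : A₀ ∪ A₁ = (φ k '' Ioo 0 t ∪ ι.conj '' (φ k '' Ioo 0 t))ᶜ)
    (hinv₀ : ∀ z ∈ A₀, ι.conj z ∈ A₀) (hinv₁ : ∀ z ∈ A₁, ι.conj z ∈ A₁) (hpA : p ∈ A₀)
    (hqA : φ k t ∈ A₁) : SlopeEquiv (conjPair ι (φ k t)) (conjPair ι p) := by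
  set J := φ k '' Ioo 0 t with hJ
  set q := φ k t with hq
  have hI : ∀ s ∈ Ioo 0 ρ, s ∈ Ico 0 r := fun s hs ↦ ⟨hs.1.le, hs.2.trans_le hρ⟩
  have htI : t ∈ Ioo 0 ρ := ⟨ht, htρ⟩
  have hsub : J ⊆ φ k '' Ioo 0 ρ := image_mono (Ioo_subset_Ioo_right htρ.le)
  have hdJ : Disjoint (ι.conj '' J) J := hd.mono (image_mono hsub) hsub
  -- `g` is 0 on the side of `p`, rises with slope 1 along the segment, and is `t` on the side of
  -- `q`.
  set g := edgeFun ι J A₁ p t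
  have hgconj : ∀ x, g (ι.conj x) = g x := edgeFun_conj hdJ hinv₁
  have hnotJ : ∀ x ∈ A₀ ∪ A₁, x ∉ J ∧ ι.conj x ∉ J := by
    intro x hx
    rw [hun] at hx
    exact ⟨fun h ↦ hx (Or.inl h), fun h ↦ hx (Or.inr ⟨_, h, ι.conj_conj x⟩)⟩
  have hcases : ∀ x, x ∉ J → ι.conj x ∉ J → x ∈ A₀ ∪ A₁ := by
    intro x hx hx'
    rw [hun]
    rintro (h | ⟨y, h, rfl⟩)
    · exact hx h
    · exact hx' (by rwa [ι.conj_conj])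
  have hgJ : ∀ s ∈ Ioo 0 t, g (φ k s) = s := by
    intro s hs
    have hsJ : φ k s ∈ J := mem_image_of_mem _ hs
    refine (edgeFun_of_mem hsJ).trans ?_
    rw [h.edist_center k
      (hI s ⟨hs.1, hs.2.trans htρ⟩), ENNReal.toReal_ofReal hs.1.le]
  have hg₀ : ∀ x ∈ A₀, g x = 0 := fun x hx ↦
    edgeFun_of_notMem (hnotJ x (Or.inl hx)).1 (hnotJ x (Or.inl hx)).2 (disjoint_left.1 hdA hx)
  have hg₁ : ∀ x ∈ A₁, g x = t := fun x hx ↦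
    edgeFun_of_mem_right (hnotJ x (Or.inr hx)).1 (hnotJ x (Or.inr hx)).2 hx
  have hne : ∀ x ∈ A₀, ∀ y ∈ A₁, x ≠ y := fun x hx y hy hxy ↦
    disjoint_left.1 hdA hx (hxy ▸ hy)
  have hqL : q ∈ φ k '' Ioo 0 ρ := mem_image_of_mem _ htI
  have hconjL : ∀ x ∈ φ k '' Ioo 0 ρ, ι.conj x ∉ φ k '' Ioo 0 ρ := fun x hx hx' ↦
    disjoint_left.1 hd (mem_image_of_mem _ hx) hx'
  have hqF : q ∉ ι.realLocus := disjoint_left.1 (disjoint_realLocus hd) hqL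
  have hpq : p ≠ q := hne p hpA q hqA
  have hpq' : p ≠ ι.conj q := hne p hpA _ (hinv₁ q hqA)
  have hqp' : q ≠ ι.conj p := (hne _ (hinv₀ p hpA) q hqA).symm
  have hiso : ∀ s ∈ Ioo 0 ρ, ∀ u ∈ Ioo 0 ρ,
      edist (φ k s) (φ k u) = ENNReal.ofReal |s - u| :=
    fun s hs u hu ↦ h.edist_same k s (hI s hs) u (hI u hu)
  have hopen : ∀ s ε, 0 < ε → 0 ≤ s - ε → s + ε < ρ → IsOpen (φ k '' Ioo (s - ε) (s + ε)) := by
    intro s ε hε hs hs'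
    have := hT.t2
    exact ((harc (s + ε) (by linarith) hs').mono hs (by linarith) le_rfl).isOpen
  have hball : ∀ s ∈ Ioo 0 ρ, BallNhds (φ k s) := fun s hs ↦ hT.ballNhds_leg h hp k (hI s hs)
  have hcl : IsClosed (J ∪ {p, q}) := by
    have := isClosed_edge_union hT (harc t ht htρ)
    rwa [h.center] at this
  have hcl' : IsClosed (ι.conj ⁻¹' (J ∪ {p, q})) := hcl.preimage ι.continuous_conj
  have hint : ∀ x ∈ J, HasSlope g x (conjPair ι p x - conjPair ι q x) := by
    rintro _ ⟨s, hs, rfl⟩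
    have hsρ : s ∈ Ioo 0 ρ := ⟨hs.1, hs.2.trans htρ⟩
    have hsJ : φ k s ∈ J := mem_image_of_mem _ hs
    have hne' : ∀ x ∈ A₀ ∪ A₁, φ k s ≠ x := fun x hx h' ↦ (hnotJ x hx).1 (h' ▸ hsJ)
    rw [conjPair_apply_of_ne ι (hne' p (Or.inl hpA)) (hne' _ (Or.inl (hinv₀ p hpA))),
      conjPair_apply_of_ne ι (hne' q (Or.inr hqA)) (hne' _ (Or.inr (hinv₁ q hqA))), sub_zero,
      show (0 : ℤ) = 1 + -1 by norm_num]
    have hε : 0 < min s (t - s) := lt_min hs.1 (sub_pos.2 hs.2)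
    have h1 := min_le_left s (t - s)
    have h2 := min_le_right s (t - s)
    have hin : ∀ u ∈ Ioo (s - min s (t - s)) (s + min s (t - s)), u ∈ Ioo 0 t := fun u hu ↦
      ⟨by linarith [hu.1], by linarith [hu.2]⟩
    refine hasSlope_two_sided (c := s) hε (fun u hu v hv ↦ hiso u ?_ v ?_)
        (hopen s _ hε (by linarith) (by linarith)) (hball s hsρ) ?_ ?_
    · exact ⟨(hin u hu).1, (hin u hu).2.trans htρ⟩
    · exact ⟨(hin v hv).1, (hin v hv).2.trans htρ⟩
    · intro u hu
      rw [hgJ _ (hin _ ⟨by linarith [hu.1], by linarith [hu.2]⟩)]; push_cast; ring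
    · intro u hu
      rw [hgJ _ (hin _ ⟨by linarith [hu.2], by linarith [hu.1]⟩)]; push_cast; ring
  have htip : HasSlope g q (conjPair ι p q - conjPair ι q q) := by
    rw [conjPair_self_of_nonreal ι hqF, conjPair_apply_of_ne ι hpq.symm hqp',
      show (0 : ℤ) - 1 = 0 + -1 by norm_num]
    have hqcl : q ∉ ι.conj ⁻¹' (J ∪ {p, q}) := by
      rintro (h' | h' | h')
      · exact hconjL q hqL (hsub h')
      · exact hqp' (by rw [← h', ι.conj_conj])
      · exact hqF h'
    obtain ⟨ε, hε, hεN⟩ := (hball t htI _).1 (inter_mem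
      (hA₀.isOpen_compl.mem_nhds fun h' ↦ hne q h' q hqA rfl) (hcl'.isOpen_compl.mem_nhds hqcl))
    set δ := min ε (min t (ρ - t)) / 2 with hδ
    have hm : 0 < min ε (min t (ρ - t)) := lt_min hε (lt_min ht (sub_pos.2 htρ))
    have hδ0 : 0 < δ := by linarith
    have h1 : min ε (min t (ρ - t)) ≤ ε := min_le_left _ _
    have h2 : min ε (min t (ρ - t)) ≤ t := (min_le_right _ _).trans (min_le_left _ _)
    have h3 : min ε (min t (ρ - t)) ≤ ρ - t := (min_le_right _ _).trans (min_le_right _ _)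
    have hin : ∀ u ∈ Ioo (t - δ) (t + δ), u ∈ Ioo 0 ρ := fun u hu ↦
      ⟨by linarith [hu.1], by linarith [hu.2]⟩
    -- Points just beyond `q` are off the segment, its conjugate and `A₀`, so they belong to `A₁`,
    -- where `g` is constant. Only the slope -1 back towards `p` counts at `q`.
    have hout : ∀ u ∈ Ico 0 δ, g (φ k (t + u)) = t := by
      intro u hu
      have hu' : t + u ∈ Ioo 0 ρ := hin _ ⟨by linarith [hu.1], by linarith [hu.2]⟩
      obtain ⟨h4, h5⟩ := hεN (φ k (t + u)) (by
        rw [hiso t htI _ hu', ENNReal.ofReal_lt_ofReal_iff hε, abs_sub_comm, add_sub_cancel_left,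
          abs_of_nonneg hu.1]
        linarith [hu.2])
      refine hg₁ _ ((hcases _ ?_ fun h' ↦ h5 (Or.inl h')).resolve_left h4)
      rintro ⟨v, hv, hvu⟩
      have := (hT.eq_index h (hI v ⟨hv.1, hv.2.trans htρ⟩) (hI _ hu') hv.1 hvu).2
      linarith [hv.2, hu.1]
    refine hasSlope_two_sided (c := t) hδ0 (fun u hu v hv ↦ hiso u (hin u hu) v (hin v hv))
      (hopen t _ hδ0 (by linarith) (by linarith)) (hball t htI) ?_ ?_
    · intro u hu
      rw [hout u hu]; push_cast; ring
    · intro u hu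
      rcases hu.1.eq_or_lt with rfl | hu0
      · rw [sub_zero, ← hq, hg₁ q hqA]; ring
      · rw [hgJ _ ⟨by linarith [hu.2], by linarith⟩]; push_cast; ring
  have hcenter : HasSlope g p (conjPair ι p p - conjPair ι q p) := by
    rw [conjPair_apply_of_ne ι hpq hpq', sub_zero]
    obtain ⟨ε, hε, hεN⟩ := (hp _).1 (hA₁.isOpen_compl.mem_nhds fun h' ↦ hne p hpA p h' rfl)
    -- Legs at `p` that avoid the segment and its conjugate start inside `A₀`, where `g` vanishes.
    have hleg : ∀ l, ∀ u ∈ Ico 0 r, u < ε → φ l u ∉ J → ι.conj (φ l u) ∉ J → g (φ l u) = 0 := by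
      intro l u hu huε hJ hJ'
      refine hg₀ _ ((hcases _ hJ hJ').resolve_right (hεN _ ?_))
      rw [h.edist_center l hu]
      exact (ENNReal.ofReal_lt_ofReal_iff hε).2 huε
    have hmemJ : ∀ l, l ≠ k → ∀ u ∈ Ico 0 r, φ l u ∉ J := by
      rintro l hl u hu ⟨v, hv, hvu⟩
      exact hl (hT.eq_index h (hI v ⟨hv.1, hv.2.trans htρ⟩) hu hv.1 hvu).1.symm
    have hgk : ∀ u ∈ Ico 0 t, g (φ k u) = u := by
      intro u hu
      rcases hu.1.eq_or_lt with rfl | hu0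
      · rw [h.center, hg₀ p hpA]
      · exact hgJ u ⟨hu0, hu.2⟩
    by_cases hpF : p ∈ ι.realLocus
    · rw [conjPair_self_of_real ι hpF]
      have h2 := h.conj ι
      rw [show ι.conj p = p from hpF] at h2
      obtain ⟨ρ₂, h20, h2r, -, e, he⟩ := h2.exists_equiv hT h hp
      have hee : ∀ l, e (e l) = l := by
        intro l
        have hh : ρ₂ / 2 ∈ Ico 0 ρ₂ := ⟨by linarith, by linarith⟩
        have hhr : ρ₂ / 2 ∈ Ico 0 r := ⟨by linarith, by linarith⟩
        have h3 := he (e l) _ hh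
        rw [← he l _ hh, ι.conj_conj] at h3
        exact (hT.eq_index h hhr hhr (by linarith) h3).1.symm
      -- At a real centre the conjugate of leg `k` is a different leg, since leg `k` is nonreal.
      -- Both have slope 1, which gives the coefficient 2 of `p + ι p = 2 p`.
      have hek : e k ≠ k := by
        intro h3
        have h4 : 0 < min ρ₂ ρ / 2 := by linarith [lt_min h20 (ht.trans htρ)]
        have h5 : min ρ₂ ρ / 2 < ρ₂ := by linarith [min_le_left ρ₂ ρ]
        have h6 : min ρ₂ ρ / 2 < ρ := by linarith [min_le_right ρ₂ ρ]
        have h7 := he k _ ⟨h4.le, h5⟩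
        rw [h3] at h7
        have h8 : φ k (min ρ₂ ρ / 2) ∈ φ k '' Ioo 0 ρ := mem_image_of_mem _ ⟨h4, h6⟩
        exact hconjL _ h8 (by rwa [h7])
      set δ := min ρ₂ (min ε t) with hδ
      have hδ0 : 0 < δ := lt_min h20 (lt_min hε ht)
      have h1 : δ ≤ ρ₂ := min_le_left _ _
      have h2 : δ ≤ ε := (min_le_right _ _).trans (min_le_left _ _)
      have h3 : δ ≤ t := (min_le_right _ _).trans (min_le_right _ _)
      refine Or.inl ⟨hp, n, δ, φ, 0, fun l ↦ (if l = k then 1 else 0) + if l = e k then 1 else 0,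
        h.shrink hp hδ0 (h1.trans h2r), ?_, ?_⟩
      · intro l u hu
        have huρ₂ : u ∈ Ico 0 ρ₂ := ⟨hu.1, hu.2.trans_le h1⟩
        have hur : u ∈ Ico 0 r := ⟨hu.1, hu.2.trans_le (h1.trans h2r)⟩
        have hut : u ∈ Ico 0 t := ⟨hu.1, hu.2.trans_le h3⟩
        beta_reduce
        by_cases hlk : l = k
        · subst hlk
          rw [hgk u hut, if_pos rfl, if_neg hek.symm]; simp
        by_cases hle : l = e k
        · subst hle
          rw [← he k u huρ₂, hgconj, hgk u hut, if_neg hek, if_pos rfl]; simp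
        · rw [if_neg hlk, if_neg hle, hleg l u hur (hu.2.trans_le h2) (hmemJ l hlk u hur)]
          · simp
          · rw [he l u huρ₂]
            exact hmemJ _ (fun h4 ↦ hle (by rw [← h4, hee])) u hur
      · rw [Finset.sum_add_distrib]; simp
    · rw [conjPair_self_of_nonreal ι hpF]
      have hpcl : p ∉ ι.conj ⁻¹' (J ∪ {p, q}) := by
        rintro (h' | h' | h')
        · exact (hnotJ p (Or.inl hpA)).2 h'
        · exact hpF h'
        · exact hpq' (by rw [← h', ι.conj_conj])
      obtain ⟨ε', hε', hεN'⟩ := (hp _).1 (hcl'.isOpen_compl.mem_nhds hpcl)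
      set δ := min ε' (min ε t) with hδ
      have hδ0 : 0 < δ := lt_min hε' (lt_min hε ht)
      have h1 : δ ≤ ε' := min_le_left _ _
      have h2 : δ ≤ ε := (min_le_right _ _).trans (min_le_left _ _)
      have h3 : δ ≤ t := (min_le_right _ _).trans (min_le_right _ _)
      refine Or.inl ⟨hp, n, δ, φ, 0, fun l ↦ if l = k then 1 else 0,
        h.shrink hp hδ0 (h3.trans (htρ.le.trans hρ)), ?_, by simp⟩
      intro l u hu
      have hur : u ∈ Ico 0 r := ⟨hu.1, hu.2.trans_le (h3.trans (htρ.le.trans hρ))⟩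
      beta_reduce
      by_cases hlk : l = k
      · subst hlk
        rw [hgk u ⟨hu.1, hu.2.trans_le h3⟩, if_pos rfl]; simp
      · rw [if_neg hlk, hleg l u hur (hu.2.trans_le h2) (hmemJ l hlk u hur)]
        · simp
        · refine fun h4 ↦ hεN' (φ l u) ?_ (Or.inl h4)
          rw [h.edist_center l hur]
          exact (ENNReal.ofReal_lt_ofReal_iff hε').2 (hu.2.trans_le h1)
  have hconj : ∀ x, HasSlope g x (conjPair ι p x - conjPair ι q x) →
      HasSlope g (ι.conj x) (conjPair ι p (ι.conj x) - conjPair ι q (ι.conj x)) := by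
    intro x hx
    rw [conjPair_conj_apply, conjPair_conj_apply]
    exact hx.conj ι hgconj
  have hgood : ∀ x ∈ J ∪ {p, q}, HasSlope g x (conjPair ι p x - conjPair ι q x) := by
    rintro x (hx | rfl | rfl)
    exacts [hint x hx, hcenter, htip]
  refine ⟨g, fun x ↦ ?_⟩
  by_cases hx : x ∈ J ∪ {p, q}
  · exact hgood x hx
  by_cases hx' : ι.conj x ∈ J ∪ {p, q}
  · have := hconj _ (hgood _ hx')
    rwa [ι.conj_conj] at this
  have hev : ∀ᶠ y in 𝓝 x, y ∈ A₀ ∪ A₁ := by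
    filter_upwards [hcl.isOpen_compl.mem_nhds hx, hcl'.isOpen_compl.mem_nhds hx'] with y hy hy'
    exact hcases y (fun h ↦ hy (Or.inl h)) fun h ↦ hy' (Or.inl h)
  rw [conjPair_apply_of_ne, conjPair_apply_of_ne, sub_zero]
  · rcases hev.self_of_nhds with hxA | hxA
    · refine hT.hasSlope_zero (c := 0) ?_
      filter_upwards [hev, hA₁.isOpen_compl.mem_nhds fun h' ↦ hne x hxA x h' rfl] with y hy hy'
      exact hg₀ y (hy.resolve_right hy')
    · refine hT.hasSlope_zero (c := t) ?_
      filter_upwards [hev, hA₀.isOpen_compl.mem_nhds fun h' ↦ hne x h' x hxA rfl] with y hy hy'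
      exact hg₁ y (hy.resolve_left hy')
  · rintro rfl; exact hx (by simp)
  · rintro rfl; exact hx' (by simp [ι.conj_conj])
  · rintro rfl; exact hx (by simp)
  · rintro rfl; exact hx' (by simp [ι.conj_conj])

/-- On an M-curve, conjugate pairs can be moved locally. -/
theorem IsCurve.exists_nhds_slopeEquiv (hT : IsCurve T) (hM : ι.IsM) (p : T) :
    ∃ N ∈ 𝓝 p, ∀ q ∈ N, q ∈ ι.realLocus ∨ SlopeEquiv (conjPair ι q) (conjPair ι p) := by
  have := hT.t2
  rcases hT.chart p with ⟨hp, n, r, φ, h⟩ | ⟨hp, R, φ, h⟩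
  · obtain ⟨ρ, hρ0, hρr, hρ⟩ := h.exists_homogeneous (ι := ι) hT hp
    obtain ⟨V₀, hV₀, hV₀'⟩ := hT.exists_isAdapted ι
    have hWfin : (V₀ ∪ ι.conj '' V₀ ∪ {p, ι.conj p}).Finite :=
      (hV₀.union (hV₀.image _)).union (toFinite _)
    set W := V₀ ∪ ι.conj '' V₀ ∪ {p, ι.conj p} with hW
    have hWinv : ∀ v ∈ W, ι.conj v ∈ W := by
      rintro _ ((hv | ⟨v, hv, rfl⟩) | rfl | rfl)
      · exact Or.inl (Or.inr ⟨_, hv, rfl⟩)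
      · rw [ι.conj_conj]; exact Or.inl (Or.inl hv)
      · exact Or.inr (Or.inr rfl)
      · rw [ι.conj_conj]; exact Or.inr (Or.inl rfl)
    have hpW : p ∈ W := Or.inr (Or.inl rfl)
    -- A ball around `p` without other vertices of `W`: once the moved point and its conjugate are
    -- added as vertices, the segment from `p` is a single edge.
    obtain ⟨ε, hε, hεW⟩ := (hp _).1 ((hWfin.sdiff (t := {p})).isClosed.isOpen_compl.mem_nhds
      (fun h' ↦ h'.2 rfl))
    have hτ : 0 < min ρ ε := lt_min hρ0 hε
    refine ⟨_, (h.shrink hp hτ ((min_le_left _ _).trans hρr)).mem_nhds, ?_⟩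
    rintro _ ⟨k, t, ht, rfl⟩
    rcases ht.1.eq_or_lt with rfl | ht0
    · right; rw [h.center]; exact SlopeEquiv.refl hT _
    by_cases hqF : φ k t ∈ ι.realLocus
    · exact Or.inl hqF
    right
    have htρ : t < ρ := ht.2.trans_le (min_le_left _ _)
    have hI : ∀ s ∈ Ioo 0 ρ, s ∈ Ico 0 r := fun s hs ↦ ⟨hs.1.le, hs.2.trans_le hρr⟩
    have hqL : φ k t ∈ φ k '' Ioo 0 ρ := mem_image_of_mem _ ⟨ht0, htρ⟩
    have hd := (hρ k).2.resolve_left fun h' ↦ hqF (h' hqL)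
    have hsub : φ k '' Ioo 0 t ⊆ φ k '' Ioo 0 ρ := image_mono (Ioo_subset_Ioo_right htρ.le)
    have hVfin : (W ∪ {φ k t, ι.conj (φ k t)}).Finite := hWfin.union (toFinite _)
    set V := W ∪ {φ k t, ι.conj (φ k t)} with hV
    have hVinv : ∀ v ∈ V, ι.conj v ∈ V := by
      rintro _ (hv | rfl | rfl)
      · exact Or.inl (hWinv _ hv)
      · exact Or.inr (Or.inr rfl)
      · rw [ι.conj_conj]; exact Or.inr (Or.inl rfl)
    have hVad := hV₀' V hVfin hVinv fun v hv ↦ Or.inl (Or.inl (Or.inl hv))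
    have harc := (hρ k).1 t ht0 htρ
    have hdV : Disjoint (φ k '' Ioo 0 t) V := by
      rw [disjoint_left]
      rintro _ ⟨s, hs, rfl⟩ (hv | hv | hv)
      · have hsρ : s ∈ Ioo 0 ρ := ⟨hs.1, hs.2.trans htρ⟩
        refine hεW (φ k s) ?_ ⟨hv, fun h' ↦ ?_⟩
        · rw [h.edist_center k (hI s hsρ)]
          exact (ENNReal.ofReal_lt_ofReal_iff hε).2 (hs.2.trans (ht.2.trans_le (min_le_right _ _)))
        · rw [mem_singleton_iff, ← h.center k] at h'
          have := (hT.eq_index h (hI s hsρ) ⟨le_rfl, h.radius_pos⟩ hs.1 h').2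
          exact hs.1.ne' this
      · have := (hT.eq_index h (hI s ⟨hs.1, hs.2.trans htρ⟩) (hI t ⟨ht0, htρ⟩) hs.1 hv).2
        exact hs.2.ne this
      · exact disjoint_left.1 hd (mem_image_of_mem _ hqL)
          (hv ▸ mem_image_of_mem _ ⟨hs.1, hs.2.trans htρ⟩)
    obtain ⟨A₀, A₁, h1, h2, h3, h4, h5, h6, h7, h8⟩ := hVad.exists_separation hT hM harc
      (by rw [h.center]; exact Or.inl hpW) (Or.inr (Or.inl rfl)) hdV
      (hd.mono (image_mono hsub) hsub)
    rw [h.center] at h7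
    exact h.slopeEquiv_of_separation hT hp ht0 htρ hρr (hρ k).1 hd h1 h2 h3 h4 h5 h6 h7 h8
  · obtain ⟨S, hS, h1, h2⟩ := h.exists_homogeneous (ι := ι) hT
    refine ⟨_, (h.chart S hS).mem_nhds, ?_⟩
    rintro q (rfl | ⟨t, ht, rfl⟩)
    · right; exact SlopeEquiv.refl hT _
    by_cases hqF : φ t ∈ ι.realLocus
    · exact Or.inl hqF
    have hqL : φ t ∈ φ '' Ioi S := mem_image_of_mem _ ht
    -- The end `p` is nonreal, for otherwise the whole tail would be real.
    exact Or.inr ((h.mono hS).slopeEquiv hT hp (fun hpF ↦ hqF (h2 hpF hqL)) ht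
      (h1.resolve_left fun h' ↦ hqF (h' hqL))).symm

/-- On an M-curve, each conjugate pair is equivalent to twice a real point. -/
theorem IsCurve.exists_real_slopeEquiv (hT : IsCurve T) (hM : ι.IsM) (p : T) :
    ∃ q ∈ ι.realLocus, SlopeEquiv (conjPair ι p) (conjPair ι q) := by
  have := hT.connected
  choose N hN h using hT.exists_nhds_slopeEquiv (ι := ι) hM
  set W := {p : T | ∃ q ∈ ι.realLocus, SlopeEquiv (conjPair ι p) (conjPair ι q)} with hW
  have hFW : ι.realLocus ⊆ W := fun q hq ↦ ⟨q, hq, SlopeEquiv.refl hT _⟩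
  have hopen : IsOpen W := by
    rw [isOpen_iff_mem_nhds]
    rintro p ⟨q, hq, hpq⟩
    filter_upwards [hN p] with x hx
    rcases h p x hx with hx | hx
    · exact hFW hx
    · exact ⟨q, hq, hx.trans hT hpq⟩
  -- Near a point outside `W`, all points are nonreal and have pairs equivalent to that of `p`, so
  -- they are outside `W` too.
  have hclosed : IsClosed W := by
    rw [← isOpen_compl_iff, isOpen_iff_mem_nhds]
    intro p hp
    filter_upwards [hN p, hT.isClosed_realLocus.isOpen_compl.mem_nhds fun h' ↦ hp (hFW h')]
      with x hx hxF
    rintro ⟨q, hq, hxq⟩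
    exact hp ⟨q, hq, ((h p x hx).resolve_left hxF).symm.trans hT hxq⟩
  have huniv := IsClopen.eq_univ ⟨hclosed, hopen⟩ ((hT.exists_real hM).mono hFW)
  have hpW : p ∈ W := huniv ▸ mem_univ p
  exact hpW

/-- On an M-curve, real effective divisors are equivalent to totally real effective ones. -/
theorem IsCurve.exists_totallyReal (hT : IsCurve T) (hM : ι.IsM) (D : T →₀ ℤ)
    (hD : ι.IsRealDivisor D) (hD' : IsEffective D) :
    ∃ D' : T →₀ ℤ, ι.IsTotallyReal D' ∧ IsEffective D' ∧ SlopeEquiv D D' := by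
  classical
  induction hn : (D.support.filter (· ∉ ι.realLocus)).card using Nat.strong_induction_on
    generalizing D with
  | _ n ih =>
  by_cases hsupp : (D.support : Set T) ⊆ ι.realLocus
  · exact ⟨D, ⟨hD, hsupp⟩, hD', SlopeEquiv.refl hT D⟩
  obtain ⟨x, hx, hxF⟩ := not_subset.1 hsupp
  obtain ⟨m, hm⟩ := Int.eq_ofNat_of_zero_le (hD' x)
  -- As `D` is real, it has the same coefficient `m` at `x` and `ι x`. Subtraction removes both
  -- points from the support and keeps the divisor effective.
  set D₁ := D - m • conjPair ι x with hD₁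
  have happ : ∀ y, D₁ y = D y - m * conjPair ι x y := by
    intro y
    rw [hD₁, Finsupp.sub_apply, Finsupp.smul_apply, nsmul_eq_mul]
  have hx₁ : D₁ x = 0 := by rw [happ, conjPair_self_of_nonreal ι hxF, hm]; ring
  have hreal : ι.IsRealDivisor D₁ := fun y ↦ by rw [happ, happ, hD y, conjPair_conj_apply]
  have hx₁' : D₁ (ι.conj x) = 0 := by rw [hreal, hx₁]
  have hother : ∀ y, y ≠ x → y ≠ ι.conj x → D₁ y = D y := fun y hy hy' ↦ by
    rw [happ, conjPair_apply_of_ne ι hy hy', mul_zero, sub_zero]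
  have heff : IsEffective D₁ := by
    intro y
    by_cases hy : y = x
    · rw [hy, hx₁]
    by_cases hy' : y = ι.conj x
    · rw [hy', hx₁']
    · rw [hother y hy hy']; exact hD' y
  have hlt : (D₁.support.filter (· ∉ ι.realLocus)).card < n := by
    rw [← hn]
    refine Finset.card_lt_card ⟨fun y hy ↦ ?_, fun hsub ↦ ?_⟩
    · rw [Finset.mem_filter, Finsupp.mem_support_iff] at hy ⊢
      refine ⟨?_, hy.2⟩
      rw [← hother y]
      · exact hy.1
      · rintro rfl; exact hy.1 hx₁
      · rintro rfl; exact hy.1 hx₁'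
    · have := hsub (Finset.mem_filter.2 ⟨hx, hxF⟩)
      rw [Finset.mem_filter, Finsupp.mem_support_iff] at this
      exact this.1 hx₁
  obtain ⟨D₂, ⟨h1, h2⟩, h3, h4⟩ := ih _ hlt D₁ hreal heff rfl
  obtain ⟨q, hq, hxq⟩ := hT.exists_real_slopeEquiv hM x
  have hqapp : ∀ y, (D₂ + m • conjPair ι q) y = D₂ y + m * conjPair ι q y := fun y ↦ by
    rw [Finsupp.add_apply, Finsupp.smul_apply, nsmul_eq_mul]
  have hqc : ι.conj q = q := hq
  refine ⟨D₂ + m • conjPair ι q, ⟨fun y ↦ ?_, fun y hy ↦ ?_⟩, fun y ↦ ?_, ?_⟩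
  · rw [hqapp, hqapp, h1 y, conjPair_conj_apply]
  · by_contra hyF
    rw [Finset.mem_coe, Finsupp.mem_support_iff, hqapp] at hy
    have h5 : D₂ y = 0 := by
      by_contra h5
      exact hyF (h2 (Finset.mem_coe.2 (Finsupp.mem_support_iff.2 h5)))
    have h6 : y ≠ q := by rintro rfl; exact hyF hq
    rw [h5, conjPair_apply_of_ne ι h6 (by rwa [hqc])] at hy
    simp at hy
  · rw [hqapp]
    have h5 : 0 ≤ conjPair ι q y := by
      by_cases h6 : y = q
      · rw [h6, conjPair_self_of_real ι hq]; norm_num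
      · rw [conjPair_apply_of_ne ι h6 (by rwa [hqc])]
    have := h3 y
    positivity
  · have h5 := h4.add hT (hxq.nsmul hT m)
    rwa [hD₁, sub_add_cancel] at h5

end StarMoves

/-! ### From real-valued functions to rational functions -/

section Extension

variable {T : Type*} [TopologicalSpace T] [EDist T]

/-- The ray tends to `p` at infinite distance from it. So `BallNhds` tells finite points from points
at infinity. -/
theorem IsCurve.not_ballNhds (hT : IsCurve T) {p : T} (hp : ∀ x ≠ p, edist x p = ⊤) {R : ℝ}
    {φ : ℝ → T} (h : IsRay p R φ) : ¬BallNhds p := by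
  intro hb
  obtain ⟨t, ht, htR⟩ := ((h.endChart.tendsto.eventually (hb.ball_mem one_pos)).and
    (eventually_gt_atTop R)).exists
  have ht' : edist p (φ t) < ENNReal.ofReal 1 := ht
  rw [hT.edist_comm, hp _ (hT.ray_ne h htR)] at ht'
  exact not_top_lt ht'

theorem exists_tendsto_affine (c : ℝ) (σ : ℤ) :
    ∃ v : EReal, Tendsto (fun t : ℝ ↦ ((c + σ * t : ℝ) : EReal)) atTop (𝓝 v) := by
  rcases lt_trichotomy σ 0 with h | rfl | h
  · refine ⟨⊥, EReal.tendsto_coe_atBot.comp (tendsto_atBot_add_const_left _ _ ?_)⟩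
    exact tendsto_id.const_mul_atTop_of_neg (by exact_mod_cast h)
  · exact ⟨(c : EReal), by simp⟩
  · refine ⟨⊤, EReal.tendsto_coe_atTop.comp (tendsto_atTop_add_const_left _ _ ?_)⟩
    exact tendsto_id.const_mul_atTop (by exact_mod_cast h)

/-- A real-valued function with slopes extends to a rational function. -/
theorem SlopeEquiv.linEquiv (hT : IsCurve T) {D D' : T →₀ ℤ} (h : SlopeEquiv D D') :
    LinEquiv D D' := by
  obtain ⟨g, hg⟩ := h
  -- The extension keeps the value of `g` at finite points; at infinity it takes the limit of the
  -- affine function along the ray.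
  have key : ∀ p, ∃ v : EReal, (BallNhds p → v = g p) ∧ (¬BallNhds p → ∃ (R : ℝ) (φ : ℝ → T)
      (c : ℝ) (σ : ℤ), IsRay p R φ ∧ (∀ t ∈ Ioi R, g (φ t) = c + σ * t) ∧ D' p - D p = -σ ∧
      Tendsto (fun t : ℝ ↦ ((c + σ * t : ℝ) : EReal)) atTop (𝓝 v)) := by
    intro p
    rcases hg p with ⟨hp, -⟩ | ⟨hp, R, φ, c, σ, hφ, h1, h2⟩
    · exact ⟨g p, fun _ ↦ rfl, fun h ↦ absurd hp h⟩
    · obtain ⟨v, hv⟩ := exists_tendsto_affine c σ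
      exact ⟨v, fun h ↦ absurd h (hT.not_ballNhds hp hφ), fun _ ↦ ⟨R, φ, c, σ, hφ, h1, h2, hv⟩⟩
  choose f hf hf' using key
  have hord : ∀ p, HasOrder f p (D' p - D p) := by
    intro p
    by_cases hp : BallNhds p
    · rcases hg p with ⟨-, n, r, φ, c, σ, hφ, h1, h2⟩ | ⟨hp', R, φ, c, σ, hφ, h1, h2⟩
      · refine Or.inl ⟨n, r, φ, c, σ, hφ, fun k t ht ↦ ?_, h2⟩
        rw [hf _ (hT.ballNhds_leg hφ hp k ht), h1 k t ht]
      · exact absurd hp (hT.not_ballNhds hp' hφ)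
    · obtain ⟨R, φ, c, σ, hφ, h1, h2, -⟩ := hf' p hp
      refine Or.inr ⟨R, φ, c, σ, hφ.endChart, fun t ht ↦ ?_, h2⟩
      rw [hf _ (hT.ballNhds_ray hφ ht), h1 t ht]
  refine ⟨f, ⟨continuous_iff_continuousAt.2 fun p ↦ ?_, fun p ↦ ⟨_, hord p⟩⟩, hord⟩
  by_cases hp : BallNhds p
  · rcases hg p with ⟨-, n, r, φ, c, σ, hφ, h1, h2⟩ | ⟨hp', R, φ, c, σ, hφ, h1, h2⟩
    · have hfφ : ∀ k, ∀ t ∈ Ico 0 r, f (φ k t) = ((c + σ k * t : ℝ) : EReal) := fun k t ht ↦ by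
        rw [hf _ (hT.ballNhds_leg hφ hp k ht), h1 k t ht]
      have hfp : f p = (c : EReal) := by
        rw [← hφ.center ⟨0, hφ.valence_pos⟩, hfφ _ 0 ⟨le_rfl, hφ.radius_pos⟩]; simp
      intro U hU
      rw [hfp] at hU
      obtain ⟨δ, hδ, hδU⟩ := Metric.mem_nhds_iff.1
        (continuous_coe_real_ereal.continuousAt (x := c) hU)
      obtain ⟨ρ, hρ, hρr, hball⟩ := hφ.exists_ball hp
      -- `B` bounds the slopes on all legs at once; `B + 1` avoids a division by zero.
      set B := ∑ k, |(σ k : ℝ)| with hB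
      have hB0 : 0 ≤ B := Finset.sum_nonneg fun k _ ↦ abs_nonneg _
      have hε : 0 < min ρ (δ / (B + 1)) := lt_min hρ (by positivity)
      refine mem_map.2 (mem_of_superset (hp.ball_mem hε) fun q hq ↦ ?_)
      obtain ⟨k, t, ht, rfl⟩ := hball q _ (min_le_left _ _) hq
      have htρ : t < ρ := ht.2.trans_le (min_le_left _ _)
      have htδ : t < δ / (B + 1) := ht.2.trans_le (min_le_right _ _)
      rw [mem_preimage, hfφ k t ⟨ht.1, htρ.trans_le hρr⟩]
      refine hδU (?_ : c + σ k * t ∈ Metric.ball c δ)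
      have h3 : |(σ k : ℝ)| ≤ B :=
        Finset.single_le_sum (f := fun k ↦ |(σ k : ℝ)|) (fun k _ ↦ abs_nonneg _)
          (Finset.mem_univ k)
      rw [Metric.mem_ball, Real.dist_eq, add_sub_cancel_left, abs_mul, abs_of_nonneg ht.1]
      rw [lt_div_iff₀ (by positivity)] at htδ
      nlinarith [ht.1]
    · exact absurd hp (hT.not_ballNhds hp' hφ)
  · obtain ⟨R, φ, c, σ, hφ, h1, h2, h3⟩ := hf' p hp
    intro U hU
    obtain ⟨S, hS⟩ := (h3.eventually hU).exists_forall_of_atTop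
    refine mem_map.2 (mem_of_superset (hφ.chart (max R S) (le_max_left _ _)).mem_nhds ?_)
    rintro q (rfl | ⟨t, ht, rfl⟩)
    · show f q ∈ U
      exact mem_of_mem_nhds hU
    · have ht' : max R S < t := ht
      have htR : R < t := (le_max_left _ _).trans_lt ht'
      rw [mem_preimage, hf _ (hT.ballNhds_ray hφ htR), h1 t htR]
      exact hS t ((le_max_right _ _).trans ht'.le)

theorem ballNhds_of_tendsto {p : T} (h : Tendsto (edist p) (𝓝 p) (𝓝 0))
    (h' : comap (edist p) (𝓝 0) ≤ 𝓝 p) : BallNhds p := by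
  intro U
  rw [le_antisymm (tendsto_iff_comap.1 h) h',
    (ENNReal.nhds_zero_basis.comap (edist p)).mem_iff]
  constructor
  · rintro ⟨ε, hε, h1⟩
    obtain ⟨δ, hδ, hδε⟩ := ENNReal.lt_iff_exists_nnreal_btwn.1 hε
    refine ⟨δ, by exact_mod_cast hδ, fun q hq ↦ h1 ?_⟩
    rw [ENNReal.ofReal_coe_nnreal] at hq
    exact hq.trans hδε
  · rintro ⟨ε, hε, h1⟩
    exact ⟨ENNReal.ofReal ε, ENNReal.ofReal_pos.2 hε, fun q hq ↦ h1 q hq⟩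

theorem IsMetricGraph.isCurve {X : Type*} [MetricSpace X] (h : IsMetricGraph X) : IsCurve X := by
  refine ⟨h.compact, inferInstance, h.connected, edist_self, edist_comm, edist_triangle,
    fun p ↦ Or.inl ⟨ballNhds_of_tendsto ?_ ?_, h.star p⟩⟩
  · have : Continuous (fun q ↦ edist p q) := continuous_const.edist continuous_id
    simpa using this.tendsto p
  · have : Tendsto id (comap (edist p) (𝓝 0)) (𝓝 p) := by
      rw [tendsto_iff_edist_tendsto_0]
      simpa only [id, edist_comm _ p] using tendsto_comap
    exact this

end Extension

/-! ### Tropical curves are curves -/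

namespace TropicalCurve

variable {X : Type*} {n : ℕ} (a : Fin n → X)

/-- The points of the graph. -/
def base (x : X) : TropicalCurve a := ⟨x, fun _ ↦ 0, fun _ h ↦ absurd rfl h⟩

/-- The points of the unbounded edges. -/
noncomputable def onEdge (u : Fin n) (t : ℝ≥0∞) : TropicalCurve a :=
  ⟨a u, fun v ↦ if v = u then t else 0, fun v hv ↦ by
    have hvu : v = u := by
      by_contra h
      exact hv (if_neg h)
    subst hvu
    exact ⟨rfl, fun w hw ↦ if_neg hw⟩⟩

variable {a}

theorem eq_onEdge {p : TropicalCurve a} {u : Fin n} (h : p.coord u ≠ 0) :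
    p = onEdge a u (p.coord u) := by
  obtain ⟨h1, h2⟩ := p.mem u h
  refine TropicalCurve.ext h1 (funext fun v ↦ ?_)
  by_cases hv : v = u
  · subst hv; exact (if_pos rfl).symm
  · rw [h2 v hv]; exact (if_neg hv).symm

theorem eq_base {p : TropicalCurve a} (h : ∀ u, p.coord u = 0) : p = base a p.foot :=
  TropicalCurve.ext rfl (funext h)

theorem onEdge_zero (u : Fin n) : onEdge a u 0 = base a (a u) :=
  TropicalCurve.ext rfl (funext fun _ ↦ ite_self 0)

theorem onEdge_coord_same (u : Fin n) (t : ℝ≥0∞) : (onEdge a u t).coord u = t :=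
  if_pos rfl

theorem onEdge_coord_of_ne {u v : Fin n} (h : v ≠ u) (t : ℝ≥0∞) : (onEdge a u t).coord v = 0 :=
  if_neg h

theorem ofReal_sub_add_ofReal_sub {s t : ℝ} (hs : 0 ≤ s) (ht : 0 ≤ t) :
    (ENNReal.ofReal s - ENNReal.ofReal t) + (ENNReal.ofReal t - ENNReal.ofReal s) =
      ENNReal.ofReal |s - t| := by
  rw [← ENNReal.ofReal_sub _ ht, ← ENNReal.ofReal_sub _ hs]
  rcases le_total s t with h | h
  · rw [ENNReal.ofReal_of_nonpos (sub_nonpos.2 h), zero_add, abs_sub_comm,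
      abs_of_nonneg (sub_nonneg.2 h)]
  · rw [ENNReal.ofReal_of_nonpos (sub_nonpos.2 h), add_zero, abs_of_nonneg (sub_nonneg.2 h)]

theorem image_onEdge_Ioi (u : Fin n) {S : ℝ} (hS : 0 ≤ S) :
    (fun t ↦ onEdge a u (ENNReal.ofReal t)) '' Ioi S =
      {q | ENNReal.ofReal S < q.coord u ∧ q.coord u < ⊤} := by
  ext q
  constructor
  · rintro ⟨t, ht, rfl⟩
    have ht' : S < t := ht
    simp only [mem_ofPred_eq, onEdge_coord_same]
    exact ⟨(ENNReal.ofReal_lt_ofReal_iff (hS.trans_lt ht')).2 ht', ENNReal.ofReal_lt_top⟩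
  · rintro ⟨h1, h2⟩
    refine ⟨(q.coord u).toReal, (ENNReal.ofReal_lt_iff_lt_toReal hS h2.ne).1 h1, ?_⟩
    beta_reduce
    rw [ENNReal.ofReal_toReal h2.ne, ← eq_onEdge (pos_of_gt h1).ne']

variable [MetricSpace X]

theorem edist_def (p q : TropicalCurve a) : edist p q = edist p.foot q.foot +
    ∑ u, ((p.coord u - q.coord u) + (q.coord u - p.coord u)) := rfl

theorem coord_le_edist (p q : TropicalCurve a) (u : Fin n) :
    (p.coord u - q.coord u) + (q.coord u - p.coord u) ≤ edist p q :=
  (Finset.single_le_sum (f := fun u ↦ (p.coord u - q.coord u) + (q.coord u - p.coord u))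
    (fun _ _ ↦ zero_le) (Finset.mem_univ u)).trans le_add_self

theorem edist_base_base (x y : X) : edist (base a x) (base a y) = edist x y := by
  rw [edist_def]; simp [base]

theorem edist_base_onEdge (x : X) (u : Fin n) (t : ℝ≥0∞) :
    edist (base a x) (onEdge a u t) = edist x (a u) + t := by
  rw [edist_def, Finset.sum_eq_single u]
  · rw [onEdge_coord_same]; simp [base, onEdge]
  · intro v _ hv
    rw [onEdge_coord_of_ne hv]; simp [base]
  · simp

theorem edist_onEdge_same (u : Fin n) (s t : ℝ≥0∞) :
    edist (onEdge a u s) (onEdge a u t) = (s - t) + (t - s) := by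
  rw [edist_def, Finset.sum_eq_single u]
  · rw [onEdge_coord_same, onEdge_coord_same]; simp [onEdge]
  · intro v _ hv
    rw [onEdge_coord_of_ne hv, onEdge_coord_of_ne hv]; simp
  · simp

theorem edist_onEdge_of_ne {u v : Fin n} (h : u ≠ v) (s t : ℝ≥0∞) :
    edist (onEdge a u s) (onEdge a v t) = edist (a u) (a v) + (s + t) := by
  rw [edist_def, Finset.sum_eq_add u v h]
  · rw [onEdge_coord_same, onEdge_coord_same, onEdge_coord_of_ne h, onEdge_coord_of_ne h.symm]
    simp [onEdge]
  · intro w _ hw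
    rw [onEdge_coord_of_ne hw.1, onEdge_coord_of_ne hw.2]; simp
  · simp
  · simp

theorem edist_comm' (p q : TropicalCurve a) : edist p q = edist q p := by
  rw [edist_def, edist_def, edist_comm]
  congr 1
  exact Finset.sum_congr rfl fun u _ ↦ add_comm _ _

theorem edist_triangle' (p q r : TropicalCurve a) : edist p r ≤ edist p q + edist q r := by
  rw [edist_def, edist_def, edist_def, add_add_add_comm, ← Finset.sum_add_distrib]
  refine add_le_add (edist_triangle _ _ _) (Finset.sum_le_sum fun u _ ↦ ?_)
  calc (p.coord u - r.coord u) + (r.coord u - p.coord u)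
      ≤ ((p.coord u - q.coord u) + (q.coord u - r.coord u)) +
        ((r.coord u - q.coord u) + (q.coord u - p.coord u)) :=
        add_le_add tsub_le_tsub_add_tsub tsub_le_tsub_add_tsub
    _ = _ := by ring

theorem isInducing : IsInducing (fun p : TropicalCurve a ↦ (p.foot, p.coord)) := ⟨rfl⟩

theorem continuous_foot : Continuous (foot : TropicalCurve a → X) :=
  continuous_fst.comp isInducing.continuous

theorem continuous_coord (u : Fin n) : Continuous fun p : TropicalCurve a ↦ p.coord u :=
  (continuous_apply u).comp (continuous_snd.comp isInducing.continuous)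

theorem continuous_base : Continuous (base a) :=
  isInducing.continuous_iff.2 (continuous_id.prodMk continuous_const)

theorem continuous_onEdge (u : Fin n) : Continuous (onEdge a u) := by
  refine isInducing.continuous_iff.2 (continuous_const.prodMk (continuous_pi fun v ↦ ?_))
  by_cases h : v = u
  · subst h
    exact continuous_id.congr fun t ↦ (onEdge_coord_same v t).symm
  · exact continuous_const.congr fun t ↦ (onEdge_coord_of_ne h t).symm

/-- The constraint `mem` is closed: for each `u`, either the coordinate vanishes, or the foot is `a
u` and the other coordinates vanish. Compactness is inherited from the product. -/
theorem isClosedEmbedding :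
    IsClosedEmbedding (fun p : TropicalCurve a ↦ (p.foot, p.coord)) := by
  refine ⟨⟨isInducing, fun p q h ↦ TropicalCurve.ext (Prod.ext_iff.1 h).1 (Prod.ext_iff.1 h).2⟩, ?_⟩
  have : range (fun p : TropicalCurve a ↦ (p.foot, p.coord)) =
      ⋂ u, ({q : X × (Fin n → ℝ≥0∞) | q.2 u = 0} ∪
        ({q | q.1 = a u} ∩ ⋂ v, ⋂ _ : v ≠ u, {q | q.2 v = 0})) := by
    ext q
    simp only [mem_range, mem_iInter, mem_union, mem_inter_iff, mem_ofPred_eq]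
    constructor
    · rintro ⟨p, rfl⟩ u
      by_cases h : p.coord u = 0
      · exact Or.inl h
      · exact Or.inr ⟨(p.mem u h).1, (p.mem u h).2⟩
    · intro h
      exact ⟨⟨q.1, q.2, fun u hu ↦ (h u).resolve_left hu⟩, rfl⟩
  rw [this]
  have hc : ∀ u, Continuous fun q : X × (Fin n → ℝ≥0∞) ↦ q.2 u := fun u ↦
    (continuous_apply u).comp continuous_snd
  exact isClosed_iInter fun u ↦ (isClosed_eq (hc u) continuous_const).union
    ((isClosed_eq continuous_fst continuous_const).inter
      (isClosed_iInter fun v ↦ isClosed_iInter fun _ ↦ isClosed_eq (hc v) continuous_const))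

/-- The distance controls the foot and every coordinate, and subtraction on `[0, ∞]` is continuous
at finite coordinates. This fails at points at infinity. -/
theorem ballNhds {p : TropicalCurve a} (hp : ∀ u, p.coord u ≠ ⊤) : BallNhds p := by
  refine ballNhds_of_tendsto ?_ ?_
  · have h1 : Tendsto (fun q : TropicalCurve a ↦ edist p.foot q.foot) (𝓝 p) (𝓝 0) := by
      have : Continuous fun q : TropicalCurve a ↦ edist p.foot q.foot :=
        continuous_const.edist continuous_foot
      simpa using this.tendsto p
    have h2 : Tendsto (fun q : TropicalCurve a ↦
        ∑ u, ((p.coord u - q.coord u) + (q.coord u - p.coord u))) (𝓝 p) (𝓝 (∑ _u : Fin n, 0)) := by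
      refine tendsto_finsetSum _ fun u _ ↦ ?_
      have h3 := (continuous_coord (a := a) u).tendsto p
      have h4 := (ENNReal.Tendsto.sub (tendsto_const_nhds (x := p.coord u)) h3
        (Or.inl (hp u))).add (ENNReal.Tendsto.sub h3 (tendsto_const_nhds (x := p.coord u))
        (Or.inl (hp u)))
      simpa using h4
    have h3 := h1.add h2
    rw [Finset.sum_const_zero, add_zero] at h3
    exact h3
  · rw [isInducing.nhds_eq_comap, ← tendsto_iff_comap]
    have h0 : Tendsto (edist p) (comap (edist p) (𝓝 0)) (𝓝 0) := tendsto_comap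
    refine Tendsto.prodMk_nhds ?_ (tendsto_pi_nhds.2 fun u ↦ ?_)
    · rw [tendsto_iff_edist_tendsto_0]
      refine tendsto_of_tendsto_of_tendsto_of_le_of_le tendsto_const_nhds h0
        (fun _ ↦ zero_le) fun q ↦ ?_
      beta_reduce
      rw [edist_comm, edist_def p q]
      exact le_self_add
    · rw [ENNReal.tendsto_nhds (hp u)]
      intro ε hε
      filter_upwards [h0.eventually (gt_mem_nhds hε)] with q hq
      have h1 := (coord_le_edist p q u).trans hq.le
      exact ⟨tsub_le_iff_left.2 (tsub_le_iff_right.1 (le_self_add.trans h1)),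
        tsub_le_iff_left.1 (le_add_self.trans h1)⟩

theorem edist_onEdge_ofReal (u : Fin n) {s t : ℝ} (hs : 0 ≤ s) (ht : 0 ≤ t) :
    edist (onEdge a u (ENNReal.ofReal s)) (onEdge a u (ENNReal.ofReal t)) =
      ENNReal.ofReal |s - t| := by
  rw [edist_onEdge_same, ofReal_sub_add_ofReal_sub hs ht]

theorem isRay (u : Fin n) :
    IsRay (onEdge a u ⊤) 0 (fun t ↦ onEdge a u (ENNReal.ofReal t)) := by
  refine ⟨fun S hS ↦ ⟨?_, ?_, ?_, ?_⟩, fun S hS ↦ ?_⟩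
  · intro s hs t ht
    exact edist_onEdge_ofReal u (le_trans hS (le_of_lt hs)) (le_trans hS (le_of_lt ht))
  · intro s hs
    rw [edist_onEdge_same, ENNReal.top_sub ENNReal.ofReal_ne_top, add_top]
  · exact ((continuous_onEdge u).tendsto ⊤).comp ENNReal.tendsto_ofReal_atTop
  · rw [image_onEdge_Ioi u hS]
    refine mem_of_superset ((isOpen_Ioi (a := ENNReal.ofReal S)).preimage
      (continuous_coord u) |>.mem_nhds ?_) ?_
    · rw [mem_preimage, onEdge_coord_same]; exact ENNReal.ofReal_lt_top
    · intro q hq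
      have hq' : ENNReal.ofReal S < q.coord u := hq
      by_cases h : q.coord u = ⊤
      · left
        rw [eq_onEdge (pos_of_gt hq').ne', h]
      · exact Or.inr ⟨hq', lt_top_iff_ne_top.2 h⟩
  · rw [image_onEdge_Ioi u hS]
    exact isOpen_Ioo.preimage (continuous_coord u)

theorem exists_star_onEdge (u : Fin n) {t : ℝ} (ht : 0 < t) :
    ∃ m r φ, IsStarChart (onEdge a u (ENNReal.ofReal t)) m r φ := by
  refine ⟨2, t, _, isStarChart_two_sided (γ := fun t ↦ onEdge a u (ENNReal.ofReal t)) ht ?_ ?_⟩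
  · intro s hs s' hs'
    exact edist_onEdge_ofReal u (by linarith [hs.1]) (by linarith [hs'.1])
  · have : (fun t ↦ onEdge a u (ENNReal.ofReal t)) '' Ioo (t - t) (t + t) =
        (fun q : TropicalCurve a ↦ q.coord u) ⁻¹' Ioo 0 (ENNReal.ofReal (t + t)) := by
      rw [sub_self]
      ext q
      constructor
      · rintro ⟨s, hs, rfl⟩
        simp only [mem_preimage, onEdge_coord_same]
        exact ⟨ENNReal.ofReal_pos.2 hs.1, (ENNReal.ofReal_lt_ofReal_iff (by linarith)).2 hs.2⟩
      · rintro ⟨h1, h2⟩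
        have h3 : q.coord u ≠ ⊤ := (h2.trans ENNReal.ofReal_lt_top).ne
        refine ⟨(q.coord u).toReal, ⟨ENNReal.toReal_pos (ne_of_gt h1) h3,
          (ENNReal.lt_ofReal_iff_toReal_lt h3).1 h2⟩, ?_⟩
        beta_reduce
        rw [ENNReal.ofReal_toReal h3, ← eq_onEdge (ne_of_gt h1)]
    rw [this]
    exact isOpen_Ioo.preimage (continuous_coord u)

/-- The star at `x` has the legs of the star in the graph and one further leg for each unbounded
edge attached at `x`. These edges are infinitely long, so the radius can be kept. -/
theorem exists_star_base {x : X} {m : ℕ} {r : ℝ} {φ : Fin m → ℝ → X} (h : IsStarChart x m r φ) :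
    ∃ m r φ, IsStarChart (base a x) m r φ := by
  classical
  let I := Fin m ⊕ {u // a u = x}
  let e : Fin (Fintype.card I) ≃ I := (Fintype.equivFin I).symm
  let ψ : I → ℝ → TropicalCurve a := Sum.elim (fun k t ↦ base a (φ k t))
    fun u t ↦ onEdge a u (ENNReal.ofReal t)
  have hmix : ∀ (k : Fin m) (u : {u // a u = x}), ∀ s ∈ Ico 0 r, ∀ t ∈ Ico 0 r,
      edist (base a (φ k s)) (onEdge a u (ENNReal.ofReal t)) = ENNReal.ofReal (s + t) := by
    intro k u s hs t ht
    rw [edist_base_onEdge, u.2, edist_comm, h.edist_center k hs, ENNReal.ofReal_add hs.1 ht.1]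
  refine ⟨Fintype.card I, r, fun k ↦ ψ (e k), ?_, h.radius_pos, ?_, ?_, ?_, ?_⟩
  · exact Fintype.card_pos_iff.2 ⟨Sum.inl ⟨0, h.valence_pos⟩⟩
  · intro k
    rcases e k with l | u
    · simp only [ψ, Sum.elim_inl, h.center]
    · simp only [ψ, Sum.elim_inr, ENNReal.ofReal_zero, onEdge_zero, u.2]
  · intro k s hs t ht
    rcases e k with l | u
    · simp only [ψ, Sum.elim_inl, edist_base_base]
      exact h.edist_same l s hs t ht
    · simp only [ψ, Sum.elim_inr]
      exact edist_onEdge_ofReal u.1 hs.1 ht.1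
  · intro k l hkl s hs t ht
    have hkl' : e k ≠ e l := fun h' ↦ hkl (e.injective h')
    revert hkl'
    rcases e k with k' | u <;> rcases e l with l' | v <;> intro hkl'
    · simp only [ψ, Sum.elim_inl, edist_base_base]
      exact h.edist_diff k' l' (fun h' ↦ hkl' (by rw [h'])) s hs t ht
    · simp only [ψ, Sum.elim_inl, Sum.elim_inr]
      exact hmix k' v s hs t ht
    · simp only [ψ, Sum.elim_inl, Sum.elim_inr]
      rw [edist_comm', hmix l' u t ht s hs, add_comm]
    · simp only [ψ, Sum.elim_inr]
      rw [edist_onEdge_of_ne fun h' ↦ hkl' (by rw [Subtype.ext h']), u.2, v.2, edist_self,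
        zero_add, ENNReal.ofReal_add hs.1 ht.1]
  · have h1 : ∀ᶠ q : TropicalCurve a in 𝓝 (base a x), ∃ k, ∃ t ∈ Ico 0 r, φ k t = q.foot :=
      (continuous_foot.tendsto (base a x)).eventually h.mem_nhds
    -- The foot of a nearby point avoids all attaching points other than `x`, so that point lies on
    -- no unbounded edge attached elsewhere.
    have h2 : ∀ᶠ q : TropicalCurve a in 𝓝 (base a x), ∀ u, a u ≠ x → q.foot ≠ a u := by
      refine eventually_all.2 fun u ↦ ?_
      by_cases hu : a u = x
      · exact Eventually.of_forall fun q h' ↦ absurd hu h'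
      · filter_upwards [(continuous_foot.tendsto (base a x)).eventually
          (isOpen_ne.mem_nhds (Ne.symm hu))] with q hq _ using hq
    have h3 : ∀ᶠ q : TropicalCurve a in 𝓝 (base a x), ∀ u, q.coord u < ENNReal.ofReal r :=
      eventually_all.2 fun u ↦ ((continuous_coord u).tendsto (base a x)).eventually
        (gt_mem_nhds (ENNReal.ofReal_pos.2 h.radius_pos))
    filter_upwards [h1, h2, h3] with q ⟨k, t, ht, hkt⟩ hq2 hq3
    by_cases hq : ∀ u, q.coord u = 0
    · refine ⟨e.symm (Sum.inl k), t, ht, ?_⟩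
      simp only [ψ, Equiv.apply_symm_apply, Sum.elim_inl, hkt]
      exact (eq_base hq).symm
    · obtain ⟨u, hu⟩ := not_forall.1 hq
      have hux : a u = x := by
        by_contra h'
        exact hq2 u h' (q.mem u hu).1
      have htop : q.coord u ≠ ⊤ := ((hq3 u).trans ENNReal.ofReal_lt_top).ne
      refine ⟨e.symm (Sum.inr ⟨u, hux⟩), (q.coord u).toReal, ⟨ENNReal.toReal_nonneg,
        (ENNReal.lt_ofReal_iff_toReal_lt htop).1 (hq3 u)⟩, ?_⟩
      simp only [ψ, Equiv.apply_symm_apply, Sum.elim_inr, ENNReal.ofReal_toReal htop]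
      exact (eq_onEdge hu).symm

theorem isCurve (h : IsMetricGraph X) (a : Fin n → X) : IsCurve (TropicalCurve a) := by
  have := h.compact
  have := h.connected
  refine ⟨isClosedEmbedding.compactSpace, isClosedEmbedding.isEmbedding.t2Space, ?_, ?_,
    edist_comm', edist_triangle', ?_⟩
  · obtain ⟨x⟩ : Nonempty X := inferInstance
    -- Each unbounded edge is connected and meets the connected base graph.
    have hpre : IsPreconnected (univ : Set (TropicalCurve a)) := by
      have hbase := isPreconnected_range (continuous_base (a := a))
      refine isPreconnected_of_forall (base a x) fun q _ ↦ ?_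
      by_cases hq : ∀ u, q.coord u = 0
      · exact ⟨_, subset_univ _, mem_range_self x, ⟨q.foot, (eq_base hq).symm⟩, hbase⟩
      · obtain ⟨u, hu⟩ := not_forall.1 hq
        refine ⟨range (base a) ∪ range (onEdge a u), subset_univ _, Or.inl (mem_range_self x),
          Or.inr ⟨_, (eq_onEdge hu).symm⟩, hbase.union' ?_
          (isPreconnected_range (continuous_onEdge u))⟩
        exact ⟨base a (a u), mem_range_self _, 0, onEdge_zero u⟩
    exact { toPreconnectedSpace := ⟨hpre⟩, toNonempty := ⟨base a x⟩ }
  · intro p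
    rw [edist_def]; simp
  · intro p
    by_cases hp : ∀ u, p.coord u ≠ ⊤
    · refine Or.inl ⟨ballNhds hp, ?_⟩
      by_cases hp0 : ∀ u, p.coord u = 0
      · obtain ⟨m, r, φ, hφ⟩ := h.star p.foot
        rw [eq_base hp0]
        exact exists_star_base hφ
      · obtain ⟨u, hu⟩ := not_forall.1 hp0
        rw [eq_onEdge hu, ← ENNReal.ofReal_toReal (hp u)]
        exact exists_star_onEdge u (ENNReal.toReal_pos hu (hp u))
    · obtain ⟨u, hu⟩ := not_forall.1 hp
      rw [not_not] at hu
      have hpu : p = onEdge a u ⊤ := by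
        have := eq_onEdge (p := p) (u := u) (by rw [hu]; exact ENNReal.top_ne_zero)
        rwa [hu] at this
      refine Or.inr ⟨fun x hx ↦ ?_, 0, _, hpu ▸ isRay u⟩
      have hxu : x.coord u ≠ ⊤ := by
        intro hxu
        apply hx
        rw [hpu, eq_onEdge (p := x) (u := u) (by rw [hxu]; exact ENNReal.top_ne_zero), hxu]
      have h1 := coord_le_edist x p u
      rw [hu, ENNReal.top_sub hxu, add_top] at h1
      exact top_le_iff.1 h1

end TropicalCurve

/-- The theorem for curves. -/
theorem IsCurve.exists_linEquiv {T : Type*} [TopologicalSpace T] [EDist T] (hT : IsCurve T)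
    {ι : RealStructure T} (hM : ι.IsM) (D : T →₀ ℤ) (hD : ι.IsRealDivisor D)
    (hD' : IsEffective D) :
    ∃ D' : T →₀ ℤ, ι.IsTotallyReal D' ∧ IsEffective D' ∧ LinEquiv D D' := by
  obtain ⟨D', h1, h2, h3⟩ := hT.exists_totallyReal hM D hD hD'
  exact ⟨D', h1, h2, h3.linEquiv hT⟩

end RealTropical

theorem theorem5 :
    (∀ (X : Type*) [MetricSpace X], RealTropical.IsMetricGraph X →
      ∀ ι : RealTropical.RealStructure X, ι.IsM →
      ∀ D : X →₀ ℤ, ι.IsRealDivisor D → RealTropical.IsEffective D →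
      ∃ D' : X →₀ ℤ, ι.IsTotallyReal D' ∧ RealTropical.IsEffective D' ∧
        RealTropical.LinEquiv D D') ∧
    (∀ (X : Type*) [MetricSpace X], RealTropical.IsMetricGraph X →
      ∀ (n : ℕ) (a : Fin n → X),
      ∀ ι : RealTropical.RealStructure (RealTropical.TropicalCurve a), ι.IsM →
      ∀ D : RealTropical.TropicalCurve a →₀ ℤ,
        ι.IsRealDivisor D → RealTropical.IsEffective D →
      ∃ D' : RealTropical.TropicalCurve a →₀ ℤ,
        ι.IsTotallyReal D' ∧ RealTropical.IsEffective D' ∧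
        RealTropical.LinEquiv D D') := by
  refine ⟨fun X _ hX ι hM D hD hD' ↦ hX.isCurve.exists_linEquiv hM D hD hD', ?_⟩
  intro X _ hX n a ι hM D hD hD'
  exact (RealTropical.TropicalCurve.isCurve hX a).exists_linEquiv hM D hD hD'
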